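/- Let $N\ge 3$ and let $\mathbb{H}^N$ be $N$-dimensional hyperbolic space with a fixed pole $o$, volume $dv$ and geodesic polar coordinates $(r,\sigma)\in(0,\infty)\times\mathbb{S}^{N-1}$ about $o$, in which the metric is $dr^2+\sinh^2 r\,d\omega^2$. Put $$\Delta_r u=\frac{\partial^2u}{\partial r^2}+(N-1)\coth r\,\frac{\partial u}{\partial r},\qquad \nabla_r u=\Big(\frac{\partial u}{\partial r},0\Big),$$ and for an integer $j\ge 0$ let $\nabla_r^{j}=\Delta_r^{j/2}$ if $j$ is even and $\nabla_r^{j}=\nabla_r\Delta_r^{(j-1)/2}$ if $j$ is odd. Let $H^k(\mathbb{H}^N)\subset L^2(\mathbb{H}^N)$ be the completion of $C_c^\infty(\mathbb{H}^N)$ (real-valued functions) for the norm $\big(\sum_{j\le k}\int_{\mathbb{H}^N}|\nabla^j u|^2\,dv\big)^{1/2}$, where $\nabla^j$ is the $j$-th covariant derivative. For $u\in H^k(\mathbb{H}^N)$ the functions $\nabla_r^j u$ are understood in the weak sense on $\mathbb{H}^N\setminus\{o\}$, and integrals of squares take values in $[0,\infty]$. Let $0\le l<k$ be integers. Then: 1.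 For every $u\in H^k(\mathbb{H}^N)$ with $\int_{\mathbb{H}^N}|\nabla_r^{j}u|^2\,dv<\infty$ for all $0\le j<k$, $$\int_{\mathbb{H}^N}|\nabla_r^{k}u|^2\,dv\;\ge\;\Big(\frac{N-1}{2}\Big)^{2(k-l)}\int_{\mathbb{H}^N}|\nabla_r^{l}u|^2\,dv .$$ 2. If $2k\le N+1$ (in particular if $k\le 2$), then $\int_{\mathbb{H}^N}|\nabla_r^{j}u|^2\,dv<\infty$ for all $u\in H^k(\mathbb{H}^N)$ and all $0\le j\le k$, so that the inequality in 1. holds for every $u\in H^k(\mathbb{H}^N)$. 3. The constant is optimal: for every real $\Lambda>\big(\frac{N-1}{2}\big)^{2(k-l)}$ there is $u\in H^k(\mathbb{H}^N)$ with $\int_{\mathbb{H}^N}|\nabla_r^{j}u|^2\,dv<\infty$ for all $0\le j\le k$ and $$\int_{\mathbb{H}^N}|\nabla_r^{k}u|^2\,dv\;<\;\Lambda\int_{\mathbb{H}^N}|\nabla_r^{l}u|^2\,dv .$$ -/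

import Mathlib

open MeasureTheory Filter Topology
open scoped ENNReal ContDiff

/-! Hyperbolic space of dimension `N` is realized as the Poincaré ball: the open unit ball of
`ℝ^N` with the metric `(2 / (1 - ‖x‖ ^ 2)) ^ 2 |dx|^2`. The pole `o` is the centre `0`. Functions
on hyperbolic space are functions on `ℝ^N`, of which only the restriction to the unit ball
matters. -/

noncomputable section

namespace HypRadial

/-- The ambient coordinate space of the Poincaré ball. -/
abbrev Coord (N : ℕ) : Type := EuclideanSpace ℝ (Fin N)

/-- The Riemannian volume `(2 / (1 - ‖x‖ ^ 2)) ^ N dx` of the Poincaré ball. -/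
def hypVol (N : ℕ) : Measure (Coord N) :=
  (volume.restrict (Metric.ball (0 : Coord N) 1)).withDensity
    (fun x => ENNReal.ofReal ((2 / (1 - ‖x‖ ^ 2)) ^ N))

/-- `C_c^∞` functions on an open subset `U` of the Poincaré ball. -/
def IsTest {N : ℕ} (U : Set (Coord N)) (φ : Coord N → ℝ) : Prop :=
  ContDiff ℝ ∞ φ ∧ HasCompactSupport φ ∧ tsupport φ ⊆ U

/-! ### The Sobolev space `H^k` -/

/-- Christoffel symbol `Γ^m_{ij}` of the Levi-Civita connection of the Poincaré metric. -/
def christoffel {N : ℕ} (x : Coord N) (m i j : Fin N) : ℝ :=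
  2 / (1 - ‖x‖ ^ 2) *
    ((if m = i then x j else 0) + (if m = j then x i else 0) - (if i = j then x m else 0))

/-- Covariant derivative of a covariant tensor field of rank `j` in the ball coordinates; the new
index (the direction of differentiation) is put in front. -/
def covDeriv {N j : ℕ} (T : Coord N → (Fin j → Fin N) → ℝ) :
    Coord N → (Fin (j + 1) → Fin N) → ℝ :=
  fun x I =>
    fderiv ℝ (fun y => T y (fun s => I s.succ)) x (EuclideanSpace.single (I 0) 1)
      - ∑ s : Fin j, ∑ m : Fin N,
          christoffel x m (I 0) (I s.succ) * T x (Function.update (fun t => I t.succ) s m)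

/-- The `j`-th covariant derivative of a function. -/
def iterCovDeriv {N : ℕ} (u : Coord N → ℝ) : (j : ℕ) → Coord N → (Fin j → Fin N) → ℝ
  | 0 => fun x _ => u x
  | j + 1 => covDeriv (iterCovDeriv u j)

/-- The squared Riemannian norm of the `j`-th covariant derivative at `x`; the inverse metric is
`((1 - ‖x‖ ^ 2) / 2) ^ 2` times the identity. -/
def covNormSq {N : ℕ} (j : ℕ) (u : Coord N → ℝ) (x : Coord N) : ℝ :=
  ((1 - ‖x‖ ^ 2) / 2) ^ (2 * j) * ∑ I : Fin j → Fin N, iterCovDeriv u j x I ^ 2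

/-- `u` belongs to `H^k` of hyperbolic space, the completion of `C_c^∞` for the norm
`(∑_{j ≤ k} ∫ |∇^j u|^2)^{1/2}`, realized inside `L^2`. -/
def MemSobolev (N k : ℕ) (u : Coord N → ℝ) : Prop :=
  MemLp u 2 (hypVol N) ∧
    ∃ v : ℕ → Coord N → ℝ,
      (∀ n, IsTest (Metric.ball 0 1) (v n)) ∧
      Tendsto (fun n => eLpNorm (v n - u) 2 (hypVol N)) atTop (𝓝 0) ∧
      ∀ j ≤ k, Tendsto
        (fun p : ℕ × ℕ => ∫⁻ x, ENNReal.ofReal (covNormSq j (v p.1 - v p.2) x) ∂(hypVol N))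
        atTop (𝓝 0)

/-! ### Radial operators -/

/-- Geodesic distance to the pole. -/
def hypRadius {N : ℕ} (x : Coord N) : ℝ := 2 * Real.artanh ‖x‖

/-- The point with geodesic polar coordinates `(s, σ)`. -/
def polar {N : ℕ} (s : ℝ) (σ : Coord N) : Coord N := Real.tanh (s / 2) • σ

/-- `∂u/∂r` in geodesic polar coordinates. -/
def radialDeriv {N : ℕ} (u : Coord N → ℝ) (x : Coord N) : ℝ :=
  deriv (fun s => u (polar s (‖x‖⁻¹ • x))) (hypRadius x)

/-- `(N - 1) coth r`. -/
def meanCurv {N : ℕ} (x : Coord N) : ℝ :=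
  ((N : ℝ) - 1) * (Real.cosh (hypRadius x) / Real.sinh (hypRadius x))

/-- Radial Laplacian `∂²u/∂r² + (N - 1) coth r ∂u/∂r`. -/
def radialLaplacian {N : ℕ} (u : Coord N → ℝ) (x : Coord N) : ℝ :=
  radialDeriv (radialDeriv u) x + meanCurv x * radialDeriv u x

/-- Formal adjoint of `∂/∂r` with respect to the hyperbolic volume. -/
def radialDerivAdj {N : ℕ} (φ : Coord N → ℝ) (x : Coord N) : ℝ :=
  -(radialDeriv φ x + meanCurv x * φ x)

/-- Formal adjoint, with respect to the hyperbolic volume, of the operator `∇_r^k` that is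
`Δ_r^{k/2}` for even `k` and `∂/∂r Δ_r^{(k-1)/2}` (the only component of `∇_r Δ_r^{(k-1)/2}`) for
odd `k`. The operator `Δ_r` is formally self-adjoint away from the pole. -/
def radialGradAdj {N : ℕ} (k : ℕ) (φ : Coord N → ℝ) : Coord N → ℝ :=
  if Even k then radialLaplacian^[k / 2] φ else radialLaplacian^[k / 2] (radialDerivAdj φ)

/-- `w` is the weak `∇_r^k u` on hyperbolic space minus the pole: `∫ w φ = ∫ u (∇_r^k)^* φ` for
all `φ ∈ C_c^∞` supported off the pole. -/
def HasWeakRadialGrad {N : ℕ} (k : ℕ) (u w : Coord N → ℝ) : Prop :=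
  LocallyIntegrableOn w (Metric.ball 0 1 \ {0}) (hypVol N) ∧
    ∀ φ : Coord N → ℝ, IsTest (Metric.ball 0 1 \ {0}) φ →
      ∫ x, w x * φ x ∂(hypVol N) = ∫ x, u x * radialGradAdj k φ x ∂(hypVol N)

/-- `∫ |∇_r^k u|^2 dv` in `[0, ∞]`, with `∇_r^k u` understood weakly. The weak `∇_r^k u` is unique
up to null sets, so the infimum runs over a single value; it is `∞` if there is no weak
`∇_r^k u`. -/
def radialEnergy {N : ℕ} (k : ℕ) (u : Coord N → ℝ) : ℝ≥0∞ :=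
  ⨅ (w : Coord N → ℝ) (_ : HasWeakRadialGrad k u w), ∫⁻ x, ENNReal.ofReal (w x ^ 2) ∂(hypVol N)

end HypRadial

end

/-!
All three assertions reduce to one-dimensional statements on the rays issuing from the pole, on
which the hyperbolic volume is `sinh^{N-1} s ds`.

*The inequality.* The operator `∇_r^k` is a composition of first order steps, alternately `∂/∂r`
and `∂/∂r + (N - 1) coth r = sinh^{1-N} r ∂/∂r sinh^{N-1} r`, so it suffices to show that each
step increases the `L²` norm by a factor `(N - 1) / 2` at least (`poincare_step`). A weak identity
off the pole, tested with functions in separated variables, says that on almost every ray the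
restriction of the function is locally absolutely continuous (`ae_ray_weak`,
`exists_isRayTest_locallyAC`). On a ray one expands `∫ (f' ± c f)² V ≥ 0` with `c = (N - 1) / 2`,
where `V = sinh^{N-1}` for the first kind of step and `V = sinh^{1-N}` for the second, applied to
`sinh^{N-1} f`; in both cases `2 c V ≤ |V'|`. For `V = sinh^{N-1}` the boundary term at `0` has
the right sign and the one at infinity vanishes along a sequence (`sinh_pow_poincare`). For `V =
sinh^{1-N}` it is the term at infinity that has the right sign, and the one at `0` vanishes
because `1 / sinh^{N-1}` is not integrable there (`inv_sinh_pow_poincare`).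

*Finiteness.* Rays are geodesics, so the `j`-th derivative of a function along a ray is its `j`-th
covariant derivative evaluated on the unit radial vector and is bounded by the norm of the latter
(`iteratedDeriv_ray`). The radial gradient of order `j ≥ 1` is a combination of terms `coth^b
f^{(i)}` with `i ≥ 1` and `b + i ≤ j` (`exists_rayOp_rayGrad`). Hardy's inequality trades each
factor `coth` for a derivative as long as the power of `sinh` in the weight stays nonnegative; at
most `j - 1` factors have to be removed, which is possible for `2 j ≤ N + 1`
(`hardy_coth_iterate`). Hence `∇_r^j` is bounded from `H^k` to `L²` on test functions, and the
bound passes to the completion (`radialEnergy_lt_top_of_memSobolev`).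

*Optimality.* For the radial function `e^{-(N-1) r / 2} χ(ε r)`, with `χ` a bump function
supported in `[1, 2]`, both kinds of steps act for small `ε` as multiplication by `∓ (N - 1) / 2`,
since `coth r → 1` on the support; after rescaling, the energies of orders `k` and `l` have limits
whose quotient is `((N - 1) / 2)^{2 (k - l)}` (`tendsto_lintegral_rayGrad_slowProfile`).
-/

noncomputable section

namespace HypRadial

/-! ### Geodesic polar coordinates and the radial derivative -/

/-- Hyperbolic space with the pole removed. -/
abbrev puncturedBall (N : ℕ) : Set (Coord N) := Metric.ball 0 1 \ {0}

theorem isOpen_puncturedBall (N : ℕ) : IsOpen (puncturedBall N) :=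
  Metric.isOpen_ball.sdiff isClosed_singleton

theorem hasDerivAt_tanh_half (s : ℝ) :
    HasDerivAt (fun s : ℝ => Real.tanh (s / 2)) ((1 - Real.tanh (s / 2) ^ 2) / 2) s := by
  have hc : Real.cosh (s / 2) ≠ 0 := (Real.cosh_pos _).ne'
  have h1 : HasDerivAt (fun s : ℝ => s / 2) (1 / 2) s := (hasDerivAt_id s).div_const 2
  have h := (h1.sinh).div (h1.cosh) hc
  have e : (fun s : ℝ => Real.tanh (s / 2)) =
      (fun s : ℝ => Real.sinh (s / 2)) / fun s => Real.cosh (s / 2) := by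
    funext s; simp [Real.tanh_eq_sinh_div_cosh]
  rw [e]
  refine h.congr_deriv ?_
  rw [Real.tanh_eq_sinh_div_cosh]
  field_simp

theorem contDiff_tanh_half : ContDiff ℝ ∞ (fun s : ℝ => Real.tanh (s / 2)) := by
  simp only [Real.tanh_eq_sinh_div_cosh]
  exact ContDiff.div (by fun_prop) (by fun_prop) fun s => (Real.cosh_pos _).ne'

theorem tanh_half_lt_one (s : ℝ) : Real.tanh (s / 2) < 1 :=
  (Real.tanh_bijOn.mapsTo (Set.mem_univ (s / 2))).2

theorem neg_one_lt_tanh_half (s : ℝ) : -1 < Real.tanh (s / 2) :=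
  (Real.tanh_bijOn.mapsTo (Set.mem_univ (s / 2))).1

theorem tanh_half_pos {s : ℝ} (hs : 0 < s) : 0 < Real.tanh (s / 2) := by
  rw [Real.tanh_eq_sinh_div_cosh]
  exact div_pos (Real.sinh_pos_iff.2 (by linarith)) (Real.cosh_pos _)

variable {N : ℕ}

theorem norm_polar {s : ℝ} (hs : 0 < s) {σ : Coord N} (hσ : ‖σ‖ = 1) :
    ‖polar s σ‖ = Real.tanh (s / 2) := by
  rw [polar, norm_smul, hσ, mul_one, Real.norm_of_nonneg (tanh_half_pos hs).le]

theorem polar_mem_ball (s : ℝ) {σ : Coord N} (hσ : ‖σ‖ = 1) :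
    polar s σ ∈ Metric.ball (0 : Coord N) 1 := by
  rw [mem_ball_zero_iff, polar, norm_smul, hσ, mul_one, Real.norm_eq_abs, abs_lt]
  exact ⟨neg_one_lt_tanh_half s, tanh_half_lt_one s⟩

theorem polar_mem_puncturedBall {s : ℝ} (hs : 0 < s) {σ : Coord N} (hσ : ‖σ‖ = 1) :
    polar s σ ∈ puncturedBall N := by
  refine ⟨polar_mem_ball s hσ, fun h => ?_⟩
  have h1 := norm_polar hs hσ
  rw [Set.mem_singleton_iff.1 h, norm_zero] at h1
  exact (tanh_half_pos hs).ne h1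

theorem hypRadius_polar {s : ℝ} (hs : 0 < s) {σ : Coord N} (hσ : ‖σ‖ = 1) :
    hypRadius (polar s σ) = s := by
  rw [hypRadius, norm_polar hs hσ, Real.artanh_tanh]; ring

theorem direction_polar {s : ℝ} (hs : 0 < s) {σ : Coord N} (hσ : ‖σ‖ = 1) :
    ‖polar s σ‖⁻¹ • polar s σ = σ := by
  rw [norm_polar hs hσ, polar, smul_smul, inv_mul_cancel₀ (tanh_half_pos hs).ne', one_smul]

theorem norm_direction {x : Coord N} (hx : x ≠ 0) : ‖‖x‖⁻¹ • x‖ = 1 := by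
  rw [norm_smul, norm_inv, norm_norm, inv_mul_cancel₀ (norm_ne_zero_iff.2 hx)]

theorem hypRadius_pos {x : Coord N} (hx : x ∈ puncturedBall N) : 0 < hypRadius x := by
  have h1 : ‖x‖ < 1 := mem_ball_zero_iff.1 hx.1
  have h2 : 0 < ‖x‖ := norm_pos_iff.2 hx.2
  have := Real.artanh_pos ⟨h2, h1⟩
  rw [hypRadius]; linarith

theorem polar_hypRadius {x : Coord N} (hx : x ∈ puncturedBall N) :
    polar (hypRadius x) (‖x‖⁻¹ • x) = x := by
  have h1 : ‖x‖ < 1 := mem_ball_zero_iff.1 hx.1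
  have h2 : 0 < ‖x‖ := norm_pos_iff.2 hx.2
  rw [polar, hypRadius, mul_div_cancel_left₀ _ two_ne_zero,
    Real.tanh_artanh ⟨by linarith, h1⟩, smul_smul, mul_inv_cancel₀ h2.ne', one_smul]

/-- Every point off the pole has polar coordinates. -/
theorem exists_eq_polar {x : Coord N} (hx : x ∈ puncturedBall N) :
    ∃ s σ, 0 < s ∧ ‖σ‖ = 1 ∧ polar s σ = x :=
  ⟨_, _, hypRadius_pos hx, norm_direction hx.2, polar_hypRadius hx⟩

/-- The junk value of `artanh` off `(-1, 1)` puts the complement of the ball at radius `0`. -/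
theorem hypRadius_eq_zero {x : Coord N} (hx : x ∉ puncturedBall N) : hypRadius x = 0 := by
  rw [hypRadius, mul_eq_zero, Real.artanh_eq_zero_iff]
  by_cases h : x = 0
  · simp [h]
  · refine Or.inr (Or.inr (Or.inr ?_))
    by_contra h'
    exact hx ⟨mem_ball_zero_iff.2 (not_le.1 h'), h⟩

theorem hasDerivAt_polar (s : ℝ) (σ : Coord N) :
    HasDerivAt (fun s => polar s σ) (((1 - Real.tanh (s / 2) ^ 2) / 2) • σ) s :=
  (hasDerivAt_tanh_half s).smul_const σ

theorem contDiff_polar (σ : Coord N) : ContDiff ℝ ∞ (fun s => polar s σ) :=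
  contDiff_tanh_half.smul contDiff_const

theorem radialDeriv_polar (u : Coord N → ℝ) {s : ℝ} (hs : 0 < s) {σ : Coord N} (hσ : ‖σ‖ = 1) :
    radialDeriv u (polar s σ) = deriv (fun s => u (polar s σ)) s := by
  rw [radialDeriv, direction_polar hs hσ, hypRadius_polar hs hσ]

theorem meanCurv_polar {s : ℝ} (hs : 0 < s) {σ : Coord N} (hσ : ‖σ‖ = 1) :
    meanCurv (polar s σ) = ((N : ℝ) - 1) * (Real.cosh s / Real.sinh s) := by
  rw [meanCurv, hypRadius_polar hs hσ]

/-- Functions agreeing on the ball off the pole have the same radial derivative there. -/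
theorem radialDeriv_congr {u v : Coord N → ℝ} (h : Set.EqOn u v (puncturedBall N)) :
    Set.EqOn (radialDeriv u) (radialDeriv v) (puncturedBall N) := by
  intro x hx
  obtain ⟨s, σ, hs, hσ, rfl⟩ := exists_eq_polar hx
  rw [radialDeriv_polar u hs hσ, radialDeriv_polar v hs hσ]
  refine Filter.EventuallyEq.deriv_eq ?_
  filter_upwards [lt_mem_nhds hs] with t ht using h (polar_mem_puncturedBall ht hσ)

theorem radialDeriv_eq_fderiv {u : Coord N → ℝ} {x : Coord N} (hx : x ∈ puncturedBall N)
    (hu : DifferentiableAt ℝ u x) :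
    radialDeriv u x = (1 - ‖x‖ ^ 2) / 2 * fderiv ℝ u x (‖x‖⁻¹ • x) := by
  obtain ⟨s, σ, hs, hσ, rfl⟩ := exists_eq_polar hx
  rw [radialDeriv_polar u hs hσ, direction_polar hs hσ, norm_polar hs hσ]
  have h := hu.hasFDerivAt.comp_hasDerivAt s (hasDerivAt_polar s σ)
  rw [map_smul, smul_eq_mul] at h
  exact h.deriv

theorem contDiffOn_radialDeriv {u : Coord N → ℝ} (hu : ContDiffOn ℝ ∞ u (puncturedBall N)) :
    ContDiffOn ℝ ∞ (radialDeriv u) (puncturedBall N) := by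
  have ho := isOpen_puncturedBall N
  have h1 : ContDiffOn ℝ ∞ (fun x => (1 - ‖x‖ ^ 2) / 2 * fderiv ℝ u x (‖x‖⁻¹ • x))
      (puncturedBall N) := by
    have hn : ContDiffOn ℝ ∞ (fun x : Coord N => ‖x‖) (puncturedBall N) :=
      contDiffOn_id.norm ℝ fun _ hx => hx.2
    refine ContDiffOn.mul ?_ (ContDiffOn.clm_apply (hu.fderiv_of_isOpen ho (by simp)) ?_)
    · exact (contDiffOn_const.sub (hn.pow 2)).div_const 2
    · exact (hn.inv fun _ hx => norm_ne_zero_iff.2 hx.2).smul contDiffOn_id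
  exact h1.congr fun x hx => radialDeriv_eq_fderiv hx
    ((hu.contDiffAt (ho.mem_nhds hx)).differentiableAt (by simp))

theorem contDiffOn_hypRadius : ContDiffOn ℝ ∞ (hypRadius (N := N)) (puncturedBall N) := by
  have hn : ContDiffOn ℝ ∞ (fun x : Coord N => ‖x‖) (puncturedBall N) :=
    contDiffOn_id.norm ℝ fun _ hx => hx.2
  have h1 : ContDiffOn ℝ ∞ (fun x : Coord N => Real.log ((1 + ‖x‖) / (1 - ‖x‖)))
      (puncturedBall N) := by
    have hlt : ∀ x ∈ puncturedBall N, ‖x‖ < 1 := fun x hx => mem_ball_zero_iff.1 hx.1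
    refine ContDiffOn.log ((contDiffOn_const.add hn).div (contDiffOn_const.sub hn) ?_) ?_
    · intro x hx; have := hlt x hx; linarith
    · intro x hx
      have := hlt x hx
      have h0 := norm_nonneg x
      have : 0 < (1 + ‖x‖) / (1 - ‖x‖) := div_pos (by linarith) (by linarith)
      exact this.ne'
  refine h1.congr fun x hx => ?_
  have hlt : ‖x‖ < 1 := mem_ball_zero_iff.1 hx.1
  rw [hypRadius, Real.artanh_eq_half_log ⟨by linarith [norm_nonneg x], hlt.le⟩]
  ring

theorem contDiffOn_meanCurv : ContDiffOn ℝ ∞ (meanCurv (N := N)) (puncturedBall N) := by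
  have h := contDiffOn_hypRadius (N := N)
  refine ContDiffOn.mul contDiffOn_const (ContDiffOn.div h.cosh h.sinh fun _ hx => ?_)
  exact (Real.sinh_pos_iff.2 (hypRadius_pos hx)).ne'

/-! ### Test functions off the pole -/

/-- Smoothness off the pole is enough for a function whose support lies in a compact set off the
pole. -/
theorem isTest_of_contDiffOn {ψ : Coord N → ℝ} {K : Set (Coord N)} (hK : IsCompact K)
    (hKs : K ⊆ puncturedBall N) (hψ : ContDiffOn ℝ ∞ ψ (puncturedBall N))
    (hs : Function.support ψ ⊆ K) : IsTest (puncturedBall N) ψ := by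
  have hts : tsupport ψ ⊆ K := closure_minimal hs hK.isClosed
  refine ⟨?_, hK.of_isClosed_subset (isClosed_tsupport ψ) hts, hts.trans hKs⟩
  refine contDiff_iff_contDiffAt.2 fun x => ?_
  by_cases hx : x ∈ tsupport ψ
  · exact hψ.contDiffAt ((isOpen_puncturedBall N).mem_nhds (hKs (hts hx)))
  · have : ψ =ᶠ[𝓝 x] fun _ => 0 := notMem_tsupport_iff_eventuallyEq.1 hx
    exact contDiffAt_const.congr_of_eventuallyEq this

/-- A function that is smooth off the pole and whose support lies in the support of a test
function is itself a test function. -/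
theorem IsTest.of_support {φ ψ : Coord N → ℝ} (hφ : IsTest (puncturedBall N) φ)
    (hψ : ContDiffOn ℝ ∞ ψ (puncturedBall N)) (hs : Function.support ψ ⊆ tsupport φ) :
    IsTest (puncturedBall N) ψ :=
  isTest_of_contDiffOn hφ.2.1 hφ.2.2 hψ hs

theorem IsTest.mul_left {φ a : Coord N → ℝ} (hφ : IsTest (puncturedBall N) φ)
    (ha : ContDiffOn ℝ ∞ a (puncturedBall N)) : IsTest (puncturedBall N) (fun x => a x * φ x) :=
  hφ.of_support (ha.mul hφ.1.contDiffOn) fun _ hx =>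
    subset_tsupport _ (right_ne_zero_of_mul hx)

theorem IsTest.neg {U : Set (Coord N)} {φ : Coord N → ℝ} (hφ : IsTest U φ) :
    IsTest U (fun x => -φ x) := by
  have h : tsupport (fun x => -φ x) = tsupport φ := by
    rw [tsupport, tsupport]; congr 1; ext x; simp
  refine ⟨hφ.1.neg, ?_, h ▸ hφ.2.2⟩
  have := hφ.2.1
  rw [HasCompactSupport] at this ⊢
  rwa [h]

theorem IsTest.add {U : Set (Coord N)} {φ ψ : Coord N → ℝ} (hφ : IsTest U φ) (hψ : IsTest U ψ) :
    IsTest U (fun x => φ x + ψ x) :=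
  ⟨hφ.1.add hψ.1, hφ.2.1.add hψ.2.1,
    (tsupport_add φ ψ).trans (Set.union_subset hφ.2.2 hψ.2.2)⟩

theorem IsTest.sub {U : Set (Coord N)} {φ ψ : Coord N → ℝ} (hφ : IsTest U φ) (hψ : IsTest U ψ) :
    IsTest U (φ - ψ) := by
  have := hφ.add hψ.neg
  simp only [← sub_eq_add_neg] at this
  exact this

theorem IsTest.eq_zero {U : Set (Coord N)} {φ : Coord N → ℝ} (hφ : IsTest U φ) {x : Coord N}
    (hx : x ∉ U) : φ x = 0 :=
  image_eq_zero_of_notMem_tsupport fun h => hx (hφ.2.2 h)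

theorem IsTest.radialDeriv {φ : Coord N → ℝ} (hφ : IsTest (puncturedBall N) φ) :
    IsTest (puncturedBall N) (radialDeriv φ) := by
  refine hφ.of_support (contDiffOn_radialDeriv hφ.1.contDiffOn) fun x hx => ?_
  by_contra h
  refine hx ?_
  -- `φ` vanishes near the point at which the derivative is taken: this is `x` itself for `x` in
  -- the punctured ball, and the pole otherwise.
  have key : polar (hypRadius x) (‖x‖⁻¹ • x) ∉ tsupport φ := by
    by_cases hxb : x ∈ puncturedBall N
    · rwa [polar_hypRadius hxb]
    · rw [hypRadius_eq_zero hxb, polar]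
      simpa using fun h0 => (hφ.2.2 h0).2 rfl
  have h2 : ∀ᶠ s in 𝓝 (hypRadius x), φ (polar s (‖x‖⁻¹ • x)) = 0 :=
    (contDiff_polar (‖x‖⁻¹ • x)).continuous.continuousAt.eventually
      (notMem_tsupport_iff_eventuallyEq.1 key)
  have h3 : (fun s => φ (polar s (‖x‖⁻¹ • x))) =ᶠ[𝓝 (hypRadius x)] fun _ => 0 := h2
  rw [HypRadial.radialDeriv, h3.deriv_eq, deriv_const]

theorem IsTest.radialDerivAdj {φ : Coord N → ℝ} (hφ : IsTest (puncturedBall N) φ) :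
    IsTest (puncturedBall N) (radialDerivAdj φ) :=
  (hφ.radialDeriv.add (hφ.mul_left contDiffOn_meanCurv)).neg

/-- The adjoint of the `j`-th factor in the factorization of `∇_r^k` into first order operators:
`(∂/∂r)^*` for even `j`, and `-∂/∂r`, the adjoint of `∂/∂r + (N - 1) coth r`, for odd `j`. -/
def gradStepAdj (j : ℕ) (φ : Coord N → ℝ) : Coord N → ℝ :=
  if Even j then radialDerivAdj φ else fun x => -radialDeriv φ x

theorem IsTest.gradStepAdj {φ : Coord N → ℝ} (hφ : IsTest (puncturedBall N) φ) (j : ℕ) :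
    IsTest (puncturedBall N) (gradStepAdj j φ) := by
  unfold HypRadial.gradStepAdj
  split_ifs
  · exact hφ.radialDerivAdj
  · exact hφ.radialDeriv.neg

theorem radialDerivAdj_neg_radialDeriv (φ : Coord N → ℝ) :
    radialDerivAdj (fun x => -radialDeriv φ x) = radialLaplacian φ := by
  funext x
  have h : radialDeriv (fun x => -radialDeriv φ x) x = -radialDeriv (radialDeriv φ) x := by
    rw [radialDeriv, radialDeriv, deriv.fun_neg]
  rw [radialDerivAdj, h, radialLaplacian]; ring

theorem radialGradAdj_zero (φ : Coord N → ℝ) : radialGradAdj 0 φ = φ := by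
  simp [radialGradAdj]

/-- The adjoint of `∇_r^{j+1}` is the adjoint of `∇_r^j` after that of one first order step, so that
weak gradients of consecutive orders can be compared. -/
theorem radialGradAdj_succ (j : ℕ) (φ : Coord N → ℝ) :
    radialGradAdj (j + 1) φ = radialGradAdj j (gradStepAdj j φ) := by
  rcases Nat.even_or_odd j with h | h
  · have h1 : ¬ Even (j + 1) := by simpa [Nat.even_add_one] using h
    have h2 : (j + 1) / 2 = j / 2 := by obtain ⟨m, rfl⟩ := h; omega
    simp [radialGradAdj, gradStepAdj, h, h1, h2]
  · have h0 : ¬ Even j := Nat.not_even_iff_odd.2 h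
    have h1 : Even (j + 1) := by simpa [Nat.even_add_one] using h0
    have h2 : (j + 1) / 2 = j / 2 + 1 := by obtain ⟨m, rfl⟩ := h; omega
    simp only [radialGradAdj, gradStepAdj, h0, h1, h2, if_true, if_false,
      radialDerivAdj_neg_radialDeriv, Function.iterate_succ_apply]

theorem IsTest.radialGradAdj {φ : Coord N → ℝ} (hφ : IsTest (puncturedBall N) φ) (j : ℕ) :
    IsTest (puncturedBall N) (radialGradAdj j φ) := by
  induction j generalizing φ with
  | zero => rwa [radialGradAdj_zero]
  | succ j ih => rw [radialGradAdj_succ]; exact ih (hφ.gradStepAdj j)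

/-! ### Integration in polar coordinates -/

/-- The measure `sinh^{N-1} s ds` on the ray `(0, ∞)`. -/
def rayVol (N : ℕ) : Measure ℝ :=
  (volume.restrict (Set.Ioi 0)).withDensity (fun s => ENNReal.ofReal (Real.sinh s ^ (N - 1)))

/-- The surface measure of the Euclidean unit sphere. -/
abbrev sphereVol (N : ℕ) : Measure (Metric.sphere (0 : Coord N) 1) :=
  (volume : Measure (Coord N)).toSphere

theorem measurable_density (N : ℕ) :
    Measurable (fun x : Coord N => ENNReal.ofReal ((2 / (1 - ‖x‖ ^ 2)) ^ N)) := by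
  fun_prop

theorem measurable_rayDensity (N : ℕ) :
    Measurable (fun s : ℝ => ENNReal.ofReal (Real.sinh s ^ (N - 1))) := by
  fun_prop

instance (N : ℕ) : SFinite (rayVol N) := by
  unfold rayVol; infer_instance

theorem lintegral_rayVol (N : ℕ) (f : ℝ → ℝ≥0∞) :
    ∫⁻ s, f s ∂(rayVol N) = ∫⁻ s in Set.Ioi 0, ENNReal.ofReal (Real.sinh s ^ (N - 1)) * f s := by
  rw [rayVol, lintegral_withDensity_eq_lintegral_mul_non_measurable _ (measurable_rayDensity N)
    (Eventually.of_forall fun _ => ENNReal.ofReal_lt_top)]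
  rfl

theorem image_tanh_half : (fun s : ℝ => Real.tanh (s / 2)) '' Set.Ioi 0 = Set.Ioo 0 1 := by
  ext t
  constructor
  · rintro ⟨s, hs, rfl⟩
    exact ⟨tanh_half_pos hs, tanh_half_lt_one s⟩
  · rintro ⟨h0, h1⟩
    refine ⟨2 * Real.artanh t, ?_, ?_⟩
    · have := Real.artanh_pos ⟨h0, h1⟩
      simpa using this
    · simp only [mul_div_cancel_left₀ _ (two_ne_zero' ℝ)]
      exact Real.tanh_artanh ⟨by linarith, h1⟩

theorem injective_tanh_half : Function.Injective fun s : ℝ => Real.tanh (s / 2) := fun a b h => by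
  have := Real.tanh_injective h
  linarith

/-- The Jacobian of the substitution `t = tanh (s / 2)`. -/
theorem jacobian_tanh_half {N : ℕ} (hN : 0 < N) (s : ℝ) :
    (1 - Real.tanh (s / 2) ^ 2) / 2 * (Real.tanh (s / 2) ^ (N - 1) *
      (2 / (1 - Real.tanh (s / 2) ^ 2)) ^ N) = Real.sinh s ^ (N - 1) := by
  have hc : Real.cosh (s / 2) ≠ 0 := (Real.cosh_pos _).ne'
  have h1 : 1 - Real.tanh (s / 2) ^ 2 = 1 / Real.cosh (s / 2) ^ 2 := by
    rw [Real.tanh_eq_sinh_div_cosh]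
    field_simp
    linarith [Real.cosh_sq (s / 2)]
  have h2 : Real.sinh s = 2 * Real.sinh (s / 2) * Real.cosh (s / 2) := by
    rw [← Real.sinh_two_mul]; congr 1; ring
  obtain ⟨n, rfl⟩ : ∃ n, N = n + 1 := ⟨N - 1, by omega⟩
  have h3 : 2 / (1 / Real.cosh (s / 2) ^ 2) = 2 * Real.cosh (s / 2) ^ 2 := by field_simp
  rw [h1, h3, h2, Real.tanh_eq_sinh_div_cosh, Nat.add_sub_cancel, mul_pow, mul_pow, div_pow]
  field_simp
  ring

theorem lintegral_Ioo_eq_lintegral_tanh_half {N : ℕ} (hN : 0 < N) (f : ℝ → ℝ≥0∞) :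
    ∫⁻ t in Set.Ioo (0 : ℝ) 1, ENNReal.ofReal (t ^ (N - 1)) *
      (ENNReal.ofReal ((2 / (1 - t ^ 2)) ^ N) * f t) =
    ∫⁻ s in Set.Ioi (0 : ℝ), ENNReal.ofReal (Real.sinh s ^ (N - 1)) * f (Real.tanh (s / 2)) := by
  rw [← image_tanh_half, lintegral_image_eq_lintegral_abs_deriv_mul measurableSet_Ioi
    (fun s _ => (hasDerivAt_tanh_half s).hasDerivWithinAt) injective_tanh_half.injOn]
  refine setLIntegral_congr_fun measurableSet_Ioi fun s hs => ?_
  have h0 : 0 < Real.tanh (s / 2) := tanh_half_pos hs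
  have h1 := tanh_half_lt_one s
  have h2 : 0 < 1 - Real.tanh (s / 2) ^ 2 := by nlinarith
  rw [abs_of_pos (by linarith), ← jacobian_tanh_half hN s, ← mul_assoc, ← mul_assoc,
    ← ENNReal.ofReal_mul (by linarith), ← ENNReal.ofReal_mul (by positivity), mul_assoc]

theorem continuous_polar :
    Continuous (fun p : Metric.sphere (0 : Coord N) 1 × ℝ => polar p.2 (p.1 : Coord N)) := by
  exact (contDiff_tanh_half.continuous.comp continuous_snd).smul
    (continuous_subtype_val.comp continuous_fst)

/-- Euclidean polar coordinates. -/
theorem lintegral_volume_eq_lintegral_sphere (hN : 0 < N) {F : Coord N → ℝ≥0∞}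
    (hF : Measurable F) :
    ∫⁻ x, F x = ∫⁻ σ, ∫⁻ t in Set.Ioi (0 : ℝ), ENNReal.ofReal (t ^ (N - 1)) *
      F (t • (σ : Coord N)) ∂volume ∂(sphereVol N) := by
  have : Nonempty (Fin N) := ⟨⟨0, hN⟩⟩
  have hmp := (volume : Measure (Coord N)).measurePreserving_homeomorphUnitSphereProd
  have h1 : ∫⁻ x, F x = ∫⁻ x : ({(0 : Coord N)}ᶜ : Set (Coord N)), F x
      ∂(volume.comap Subtype.val) := by
    rw [lintegral_subtype_comap (measurableSet_singleton _).compl, restrict_compl_singleton]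
  have h2 := hmp.symm (homeomorphUnitSphereProd (Coord N)).toMeasurableEquiv
  have h3 := h2.lintegral_comp (f := fun x : ({(0 : Coord N)}ᶜ : Set (Coord N)) => F x)
    (hF.comp measurable_subtype_coe)
  rw [h1, ← h3, lintegral_prod _ (by
    refine Measurable.aemeasurable ?_
    exact (hF.comp measurable_subtype_coe).comp (MeasurableEquiv.measurable _))]
  refine lintegral_congr fun σ => ?_
  rw [finrank_euclideanSpace_fin, Measure.volumeIoiPow, lintegral_withDensity_eq_lintegral_mul₀]
  · have h4 := lintegral_subtype_comap (μ := (volume : Measure ℝ)) (s := Set.Ioi (0 : ℝ))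
      measurableSet_Ioi (fun t => ENNReal.ofReal (t ^ (N - 1)) * F (t • (σ : Coord N)))
    rw [← h4]
    refine lintegral_congr fun t => ?_
    rfl
  · exact Measurable.aemeasurable (by fun_prop)
  · refine Measurable.aemeasurable ?_
    exact ((hF.comp measurable_subtype_coe).comp (MeasurableEquiv.measurable _)).comp
      measurable_prodMk_left

/-- In geodesic polar coordinates the hyperbolic volume is `sinh^{N-1} s ds dσ`. -/
theorem measurePreserving_polar (hN : 0 < N) :
    MeasurePreserving (fun p : Metric.sphere (0 : Coord N) 1 × ℝ => polar p.2 (p.1 : Coord N))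
      ((sphereVol N).prod (rayVol N)) (hypVol N) := by
  refine ⟨continuous_polar.measurable, Measure.ext_of_lintegral _ fun f hf => ?_⟩
  rw [lintegral_map hf continuous_polar.measurable,
    lintegral_prod (fun p : Metric.sphere (0 : Coord N) 1 × ℝ => f (polar p.2 (p.1 : Coord N)))
      (hf.comp continuous_polar.measurable).aemeasurable, hypVol,
    lintegral_withDensity_eq_lintegral_mul _ (measurable_density N) hf,
    ← lintegral_indicator measurableSet_ball, lintegral_volume_eq_lintegral_sphere hN
      (((measurable_density N).mul hf).indicator measurableSet_ball)]
  refine lintegral_congr fun σ => ?_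
  have hσ : ‖(σ : Coord N)‖ = 1 := norm_eq_of_mem_sphere σ
  rw [lintegral_rayVol N]
  refine (lintegral_Ioo_eq_lintegral_tanh_half hN (fun t => f (t • (σ : Coord N)))).symm.trans ?_
  rw [← lintegral_indicator measurableSet_Ioo, ← lintegral_indicator measurableSet_Ioi]
  refine lintegral_congr fun t => ?_
  by_cases h0 : 0 < t
  · have hn : ‖t • (σ : Coord N)‖ = t := by rw [norm_smul, hσ, mul_one, Real.norm_of_nonneg h0.le]
    by_cases h1 : t < 1
    · rw [Set.indicator_of_mem (show t ∈ Set.Ioo (0 : ℝ) 1 from ⟨h0, h1⟩),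
        Set.indicator_of_mem (show t ∈ Set.Ioi (0 : ℝ) from h0),
        Set.indicator_of_mem (by rw [mem_ball_zero_iff, hn]; exact h1), Pi.mul_apply, hn]
    · rw [Set.indicator_of_notMem (fun h : t ∈ Set.Ioo (0 : ℝ) 1 => h1 h.2),
        Set.indicator_of_mem (show t ∈ Set.Ioi (0 : ℝ) from h0),
        Set.indicator_of_notMem (by rw [mem_ball_zero_iff, hn]; exact h1), mul_zero]
  · rw [Set.indicator_of_notMem (fun h : t ∈ Set.Ioo (0 : ℝ) 1 => h0 h.1),
      Set.indicator_of_notMem (show t ∉ Set.Ioi (0 : ℝ) from h0)]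

theorem lintegral_polar (hN : 0 < N) {H : Coord N → ℝ≥0∞} (hH : AEMeasurable H (hypVol N)) :
    ∫⁻ x, H x ∂(hypVol N) = ∫⁻ σ : Metric.sphere (0 : Coord N) 1,
      (∫⁻ s in Set.Ioi 0, ENNReal.ofReal (Real.sinh s ^ (N - 1)) * H (polar s (σ : Coord N)))
        ∂(sphereVol N) := by
  have hmp := measurePreserving_polar hN
  rw [← hmp.map_eq] at hH ⊢
  rw [lintegral_map' hH hmp.measurable.aemeasurable,
    lintegral_prod (fun p : Metric.sphere (0 : Coord N) 1 × ℝ => H (polar p.2 (p.1 : Coord N)))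
      (hH.comp_measurable hmp.measurable)]
  exact lintegral_congr fun σ => lintegral_rayVol N _

/-! ### Weak derivatives on the half-line -/

/-- `C_c^∞` functions on the half-line `(0, ∞)`. -/
def IsRayTest (ψ : ℝ → ℝ) : Prop :=
  ContDiff ℝ ∞ ψ ∧ HasCompactSupport ψ ∧ tsupport ψ ⊆ Set.Ioi 0

/-- Local absolute continuity on `(0, ∞)`. -/
def LocallyAC (f : ℝ → ℝ) : Prop :=
  ∀ a b, 0 < a → a ≤ b → AbsolutelyContinuousOnInterval f a b

theorem intervalIntegrable_of_locallyIntegrableOn {h : ℝ → ℝ}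
    (hh : LocallyIntegrableOn h (Set.Ioi 0)) {a b : ℝ} (ha : 0 < a) (hb : 0 < b) :
    IntervalIntegrable h volume a b := by
  refine (hh.integrableOn_compact_subset (t := Set.uIcc a b) ?_ isCompact_uIcc).intervalIntegrable
  intro x hx
  exact lt_of_lt_of_le (lt_min ha hb) hx.1

/-- A test function on the half-line is supported in a compact interval containing `1`. -/
theorem IsRayTest.exists_Icc {ψ : ℝ → ℝ} (hψ : IsRayTest ψ) :
    ∃ a b, 0 < a ∧ a ≤ 1 ∧ 1 ≤ b ∧ ∀ x, x ∉ Set.Ioo a b → ψ x = 0 := by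
  have hK : IsCompact (tsupport ψ ∪ {1}) := IsCompact.union hψ.2.1 isCompact_singleton
  have hne : (tsupport ψ ∪ {1}).Nonempty := ⟨1, Or.inr rfl⟩
  obtain ⟨a, ha, ha'⟩ := hK.exists_isLeast hne
  obtain ⟨b, hb, hb'⟩ := hK.exists_isGreatest hne
  have ha0 : 0 < a := by
    rcases ha with ha | ha
    · exact hψ.2.2 ha
    · rw [Set.mem_singleton_iff.1 ha]; exact one_pos
  have h1 := ha' (Or.inr rfl : (1 : ℝ) ∈ tsupport ψ ∪ {1})
  have h2 := hb' (Or.inr rfl : (1 : ℝ) ∈ tsupport ψ ∪ {1})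
  refine ⟨a / 2, b + 1, by linarith, by linarith, by linarith, fun x hx => ?_⟩
  by_contra h
  have hm : x ∈ tsupport ψ ∪ {1} := Or.inl (subset_tsupport ψ h)
  exact hx ⟨by linarith [ha' hm], by linarith [hb' hm]⟩

theorem ae_eq_zero_of_intervalIntegral_rat {h : ℝ → ℝ} {a b : ℝ} (hab : a ≤ b)
    (hh : IntervalIntegrable h volume a b)
    (h0 : ∀ q : ℚ, a < q → (q : ℝ) < b → ∫ x in a..q, h x = 0) :
    ∀ᵐ x, x ∈ Set.Ioo a b → h x = 0 := by
  have hcont : ContinuousOn (fun x => ∫ t in a..x, h t) (Set.Icc a b) := by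
    have := intervalIntegral.continuousOn_primitive_interval' hh Set.left_mem_uIcc
    rwa [Set.uIcc_of_le hab] at this
  -- the primitive vanishes at the rational points, hence everywhere
  have hz : ∀ x ∈ Set.Ioo a b, ∫ t in a..x, h t = 0 := by
    intro x hx
    by_contra hne
    have hat : ContinuousAt (fun x => ∫ t in a..x, h t) x :=
      hcont.continuousAt (Icc_mem_nhds hx.1 hx.2)
    have hev := (hat.eventually_ne hne).and (Ioo_mem_nhds hx.1 hx.2)
    obtain ⟨q, hq, hqab⟩ := (Rat.denseRange_cast (𝕜 := ℝ)).mem_nhds hev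
    exact hq (h0 q hqab.1 hqab.2)
  filter_upwards [hh.ae_hasDerivAt_integral] with x hx hxab
  have hx1 : x ∈ Set.uIcc a b := by
    rw [Set.uIcc_of_le hab]; exact ⟨hxab.1.le, hxab.2.le⟩
  have hd := hx hx1 a Set.left_mem_uIcc
  have hev : (fun x => ∫ t in a..x, h t) =ᶠ[𝓝 x] fun _ => 0 := by
    filter_upwards [Ioo_mem_nhds hxab.1 hxab.2] with y hy using hz y hy
  exact (hd.congr_of_eventuallyEq hev.symm).unique (hasDerivAt_const x 0)

/-- Test functions that converge to the indicator function of `(a, b)` detect whether the integral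
over `(a, b)` vanishes. -/
theorem exists_isRayTest_intervalIntegral_eq_zero {a b : ℝ} (ha : 0 < a) (hab : a < b) :
    ∃ α : ℕ → ℝ → ℝ, (∀ m, IsRayTest (α m)) ∧ ∀ h : ℝ → ℝ, LocallyIntegrableOn h (Set.Ioi 0) →
      (∀ m, ∫ s in Set.Ioi 0, h s * α m s = 0) → ∫ s in a..b, h s = 0 := by
  have hR : 0 < (b - a) / 2 := by linarith
  have hball : Metric.ball ((a + b) / 2) ((b - a) / 2) = Set.Ioo a b := by
    rw [Real.ball_eq_Ioo]; congr 1 <;> ring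
  let β : ℕ → ContDiffBump ((a + b) / 2) := fun m =>
    { rIn := (b - a) / 2 * (1 - 1 / ((m : ℝ) + 2))
      rOut := (b - a) / 2
      rIn_pos := by
        refine mul_pos hR ?_
        have : 1 / ((m : ℝ) + 2) < 1 := by
          rw [div_lt_one (by positivity)]; linarith [(Nat.cast_nonneg m : (0 : ℝ) ≤ m)]
        linarith
      rIn_lt_rOut := by
        have : 0 < 1 / ((m : ℝ) + 2) := by positivity
        nlinarith }
  refine ⟨fun m => β m, fun m => ⟨(β m).contDiff, (β m).hasCompactSupport, ?_⟩, fun h hh h0 => ?_⟩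
  · rw [(β m).tsupport_eq, Real.closedBall_eq_Icc]
    intro x hx
    have h1 : (a + b) / 2 - (b - a) / 2 ≤ x := hx.1
    show 0 < x
    linarith
  · have hint : IntegrableOn h (Set.Ioo a b) := by
      have := intervalIntegrable_of_locallyIntegrableOn hh ha (ha.trans hab)
      exact ((intervalIntegrable_iff_integrableOn_Ioc_of_le hab.le).1 this).mono_set
        Set.Ioo_subset_Ioc_self
    have hm : ∀ m, ∫ s in Set.Ioo a b, h s * β m s = 0 := by
      intro m
      rw [← h0 m]
      refine (setIntegral_eq_of_subset_of_forall_sdiff_eq_zero measurableSet_Ioi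
        (fun x hx => ha.trans hx.1) fun x hx => ?_).symm
      have : x ∉ Function.support (β m) := by
        rw [(β m).support_eq]
        show x ∉ Metric.ball ((a + b) / 2) ((b - a) / 2)
        rw [hball]; exact hx.2
      rw [Function.notMem_support.1 this, mul_zero]
    have hlim : Tendsto (fun m => ∫ s in Set.Ioo a b, h s * β m s) atTop
        (𝓝 (∫ s in Set.Ioo a b, h s)) := by
      refine tendsto_integral_of_dominated_convergence (fun s => |h s|) (fun m => ?_) hint.abs
        (fun m => ?_) ?_
      · exact hint.aestronglyMeasurable.mul (β m).continuous.aestronglyMeasurable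
      · refine Eventually.of_forall fun s => ?_
        rw [norm_mul, Real.norm_eq_abs, Real.norm_of_nonneg (β m).nonneg]
        exact mul_le_of_le_one_right (abs_nonneg _) (β m).le_one
      · rw [ae_restrict_iff' measurableSet_Ioo]
        refine Eventually.of_forall fun s hs => ?_
        rw [← hball, Metric.mem_ball] at hs
        have h1 : Tendsto (fun m : ℕ => (b - a) / 2 * (1 - 1 / ((m : ℝ) + 2))) atTop
            (𝓝 ((b - a) / 2 * (1 - 0))) := by
          refine (tendsto_const_nhds.sub ?_).const_mul _
          have := tendsto_one_div_add_atTop_nhds_zero_nat (𝕜 := ℝ)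
          have h2 := this.comp (tendsto_add_atTop_nat 1)
          refine h2.congr fun m => ?_
          simp only [Function.comp, Nat.cast_add, Nat.cast_one]
          congr 1; ring
        have h2 := h1.eventually (lt_mem_nhds (by simpa using hs))
        refine tendsto_const_nhds.congr' ?_
        filter_upwards [h2] with m hm
        rw [(β m).one_of_mem_closedBall (Metric.mem_closedBall.2 (le_of_lt hm)), mul_one]
    rw [intervalIntegral.integral_of_le hab.le, integral_Ioc_eq_integral_Ioo]
    exact tendsto_nhds_unique hlim (by simp [hm])

/-- Countably many test functions on the half-line detect whether a function vanishes. -/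
theorem exists_separating_isRayTest :
    ∃ α : ℕ → ℝ → ℝ, (∀ n, IsRayTest (α n)) ∧ ∀ h : ℝ → ℝ, LocallyIntegrableOn h (Set.Ioi 0) →
      (∀ n, ∫ s in Set.Ioi 0, h s * α n s = 0) → ∀ᵐ s ∂(volume.restrict (Set.Ioi 0)), h s = 0 := by
  let I := {p : ℚ × ℚ // 0 < p.1 ∧ p.1 < p.2}
  have hI : ∀ i : I, (0 : ℝ) < i.1.1 ∧ (i.1.1 : ℝ) < i.1.2 := fun i =>
    ⟨by exact_mod_cast i.2.1, by exact_mod_cast i.2.2⟩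
  choose α hα hα' using fun i : I => exists_isRayTest_intervalIntegral_eq_zero (hI i).1 (hI i).2
  have : Nonempty (I × ℕ) := ⟨⟨⟨(1, 2), by norm_num⟩, 0⟩⟩
  obtain ⟨e, he⟩ := exists_surjective_nat (I × ℕ)
  refine ⟨fun n => α (e n).1 (e n).2, fun n => hα _ _, fun h hh h0 => ?_⟩
  have hrat : ∀ i : I, ∫ s in (i.1.1 : ℝ)..(i.1.2 : ℝ), h s = 0 := fun i => by
    refine hα' i h hh fun m => ?_
    obtain ⟨n, hn⟩ := he (i, m)
    have := h0 n
    simp only [hn] at this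
    exact this
  have hI2 : ∀ i : I, ∀ᵐ x, x ∈ Set.Ioo (i.1.1 : ℝ) (i.1.2 : ℝ) → h x = 0 := fun i => by
    refine ae_eq_zero_of_intervalIntegral_rat (hI i).2.le
      (intervalIntegrable_of_locallyIntegrableOn hh (hI i).1 ((hI i).1.trans (hI i).2))
      fun q hq _ => ?_
    exact hrat ⟨(i.1.1, q), i.2.1, by exact_mod_cast hq⟩
  rw [ae_restrict_iff' measurableSet_Ioi]
  filter_upwards [ae_all_iff.2 hI2] with x hx hx0
  obtain ⟨p, hp0, hpx⟩ := exists_rat_btwn (show (0 : ℝ) < x from hx0)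
  obtain ⟨q, hq⟩ := exists_rat_gt x
  exact hx ⟨(p, q), by exact_mod_cast hp0, by exact_mod_cast hpx.trans hq⟩ ⟨hpx, hq⟩

/-- A test function of mean zero is the derivative of a test function. -/
theorem IsRayTest.exists_primitive {β : ℝ → ℝ} (hβ : IsRayTest β)
    (h0 : ∫ s in Set.Ioi 0, β s = 0) : ∃ ψ, IsRayTest ψ ∧ deriv ψ = β := by
  obtain ⟨a, b, ha, ha1, hb1, hab⟩ := hβ.exists_Icc
  have hc := hβ.1.continuous
  have hd : ∀ x, HasDerivAt (fun x => ∫ t in (0 : ℝ)..x, β t) (β x) x := fun x =>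
    intervalIntegral.integral_hasDerivAt_right (hc.intervalIntegrable _ _)
      (hc.stronglyMeasurableAtFilter _ _) hc.continuousAt
  have hderiv : deriv (fun x => ∫ t in (0 : ℝ)..x, β t) = β := funext fun x => (hd x).deriv
  have hle : ∀ x ≤ a, ∫ t in (0 : ℝ)..x, β t = 0 := fun x hx => by
    refine intervalIntegral.integral_zero_ae (Eventually.of_forall fun t ht => hab t fun h => ?_)
    rcases le_total 0 x with h2 | h2
    · rw [Set.uIoc_of_le h2] at ht; linarith [ht.2, h.1]
    · rw [Set.uIoc_of_ge h2] at ht; linarith [ht.2, h.1]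
  have hge : ∀ x, b ≤ x → ∫ t in (0 : ℝ)..x, β t = 0 := fun x hx => by
    rw [intervalIntegral.integral_of_le (by linarith)]
    refine Eq.trans ?_ h0
    refine (setIntegral_eq_of_subset_of_forall_sdiff_eq_zero measurableSet_Ioi
      (fun y hy => hy.1) fun y hy => ?_).symm
    refine hab y fun h => hy.2 ⟨hy.1, ?_⟩
    linarith [h.2]
  have hsupp : Function.support (fun x => ∫ t in (0 : ℝ)..x, β t) ⊆ Set.Icc a b := by
    intro x hx
    by_contra h
    rw [Set.mem_Icc, not_and_or, not_le, not_le] at h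
    exact hx (h.elim (fun h => hle x h.le) fun h => hge x h.le)
  have hts : tsupport (fun x => ∫ t in (0 : ℝ)..x, β t) ⊆ Set.Icc a b :=
    closure_minimal hsupp isClosed_Icc
  refine ⟨fun x => ∫ t in (0 : ℝ)..x, β t, ⟨?_, ?_, ?_⟩, hderiv⟩
  · exact contDiff_infty_iff_deriv.2 ⟨fun x => (hd x).differentiableAt, by
      rw [hderiv]; exact hβ.1⟩
  · exact isCompact_Icc.of_isClosed_subset (isClosed_tsupport _) hts
  · exact hts.trans fun x hx => lt_of_lt_of_le ha hx.1

theorem IsRayTest.deriv {ψ : ℝ → ℝ} (hψ : IsRayTest ψ) : IsRayTest (deriv ψ) :=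
  ⟨(contDiff_infty_iff_deriv.1 hψ.1).2, hψ.2.1.deriv,
    tsupport_deriv_subset.trans hψ.2.2⟩

theorem IsRayTest.integrableOn_mul {ψ h : ℝ → ℝ} (hψ : IsRayTest ψ)
    (hh : LocallyIntegrableOn h (Set.Ioi 0)) :
    IntegrableOn (fun s => h s * ψ s) (Set.Ioi 0) := by
  obtain ⟨a, b, ha, ha1, hb1, hab⟩ := hψ.exists_Icc
  have h1 : IntegrableOn h (Set.Icc a b) :=
    hh.integrableOn_compact_subset (fun x hx => lt_of_lt_of_le ha hx.1) isCompact_Icc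
  have h2 : IntegrableOn (fun s => h s * ψ s) (Set.Icc a b) :=
    h1.mul_continuousOn hψ.1.continuous.continuousOn isCompact_Icc
  refine h2.of_forall_sdiff_eq_zero measurableSet_Ioi fun x hx => ?_
  rw [hab x fun h => hx.2 ⟨h.1.le, h.2.le⟩, mul_zero]

/-- The primitive, based at `1`, of a locally integrable function on the half-line. -/
theorem locallyAC_primitive {g : ℝ → ℝ} (hg : LocallyIntegrableOn g (Set.Ioi 0)) (k : ℝ) :
    LocallyAC (fun r => k + ∫ t in (1 : ℝ)..r, g t) ∧
      ∀ᵐ s ∂(volume.restrict (Set.Ioi 0)), deriv (fun r => k + ∫ t in (1 : ℝ)..r, g t) s = g s := by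
  constructor
  · intro a b ha hab
    have hmin : 0 < min a 1 := lt_min ha one_pos
    have h1 := (intervalIntegrable_of_locallyIntegrableOn hg hmin
      (lt_of_lt_of_le one_pos (le_max_right b 1))).absolutelyContinuousOnInterval_intervalIntegral
      (c := 1) ⟨(inf_le_left).trans (min_le_right a 1), (le_max_right b 1).trans le_sup_right⟩
    have h2 : AbsolutelyContinuousOnInterval (fun r => ∫ t in (1 : ℝ)..r, g t) a b := by
      refine h1.mono ?_
      rw [Set.uIcc_of_le hab, Set.uIcc_of_le ((min_le_right a 1).trans (le_max_right b 1))]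
      exact Set.Icc_subset_Icc (min_le_left _ _) (le_max_left _ _)
    exact (contDiffOn_const (c := k)).absolutelyContinuousOnInterval.add h2
  · have h : ∀ n : ℕ, ∀ᵐ x, x ∈ Set.uIcc (1 / ((n : ℝ) + 1)) ((n : ℝ) + 1) →
        deriv (fun r => k + ∫ t in (1 : ℝ)..r, g t) x = g x := fun n => by
      have hn : (0 : ℝ) < n + 1 := by positivity
      have hn1 : (1 : ℝ) ≤ n + 1 := by linarith [(Nat.cast_nonneg n : (0 : ℝ) ≤ n)]
      have hn2 : 1 / ((n : ℝ) + 1) ≤ 1 := by rw [div_le_one hn]; exact hn1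
      have hi := intervalIntegrable_of_locallyIntegrableOn hg
        (show 0 < 1 / ((n : ℝ) + 1) by positivity) hn
      filter_upwards [hi.ae_hasDerivAt_integral] with x hx hxm
      refine ((hx hxm 1 ?_).const_add k).deriv
      rw [Set.uIcc_of_le (hn2.trans hn1)]
      exact ⟨hn2, hn1⟩
    rw [ae_restrict_iff' measurableSet_Ioi]
    filter_upwards [ae_all_iff.2 h] with x hx hx0
    obtain ⟨n, hn⟩ := exists_nat_gt (max x x⁻¹)
    have hx0' : (0 : ℝ) < x := hx0
    refine hx n ?_
    have h1 : x < n := lt_of_le_of_lt (le_max_left _ _) hn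
    have h2 : x⁻¹ < n := lt_of_le_of_lt (le_max_right _ _) hn
    have h3 : 1 / ((n : ℝ) + 1) ≤ x := by
      rw [div_le_iff₀ (by linarith)]
      have : x⁻¹ * x = 1 := inv_mul_cancel₀ hx0'.ne'
      nlinarith
    rw [Set.uIcc_of_le (h3.trans (by linarith))]
    exact ⟨h3, by linarith⟩

theorem IsRayTest.integral_primitive_mul_deriv {ψ g : ℝ → ℝ} (hψ : IsRayTest ψ)
    (hg : LocallyIntegrableOn g (Set.Ioi 0)) :
    ∫ s in Set.Ioi 0, (∫ t in (1 : ℝ)..s, g t) * _root_.deriv ψ s =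
      -∫ s in Set.Ioi 0, g s * ψ s := by
  obtain ⟨a, b, ha, ha1, hb1, hab⟩ := hψ.exists_Icc
  have hle : a ≤ b := ha1.trans hb1
  have hd : ∀ x, x ∉ Set.Icc a b → _root_.deriv ψ x = 0 := fun x hx => by
    have : ψ =ᶠ[𝓝 x] fun _ => 0 := by
      filter_upwards [isClosed_Icc.isOpen_compl.mem_nhds hx] with y hy
      exact hab y fun h => hy ⟨h.1.le, h.2.le⟩
    rw [this.deriv_eq, deriv_const]
  have hsub : Set.Icc a b ⊆ Set.Ioi 0 := fun x hx => lt_of_lt_of_le ha hx.1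
  rw [setIntegral_eq_of_subset_of_forall_sdiff_eq_zero measurableSet_Ioi hsub fun x hx => by
      rw [hd x hx.2, mul_zero],
    setIntegral_eq_of_subset_of_forall_sdiff_eq_zero (f := fun s => g s * ψ s) measurableSet_Ioi
      hsub fun x hx => by
        rw [hab x fun h => hx.2 ⟨h.1.le, h.2.le⟩, mul_zero],
    integral_Icc_eq_integral_Ioc, integral_Icc_eq_integral_Ioc,
    ← intervalIntegral.integral_of_le hle, ← intervalIntegral.integral_of_le hle]
  obtain ⟨hAC, hder⟩ := locallyAC_primitive hg 0
  have h := (hAC a b ha hle).integral_mul_deriv_eq_deriv_mul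
    (hψ.1.contDiffOn.of_le (by exact_mod_cast le_top)).absolutelyContinuousOnInterval
  simp only [zero_add] at h hder
  rw [h, hab a (by simp), hab b (by simp), mul_zero, mul_zero, sub_zero, zero_sub]
  congr 1
  refine intervalIntegral.integral_congr_ae ?_
  rw [ae_restrict_iff' measurableSet_Ioi] at hder
  filter_upwards [hder] with x hx hxm
  rw [Set.uIoc_of_le hle] at hxm
  rw [hx (ha.trans hxm.1)]

/-- Countably many test functions detect weak differentiability: if `g` is the derivative of `f`
against each of them, then `f` has a locally absolutely continuous representative with
derivative `g`. -/
theorem exists_isRayTest_locallyAC :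
    ∃ ψ : ℕ → ℝ → ℝ, (∀ n, IsRayTest (ψ n)) ∧ ∀ f g : ℝ → ℝ,
      LocallyIntegrableOn f (Set.Ioi 0) → LocallyIntegrableOn g (Set.Ioi 0) →
      (∀ n, ∫ s in Set.Ioi 0, (g s * ψ n s + f s * deriv (ψ n) s) = 0) →
      ∃ F : ℝ → ℝ, LocallyAC F ∧ (∀ᵐ s ∂(volume.restrict (Set.Ioi 0)), F s = f s) ∧
        ∀ᵐ s ∂(volume.restrict (Set.Ioi 0)), deriv F s = g s := by
  obtain ⟨α, hα, hsep⟩ := exists_separating_isRayTest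
  -- a test function of integral one
  obtain ⟨η, hη, hη1⟩ : ∃ η, IsRayTest η ∧ ∫ s in Set.Ioi 0, η s = 1 := by
    let β : ContDiffBump (2 : ℝ) := ⟨1 / 2, 1, by norm_num, by norm_num⟩
    have hts : tsupport (β.normed volume) ⊆ Set.Ioi 0 := by
      rw [β.tsupport_normed_eq, Real.closedBall_eq_Icc]
      intro x hx
      have h1 : (2 : ℝ) - 1 ≤ x := hx.1
      show 0 < x
      linarith
    refine ⟨β.normed volume, ⟨β.contDiff_normed, β.hasCompactSupport_normed, hts⟩, ?_⟩
    rw [setIntegral_eq_integral_of_forall_compl_eq_zero fun x hx =>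
      image_eq_zero_of_notMem_tsupport fun h => hx (hts h)]
    exact β.integral_normed
  have hloc1 : LocallyIntegrableOn (fun _ : ℝ => (1 : ℝ)) (Set.Ioi 0) :=
    (locallyIntegrable_const 1).locallyIntegrableOn _
  have hint : ∀ φ, IsRayTest φ → IntegrableOn φ (Set.Ioi 0) := fun φ hφ => by
    simpa using hφ.integrableOn_mul hloc1
  have hβ : ∀ n, IsRayTest (fun s => α n s - (∫ t in Set.Ioi 0, α n t) * η s) := fun n => by
    refine ⟨(hα n).1.sub (contDiff_const.mul hη.1), ?_, ?_⟩
    · exact (hα n).2.1.sub (hη.2.1.mul_left (f := fun _ => ∫ t in Set.Ioi 0, α n t))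
    · refine (tsupport_sub _ _).trans (Set.union_subset (hα n).2.2 ?_)
      exact (tsupport_mul_subset_right).trans hη.2.2
  have hβ0 : ∀ n, ∫ s in Set.Ioi 0, (α n s - (∫ t in Set.Ioi 0, α n t) * η s) = 0 := fun n => by
    rw [integral_sub (hint _ (hα n)) ((hint _ hη).const_mul _), integral_const_mul, hη1]
    ring
  choose ψ hψ hψ' using fun n => (hβ n).exists_primitive (hβ0 n)
  refine ⟨ψ, hψ, fun f g hf hg h => ?_⟩
  have hGc : LocallyIntegrableOn (fun r => ∫ t in (1 : ℝ)..r, g t) (Set.Ioi 0) := by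
    refine ContinuousOn.locallyIntegrableOn ?_ measurableSet_Ioi
    intro x hx
    have hx' : (0 : ℝ) < x := hx
    have h1 := ((locallyAC_primitive hg 0).1 (x / 2) (x + 1) (by linarith)
      (by linarith)).continuousOn
    simp only [zero_add] at h1
    refine (h1.continuousAt ?_).continuousWithinAt
    rw [Set.uIcc_of_le (by linarith)]
    exact Icc_mem_nhds (by linarith) (by linarith)
  have hK : LocallyIntegrableOn (fun r => f r - ∫ t in (1 : ℝ)..r, g t) (Set.Ioi 0) := hf.sub hGc
  set K := fun r => f r - ∫ t in (1 : ℝ)..r, g t with hKdef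
  set k := ∫ s in Set.Ioi 0, K s * η s with hk
  have hKψ : ∀ n, ∫ s in Set.Ioi 0, K s * deriv (ψ n) s = 0 := fun n => by
    have e : ∀ s, K s * deriv (ψ n) s =
        f s * deriv (ψ n) s - (∫ t in (1 : ℝ)..s, g t) * deriv (ψ n) s := fun s => by
      rw [hKdef]; ring
    simp only [e]
    rw [integral_sub ((hψ n).deriv.integrableOn_mul hf) ((hψ n).deriv.integrableOn_mul hGc),
      (hψ n).integral_primitive_mul_deriv hg]
    have := h n
    rw [integral_add ((hψ n).integrableOn_mul hg) ((hψ n).deriv.integrableOn_mul hf)] at this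
    linarith
  have hz := hsep (fun s => K s - k) (hK.sub ((locallyIntegrable_const k).locallyIntegrableOn _))
    fun n => by
      have e : ∀ s, (K s - k) * α n s = K s * deriv (ψ n) s +
          ((∫ t in Set.Ioi 0, α n t) * (K s * η s) - k * α n s) := fun s => by
        rw [hψ' n]; ring
      simp only [e]
      have i1 := (hη.integrableOn_mul hK).const_mul (∫ t in Set.Ioi 0, α n t)
      have i2 := (hint _ (hα n)).const_mul k
      rw [integral_add ((hψ n).deriv.integrableOn_mul hK) (i1.sub' i2), hKψ, integral_sub i1 i2,
        integral_const_mul, integral_const_mul, ← hk]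
      ring
  obtain ⟨h1, h2⟩ := locallyAC_primitive hg k
  refine ⟨_, h1, ?_, h2⟩
  filter_upwards [hz] with s hs
  simp only [hKdef] at hs
  linarith

/-! ### One-dimensional weighted inequalities -/

theorem LocallyAC.continuousOn {f : ℝ → ℝ} (hf : LocallyAC f) : ContinuousOn f (Set.Ioi 0) := by
  intro x hx
  have hx' : (0 : ℝ) < x := hx
  have h1 := (hf (x / 2) (x + 1) (by linarith) (by linarith)).continuousOn
  refine (h1.continuousAt ?_).continuousWithinAt
  rw [Set.uIcc_of_le (by linarith)]
  exact Icc_mem_nhds (by linarith) (by linarith)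

/-- Expansion of `0 ≤ ∫ (f' + ε c f)² V` for a weight with `2 c V ≤ ε V'`, where `ε = ±1`. -/
theorem weighted_sq_le_of_locallyAC {f V : ℝ → ℝ} {c ε : ℝ} (hf : LocallyAC f) (hc : 0 ≤ c)
    (hε : ε ^ 2 = 1) (hV : ContDiffOn ℝ 1 V (Set.Ioi 0)) (hV0 : ∀ s, 0 < s → 0 ≤ V s)
    (hVd : ∀ s, 0 < s → 2 * c * V s ≤ ε * deriv V s)
    (hi : IntegrableOn (fun s => f s ^ 2 * V s) (Set.Ioi 0))
    (hi' : IntegrableOn (fun s => deriv f s ^ 2 * V s) (Set.Ioi 0))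
    {a b : ℝ} (ha : 0 < a) (hab : a ≤ b) :
    c ^ 2 * ∫ s in a..b, f s ^ 2 * V s ≤
      (∫ s in a..b, deriv f s ^ 2 * V s) + c * ε * (f b ^ 2 * V b - f a ^ 2 * V a) := by
  have hsub : Set.uIcc a b ⊆ Set.Ioi 0 := by
    rw [Set.uIcc_of_le hab]; exact fun x hx => lt_of_lt_of_le ha hx.1
  have hfa := hf a b ha hab
  have hVa : AbsolutelyContinuousOnInterval V a b := (hV.mono hsub).absolutelyContinuousOnInterval
  have hQ := (hfa.mul hfa).mul hVa
  have hFTC := hQ.integral_deriv_eq_sub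
  have iQ := hQ.intervalIntegrable_deriv
  have hsub' : Set.uIoc a b ⊆ Set.Ioi 0 := Set.uIoc_subset_uIcc.trans hsub
  have i1 : IntervalIntegrable (fun s => f s ^ 2 * V s) volume a b :=
    intervalIntegrable_iff.2 (hi.mono_set hsub')
  have i2 : IntervalIntegrable (fun s => deriv f s ^ 2 * V s) volume a b :=
    intervalIntegrable_iff.2 (hi'.mono_set hsub')
  have key : ∫ s in a..b, c ^ 2 * (f s ^ 2 * V s) ≤
      ∫ s in a..b, (deriv f s ^ 2 * V s + c * ε * deriv (f * f * V) s) := by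
    refine intervalIntegral.integral_mono_ae_restrict hab (i1.const_mul _)
      (i2.add (iQ.const_mul _)) ?_
    rw [EventuallyLE, ae_restrict_iff' measurableSet_Icc]
    filter_upwards [hfa.ae_differentiableAt] with s hs hsm
    have hsu : s ∈ Set.uIcc a b := by rwa [Set.uIcc_of_le hab]
    have hs0 : 0 < s := hsub hsu
    have hd := (hs hsu).hasDerivAt
    have hdV := ((hV.contDiffAt (Ioi_mem_nhds hs0)).differentiableAt one_ne_zero).hasDerivAt
    have hdQ := ((hd.mul hd).mul hdV).deriv
    rw [hdQ]
    have e : deriv f s ^ 2 * V s + c * ε * ((deriv f s * f s + f s * deriv f s) * V s +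
        (f * f) s * deriv V s) = (deriv f s + ε * c * f s) ^ 2 * V s -
          (ε ^ 2) * c ^ 2 * f s ^ 2 * V s + c * f s ^ 2 * (ε * deriv V s) := by
      rw [Pi.mul_apply]; ring
    rw [e, hε]
    have h1 := mul_nonneg (sq_nonneg (deriv f s + ε * c * f s)) (hV0 s hs0)
    have h2 := mul_le_mul_of_nonneg_left (hVd s hs0) (mul_nonneg hc (sq_nonneg (f s)))
    nlinarith
  rw [intervalIntegral.integral_const_mul, intervalIntegral.integral_add i2 (iQ.const_mul _),
    intervalIntegral.integral_const_mul, hFTC] at key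
  simpa [pow_two] using key

/-- The passage from compact intervals to the half-line. -/
theorem lintegral_le_of_forall_interval {F H : ℝ → ℝ} {k : ℝ} (hk : 0 ≤ k)
    (hF0 : ∀ s, 0 < s → 0 ≤ F s) (hH0 : ∀ s, 0 < s → 0 ≤ H s)
    (hF : IntegrableOn F (Set.Ioi 0)) (hH : IntegrableOn H (Set.Ioi 0))
    (h : ∀ a b, 0 < a → a ≤ b → k * ∫ s in a..b, F s ≤ ∫ s in Set.Ioi 0, H s) :
    ENNReal.ofReal k * ∫⁻ s in Set.Ioi 0, ENNReal.ofReal (F s) ≤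
      ∫⁻ s in Set.Ioi 0, ENNReal.ofReal (H s) := by
  have hn : ∀ G : ℝ → ℝ, (∀ s, 0 < s → 0 ≤ G s) → 0 ≤ᵐ[volume.restrict (Set.Ioi 0)] G :=
    fun G hG => by
      rw [EventuallyLE, ae_restrict_iff' measurableSet_Ioi]
      exact Eventually.of_forall hG
  rw [← ofReal_integral_eq_lintegral_ofReal hF (hn F hF0),
    ← ofReal_integral_eq_lintegral_ofReal hH (hn H hH0), ← ENNReal.ofReal_mul hk]
  refine ENNReal.ofReal_le_ofReal ?_
  have hcov : AECover (volume.restrict (Set.Ioi (0 : ℝ))) atTop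
      fun n : ℕ => Set.Ioc (1 / ((n : ℝ) + 1)) ((n : ℝ) + 1) :=
    (aecover_Ioi_of_Ioi tendsto_one_div_add_atTop_nhds_zero_nat).inter
      (aecover_Iic (tendsto_atTop_add_const_right _ _ tendsto_natCast_atTop_atTop))
  have hlim := hcov.integral_tendsto_of_countably_generated hF
  refine le_of_tendsto (hlim.const_mul k) (Eventually.of_forall fun n => ?_)
  have hn0 : (0 : ℝ) ≤ n := Nat.cast_nonneg n
  have h1 : 1 / ((n : ℝ) + 1) ≤ (n : ℝ) + 1 := by
    rw [div_le_iff₀ (by linarith)]; nlinarith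
  have h2 := h _ _ (show (0 : ℝ) < 1 / ((n : ℝ) + 1) by positivity) h1
  rw [intervalIntegral.integral_of_le h1] at h2
  rwa [Measure.restrict_restrict measurableSet_Ioc, Set.inter_eq_left.2]
  exact fun x hx => lt_trans (by positivity) hx.1

theorem integrableOn_of_lintegral_ne_top {F : ℝ → ℝ}
    (hm : AEStronglyMeasurable F (volume.restrict (Set.Ioi 0))) (h0 : ∀ s, 0 < s → 0 ≤ F s)
    (h : ∫⁻ s in Set.Ioi 0, ENNReal.ofReal (F s) ≠ ⊤) : IntegrableOn F (Set.Ioi 0) := by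
  refine (lintegral_ofReal_ne_top_iff_integrable hm ?_).1 h
  rw [EventuallyLE, ae_restrict_iff' measurableSet_Ioi]
  exact Eventually.of_forall h0

theorem contDiffOn_sinh_pow (m : ℕ) :
    ContDiffOn ℝ 1 (fun s : ℝ => Real.sinh s ^ m) (Set.Ioi 0) := by
  fun_prop

theorem hasDerivAt_sinh_pow (m : ℕ) (s : ℝ) :
    HasDerivAt (fun s : ℝ => Real.sinh s ^ m) (m * Real.sinh s ^ (m - 1) * Real.cosh s) s :=
  (Real.hasDerivAt_sinh s).pow m

/-- `m sinh^m ≤ (sinh^m)'` on the half-line. -/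
theorem mul_sinh_pow_le (m : ℕ) {s : ℝ} (hs : 0 < s) :
    m * Real.sinh s ^ m ≤ m * Real.sinh s ^ (m - 1) * Real.cosh s := by
  have h0 : 0 < Real.sinh s := Real.sinh_pos_iff.2 hs
  rcases m with _ | m
  · simp
  · rw [Nat.add_sub_cancel, pow_succ, mul_assoc]
    have := (Real.sinh_lt_cosh s).le
    gcongr

theorem aestronglyMeasurable_deriv_sq_mul {f V : ℝ → ℝ} (hV : ContinuousOn V (Set.Ioi 0)) :
    AEStronglyMeasurable (fun s => deriv f s ^ 2 * V s) (volume.restrict (Set.Ioi 0)) :=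
  ((measurable_deriv f).pow_const 2).aestronglyMeasurable.mul
    (hV.aestronglyMeasurable measurableSet_Ioi)

/-- The sharp Poincaré inequality with weight `sinh^m` for functions on the half-line. No condition
at `0` is needed: the boundary term there has the favourable sign. -/
theorem sinh_pow_poincare (m : ℕ) {f : ℝ → ℝ} (hf : LocallyAC f)
    (hfin : ∫⁻ s in Set.Ioi 0, ENNReal.ofReal (f s ^ 2 * Real.sinh s ^ m) ≠ ⊤) :
    ENNReal.ofReal (((m : ℝ) / 2) ^ 2) *
        ∫⁻ s in Set.Ioi 0, ENNReal.ofReal (f s ^ 2 * Real.sinh s ^ m) ≤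
      ∫⁻ s in Set.Ioi 0, ENNReal.ofReal (deriv f s ^ 2 * Real.sinh s ^ m) := by
  by_cases htop : ∫⁻ s in Set.Ioi 0, ENNReal.ofReal (deriv f s ^ 2 * Real.sinh s ^ m) = ⊤
  · rw [htop]; exact le_top
  have hV := contDiffOn_sinh_pow m
  have hV0 : ∀ s : ℝ, 0 < s → 0 ≤ Real.sinh s ^ m := fun s hs =>
    pow_nonneg (Real.sinh_pos_iff.2 hs).le _
  have n1 : ∀ s : ℝ, 0 < s → 0 ≤ f s ^ 2 * Real.sinh s ^ m := fun s hs =>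
    mul_nonneg (sq_nonneg _) (hV0 s hs)
  have n2 : ∀ s : ℝ, 0 < s → 0 ≤ deriv f s ^ 2 * Real.sinh s ^ m := fun s hs =>
    mul_nonneg (sq_nonneg _) (hV0 s hs)
  have i1 : IntegrableOn (fun s => f s ^ 2 * Real.sinh s ^ m) (Set.Ioi 0) :=
    integrableOn_of_lintegral_ne_top
      (((hf.continuousOn.pow 2).mul hV.continuousOn).aestronglyMeasurable measurableSet_Ioi) n1 hfin
  have i2 : IntegrableOn (fun s => deriv f s ^ 2 * Real.sinh s ^ m) (Set.Ioi 0) :=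
    integrableOn_of_lintegral_ne_top (aestronglyMeasurable_deriv_sq_mul hV.continuousOn) n2 htop
  refine lintegral_le_of_forall_interval (sq_nonneg _) n1 n2 i1 i2 fun a b ha hab => ?_
  have hm0 : (0 : ℝ) ≤ m / 2 := by positivity
  refine le_of_forall_pos_le_add fun δ hδ => ?_
  -- integrability yields a point beyond `b` at which the boundary term is small
  obtain ⟨b', hb', hsmall⟩ : ∃ b', b ≤ b' ∧ (m : ℝ) / 2 * (f b' ^ 2 * Real.sinh b' ^ m) ≤ δ := by
    by_contra hcon
    push Not at hcon
    have hconst : IntegrableOn (fun _ : ℝ => δ) (Set.Ioi b) := by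
      refine Integrable.mono' ((i1.mono_set (Set.Ioi_subset_Ioi (ha.le.trans hab))).const_mul
        ((m : ℝ) / 2)) aestronglyMeasurable_const ?_
      rw [ae_restrict_iff' measurableSet_Ioi]
      refine Eventually.of_forall fun s hs => ?_
      rw [Real.norm_of_nonneg hδ.le]
      exact (hcon s (le_of_lt hs)).le
    rw [integrableOn_const_iff (by simp)] at hconst
    simp [hδ.ne'] at hconst
  have hab' := hab.trans hb'
  have h1 := weighted_sq_le_of_locallyAC (c := (m : ℝ) / 2) (ε := 1) hf hm0 (by norm_num) hV hV0
    (fun s hs => by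
      rw [(hasDerivAt_sinh_pow m s).deriv, mul_div_cancel₀ _ two_ne_zero, one_mul]
      exact mul_sinh_pow_le m hs) i1 i2 ha hab'
  have h2 : ∫ s in a..b, f s ^ 2 * Real.sinh s ^ m ≤ ∫ s in a..b', f s ^ 2 * Real.sinh s ^ m := by
    rw [intervalIntegral.integral_of_le hab, intervalIntegral.integral_of_le hab']
    refine setIntegral_mono_set (i1.mono_set fun x hx => ha.trans hx.1) ?_
      (Set.Ioc_subset_Ioc_right hb').eventuallyLE
    rw [EventuallyLE, ae_restrict_iff' measurableSet_Ioc]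
    exact Eventually.of_forall fun s hs => n1 s (ha.trans hs.1)
  have h3 : ∫ s in a..b', deriv f s ^ 2 * Real.sinh s ^ m ≤
      ∫ s in Set.Ioi 0, deriv f s ^ 2 * Real.sinh s ^ m := by
    rw [intervalIntegral.integral_of_le hab']
    refine setIntegral_mono_set i2 ?_
      (show Set.Ioc a b' ⊆ Set.Ioi 0 from fun x hx => ha.trans hx.1).eventuallyLE
    rw [EventuallyLE, ae_restrict_iff' measurableSet_Ioi]
    exact Eventually.of_forall n2
  have h4 := mul_le_mul_of_nonneg_left h2 (sq_nonneg ((m : ℝ) / 2))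
  have h5 := mul_nonneg hm0 (n1 a ha)
  linarith

theorem sinh_le_two_mul {s : ℝ} (h0 : 0 < s) (h1 : s ≤ 1) : Real.sinh s ≤ 2 * s := by
  have a1 := Real.abs_exp_sub_one_le (x := s) (by rwa [abs_of_pos h0])
  have a2 := Real.abs_exp_sub_one_le (x := -s) (by rwa [abs_neg, abs_of_pos h0])
  rw [abs_neg, abs_of_pos h0] at a2
  rw [abs_of_pos h0] at a1
  have b1 := (abs_le.1 a1).2
  have b2 := (abs_le.1 a2).1
  rw [Real.sinh_eq]
  linarith

/-- A locally absolutely continuous `f` with `∫ f² / sinh^m < ∞`, `m ≥ 1`, comes arbitrarily close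
to `0` near `0`, because `1 / sinh^m` is not integrable there. -/
theorem exists_sq_lt_near_zero {m : ℕ} (hm : 1 ≤ m) {f : ℝ → ℝ}
    (hi : IntegrableOn (fun s => f s ^ 2 * (Real.sinh s ^ m)⁻¹) (Set.Ioi 0)) {δ a : ℝ}
    (hδ : 0 < δ) (ha : 0 < a) : ∃ s, 0 < s ∧ s < a ∧ f s ^ 2 < δ := by
  by_contra hcon
  push Not at hcon
  set a' := min (a / 2) (1 / 2) with ha'
  have ha'0 : 0 < a' := lt_min (by linarith) (by norm_num)
  have h1 : IntervalIntegrable (fun s : ℝ => s⁻¹) volume 0 a' := by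
    rw [intervalIntegrable_iff_integrableOn_Ioc_of_le ha'0.le]
    refine Integrable.mono' ((hi.mono_set
      (Set.Ioc_subset_Ioi_self : Set.Ioc 0 a' ⊆ Set.Ioi 0)).const_mul (2 / δ))
      measurable_inv.aestronglyMeasurable ?_
    rw [ae_restrict_iff' measurableSet_Ioc]
    refine Eventually.of_forall fun s hs => ?_
    have hs0 : 0 < s := hs.1
    have hsa : s < a := lt_of_le_of_lt (hs.2.trans (min_le_left _ _)) (by linarith)
    have hs1 : s ≤ 1 / 2 := hs.2.trans (min_le_right _ _)
    have hsh : 0 < Real.sinh s := Real.sinh_pos_iff.2 hs0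
    have hle : Real.sinh s ≤ 2 * s := sinh_le_two_mul hs0 (by linarith)
    have hpow : Real.sinh s ^ m ≤ 2 * s :=
      (pow_le_of_le_one hsh.le (by linarith) (by omega)).trans hle
    have hinv : (2 * s)⁻¹ ≤ (Real.sinh s ^ m)⁻¹ := inv_anti₀ (pow_pos hsh m) hpow
    rw [Real.norm_of_nonneg (inv_nonneg.2 hs0.le)]
    calc s⁻¹ = 2 / δ * (δ * (2 * s)⁻¹) := by field_simp
      _ ≤ 2 / δ * (f s ^ 2 * (Real.sinh s ^ m)⁻¹) := by
        refine mul_le_mul_of_nonneg_left ?_ (by positivity)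
        exact mul_le_mul (hcon s hs0 hsa) hinv (by positivity) (sq_nonneg _)
  rw [intervalIntegrable_inv_iff] at h1
  rcases h1 with h1 | h1
  · exact ha'0.ne h1
  · exact h1 Set.left_mem_uIcc

/-- If both `f² / sinh^m` and `f'² / sinh^m` are integrable, then `f² / sinh^m = O(s)` at `0`. -/
theorem exists_sq_mul_inv_sinh_pow_le {m : ℕ} (hm : 1 ≤ m) {f : ℝ → ℝ} (hf : LocallyAC f)
    (hi : IntegrableOn (fun s => f s ^ 2 * (Real.sinh s ^ m)⁻¹) (Set.Ioi 0))
    (hi' : IntegrableOn (fun s => deriv f s ^ 2 * (Real.sinh s ^ m)⁻¹) (Set.Ioi 0)) :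
    ∃ C, 0 ≤ C ∧ ∀ a, 0 < a → f a ^ 2 * (Real.sinh a ^ m)⁻¹ ≤ C * a := by
  set J := ∫ s in Set.Ioi 0, deriv f s ^ 2 * (Real.sinh s ^ m)⁻¹ with hJ
  have n2 : ∀ s : ℝ, 0 < s → 0 ≤ deriv f s ^ 2 * (Real.sinh s ^ m)⁻¹ := fun s hs =>
    mul_nonneg (sq_nonneg _) (inv_nonneg.2 (pow_nonneg (Real.sinh_pos_iff.2 hs).le _))
  have hJ0 : 0 ≤ J := setIntegral_nonneg measurableSet_Ioi fun s hs => n2 s hs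
  refine ⟨((J + 1) / 2) ^ 2, sq_nonneg _, fun a ha => ?_⟩
  have hW : 0 < Real.sinh a ^ m := pow_pos (Real.sinh_pos_iff.2 ha) m
  set t := √(a * Real.sinh a ^ m) with ht
  have ht2 : t ^ 2 = a * Real.sinh a ^ m := Real.sq_sqrt (by positivity)
  have ht0 : 0 < t := Real.sqrt_pos.2 (by positivity)
  have hmain : |f a| ≤ t * ((J + 1) / 2) := by
    refine le_of_forall_pos_le_add fun δ hδ => ?_
    obtain ⟨s, hs0, hsa, hs⟩ := exists_sq_lt_near_zero hm hi (sq_pos_of_pos hδ) ha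
    have hfs : |f s| ≤ δ := (abs_lt_of_sq_lt_sq hs hδ.le).le
    have hFTC := (hf s a hs0 hsa.le).integral_deriv_eq_sub
    have id := (hf s a hs0 hsa.le).intervalIntegrable_deriv
    have hsub : Set.Ioc s a ⊆ Set.Ioi 0 := fun x hx => hs0.trans hx.1
    have iJ : IntervalIntegrable (fun x => deriv f x ^ 2 * (Real.sinh x ^ m)⁻¹) volume s a :=
      (intervalIntegrable_iff_integrableOn_Ioc_of_le hsa.le).2 (hi'.mono_set hsub)
    -- `|f'| ≤ (t f'² / W + W / t) / 2` with `W = sinh^m` increasing, and `t² = a W(a)`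
    have hle : ∫ x in s..a, |deriv f x| ≤
        ∫ x in s..a, (t / 2 * (deriv f x ^ 2 * (Real.sinh x ^ m)⁻¹) +
          Real.sinh a ^ m / (2 * t)) := by
      refine intervalIntegral.integral_mono_on hsa.le id.abs
        ((iJ.const_mul _).add intervalIntegrable_const) fun x hx => ?_
      have hx0 : 0 < x := lt_of_lt_of_le hs0 hx.1
      have hWx : 0 < Real.sinh x ^ m := pow_pos (Real.sinh_pos_iff.2 hx0) m
      have hmono : Real.sinh x ^ m ≤ Real.sinh a ^ m :=
        pow_le_pow_left₀ (Real.sinh_pos_iff.2 hx0).le (Real.sinh_le_sinh.2 hx.2) m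
      have h1 : |deriv f x| ≤ t / 2 * (deriv f x ^ 2 * (Real.sinh x ^ m)⁻¹) +
          Real.sinh x ^ m / (2 * t) := by
        rw [← sq_abs (deriv f x)]
        set y := |deriv f x|
        have e : t / 2 * (y ^ 2 * (Real.sinh x ^ m)⁻¹) + Real.sinh x ^ m / (2 * t) - y =
            (t * y - Real.sinh x ^ m) ^ 2 / (2 * t * Real.sinh x ^ m) := by
          field_simp; ring
        have : 0 ≤ (t * y - Real.sinh x ^ m) ^ 2 / (2 * t * Real.sinh x ^ m) := by positivity
        linarith
      refine h1.trans ?_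
      gcongr
    rw [intervalIntegral.integral_add (iJ.const_mul _) intervalIntegrable_const,
      intervalIntegral.integral_const_mul, intervalIntegral.integral_const, smul_eq_mul] at hle
    have hJle : ∫ x in s..a, deriv f x ^ 2 * (Real.sinh x ^ m)⁻¹ ≤ J := by
      rw [intervalIntegral.integral_of_le hsa.le]
      refine setIntegral_mono_set hi' ?_ hsub.eventuallyLE
      rw [EventuallyLE, ae_restrict_iff' measurableSet_Ioi]
      exact Eventually.of_forall n2
    have habs : |f a - f s| ≤ ∫ x in s..a, |deriv f x| := by
      rw [← hFTC]; exact intervalIntegral.abs_integral_le_integral_abs hsa.le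
    have hlast : (a - s) * (Real.sinh a ^ m / (2 * t)) ≤ t / 2 := by
      have : a * (Real.sinh a ^ m / (2 * t)) = t / 2 := by
        rw [← mul_div_assoc, ← ht2]; field_simp
      have h0 : 0 ≤ s * (Real.sinh a ^ m / (2 * t)) := by positivity
      linarith
    have hJt := mul_le_mul_of_nonneg_left hJle (show 0 ≤ t / 2 by linarith)
    have htri : |f a| ≤ |f a - f s| + |f s| := by
      have := abs_add_le (f a - f s) (f s); simpa using this
    linarith
  have hsq : f a ^ 2 ≤ (t * ((J + 1) / 2)) ^ 2 := by
    rw [← sq_abs (f a)]; exact pow_le_pow_left₀ (abs_nonneg _) hmain 2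
  rw [mul_pow, ht2] at hsq
  calc f a ^ 2 * (Real.sinh a ^ m)⁻¹
      ≤ a * Real.sinh a ^ m * ((J + 1) / 2) ^ 2 * (Real.sinh a ^ m)⁻¹ := by gcongr
    _ = ((J + 1) / 2) ^ 2 * a := by field_simp

/-- The sharp Poincaré inequality with the reciprocal weight `sinh^{-m}`, `m ≥ 1`. Here the
boundary term at `0` has the unfavourable sign but vanishes in the limit. -/
theorem inv_sinh_pow_poincare {m : ℕ} (hm : 1 ≤ m) {f : ℝ → ℝ} (hf : LocallyAC f)
    (hfin : ∫⁻ s in Set.Ioi 0, ENNReal.ofReal (f s ^ 2 * (Real.sinh s ^ m)⁻¹) ≠ ⊤) :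
    ENNReal.ofReal (((m : ℝ) / 2) ^ 2) *
        ∫⁻ s in Set.Ioi 0, ENNReal.ofReal (f s ^ 2 * (Real.sinh s ^ m)⁻¹) ≤
      ∫⁻ s in Set.Ioi 0, ENNReal.ofReal (deriv f s ^ 2 * (Real.sinh s ^ m)⁻¹) := by
  by_cases htop : ∫⁻ s in Set.Ioi 0, ENNReal.ofReal (deriv f s ^ 2 * (Real.sinh s ^ m)⁻¹) = ⊤
  · rw [htop]; exact le_top
  have hVpos : ∀ s : ℝ, 0 < s → 0 < Real.sinh s ^ m := fun s hs =>
    pow_pos (Real.sinh_pos_iff.2 hs) _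
  have hV : ContDiffOn ℝ 1 (fun s : ℝ => (Real.sinh s ^ m)⁻¹) (Set.Ioi 0) :=
    (contDiffOn_sinh_pow m).inv fun s hs => (hVpos s hs).ne'
  have hV0 : ∀ s : ℝ, 0 < s → 0 ≤ (Real.sinh s ^ m)⁻¹ := fun s hs => (inv_pos.2 (hVpos s hs)).le
  have n1 : ∀ s : ℝ, 0 < s → 0 ≤ f s ^ 2 * (Real.sinh s ^ m)⁻¹ := fun s hs =>
    mul_nonneg (sq_nonneg _) (hV0 s hs)
  have n2 : ∀ s : ℝ, 0 < s → 0 ≤ deriv f s ^ 2 * (Real.sinh s ^ m)⁻¹ := fun s hs =>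
    mul_nonneg (sq_nonneg _) (hV0 s hs)
  have i1 : IntegrableOn (fun s => f s ^ 2 * (Real.sinh s ^ m)⁻¹) (Set.Ioi 0) :=
    integrableOn_of_lintegral_ne_top
      (((hf.continuousOn.pow 2).mul hV.continuousOn).aestronglyMeasurable measurableSet_Ioi) n1 hfin
  have i2 : IntegrableOn (fun s => deriv f s ^ 2 * (Real.sinh s ^ m)⁻¹) (Set.Ioi 0) :=
    integrableOn_of_lintegral_ne_top (aestronglyMeasurable_deriv_sq_mul hV.continuousOn) n2 htop
  refine lintegral_le_of_forall_interval (sq_nonneg _) n1 n2 i1 i2 fun a b ha hab => ?_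
  have hm0 : (0 : ℝ) ≤ m / 2 := by positivity
  obtain ⟨C, hC, hCle⟩ := exists_sq_mul_inv_sinh_pow_le hm hf i1 i2
  refine le_of_forall_pos_le_add fun δ hδ => ?_
  obtain ⟨a', ha'0, ha'a, hsmall⟩ : ∃ a', 0 < a' ∧ a' ≤ a ∧
      (m : ℝ) / 2 * (f a' ^ 2 * (Real.sinh a' ^ m)⁻¹) ≤ δ := by
    have hD : 0 < (m : ℝ) / 2 * C + 1 := by positivity
    refine ⟨min a (δ / ((m : ℝ) / 2 * C + 1)), lt_min ha (by positivity), min_le_left _ _, ?_⟩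
    refine (mul_le_mul_of_nonneg_left (hCle _ (lt_min ha (by positivity))) hm0).trans ?_
    have h1 : (m : ℝ) / 2 * (C * min a (δ / ((m : ℝ) / 2 * C + 1))) ≤
        (m : ℝ) / 2 * (C * (δ / ((m : ℝ) / 2 * C + 1))) := by
      gcongr; exact min_le_right _ _
    refine h1.trans ?_
    rw [← mul_assoc, ← mul_div_assoc, div_le_iff₀ hD]
    nlinarith
  have hab' := ha'a.trans hab
  have h1 := weighted_sq_le_of_locallyAC (c := (m : ℝ) / 2) (ε := -1) hf hm0 (by norm_num) hV hV0
    (fun s hs => by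
      rw [((hasDerivAt_sinh_pow m s).fun_inv (hVpos s hs).ne').deriv,
        mul_div_cancel₀ _ two_ne_zero]
      have h := mul_sinh_pow_le m hs
      have hp := hVpos s hs
      rw [neg_one_mul, neg_div, neg_neg, le_div_iff₀ (by positivity)]
      calc (m : ℝ) * (Real.sinh s ^ m)⁻¹ * (Real.sinh s ^ m) ^ 2 = m * Real.sinh s ^ m := by
            field_simp
        _ ≤ _ := h) i1 i2 ha'0 hab'
  have h2 : ∫ s in a..b, f s ^ 2 * (Real.sinh s ^ m)⁻¹ ≤
      ∫ s in a'..b, f s ^ 2 * (Real.sinh s ^ m)⁻¹ := by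
    rw [intervalIntegral.integral_of_le hab, intervalIntegral.integral_of_le hab']
    refine setIntegral_mono_set (i1.mono_set fun x hx => ha'0.trans hx.1) ?_
      (Set.Ioc_subset_Ioc_left ha'a).eventuallyLE
    rw [EventuallyLE, ae_restrict_iff' measurableSet_Ioc]
    exact Eventually.of_forall fun s hs => n1 s (ha'0.trans hs.1)
  have h3 : ∫ s in a'..b, deriv f s ^ 2 * (Real.sinh s ^ m)⁻¹ ≤
      ∫ s in Set.Ioi 0, deriv f s ^ 2 * (Real.sinh s ^ m)⁻¹ := by
    rw [intervalIntegral.integral_of_le hab']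
    refine setIntegral_mono_set i2 ?_
      (show Set.Ioc a' b ⊆ Set.Ioi 0 from fun x hx => ha'0.trans hx.1).eventuallyLE
    rw [EventuallyLE, ae_restrict_iff' measurableSet_Ioi]
    exact Eventually.of_forall n2
  have h4 := mul_le_mul_of_nonneg_left h2 (sq_nonneg ((m : ℝ) / 2))
  have h5 := mul_nonneg hm0 (n1 b (ha.trans_le hab))
  linarith

/-! ### Square-integrable functions on hyperbolic space -/

theorem hypVol_lt_top_of_isCompact {K : Set (Coord N)} (hK : IsCompact K)
    (hKs : K ⊆ Metric.ball 0 1) : hypVol N K < ⊤ := by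
  have hc : ContinuousOn (fun x : Coord N => (2 / (1 - ‖x‖ ^ 2)) ^ N) K := by
    refine ContinuousOn.pow (ContinuousOn.div continuousOn_const (by fun_prop) fun x hx => ?_) N
    have h1 : ‖x‖ < 1 := mem_ball_zero_iff.1 (hKs hx)
    have h2 := norm_nonneg x
    nlinarith
  obtain ⟨C, hC⟩ := hK.exists_bound_of_continuousOn hc
  rw [hypVol, withDensity_apply _ hK.measurableSet]
  refine lt_of_le_of_lt (setLIntegral_mono' hK.measurableSet fun x hx =>
    ENNReal.ofReal_le_ofReal ((le_abs_self _).trans (hC x hx))) ?_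
  rw [setLIntegral_const]
  exact ENNReal.mul_lt_top ENNReal.ofReal_lt_top
    (lt_of_le_of_lt (Measure.restrict_apply_le _ _) hK.measure_lt_top)

theorem hypVol_absolutelyContinuous (N : ℕ) : hypVol N ≪ volume :=
  (withDensity_absolutelyContinuous _ _).trans Measure.restrict_le_self.absolutelyContinuous

/-- Almost every point lies in the ball and off the pole. -/
theorem ae_mem_puncturedBall (hN : 0 < N) : ∀ᵐ x ∂(hypVol N), x ∈ puncturedBall N := by
  have : Nonempty (Fin N) := ⟨⟨0, hN⟩⟩
  have h1 : ∀ᵐ x ∂(hypVol N), x ∈ Metric.ball (0 : Coord N) 1 :=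
    (withDensity_absolutelyContinuous _ _).ae_le (ae_restrict_mem measurableSet_ball)
  have h2 : ∀ᵐ x ∂(hypVol N), x ≠ (0 : Coord N) :=
    (hypVol_absolutelyContinuous N).ae_le (Measure.ae_ne volume 0)
  filter_upwards [h1, h2] with x hx1 hx2 using ⟨hx1, hx2⟩

theorem restrict_hypVol_puncturedBall (hN : 0 < N) :
    (hypVol N).restrict (puncturedBall N) = hypVol N :=
  Measure.restrict_eq_self_of_ae_mem (ae_mem_puncturedBall hN)

theorem memLp_of_continuousOn_of_support {φ : Coord N → ℝ} {K : Set (Coord N)} (hK : IsCompact K)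
    (hKs : K ⊆ Metric.ball 0 1) (hφ : ContinuousOn φ K) (hs : Function.support φ ⊆ K)
    (p : ℝ≥0∞) : MemLp φ p (hypVol N) := by
  obtain ⟨C, hC⟩ := hK.exists_bound_of_continuousOn hφ
  have hind : K.indicator φ = φ := Set.indicator_eq_self.2 hs
  rw [← hind, memLp_indicator_iff_restrict hK.measurableSet]
  have : IsFiniteMeasure ((hypVol N).restrict K) :=
    ⟨by rw [Measure.restrict_apply_univ]; exact hypVol_lt_top_of_isCompact hK hKs⟩
  refine MemLp.of_bound (hφ.aestronglyMeasurable hK.measurableSet) C ?_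
  rw [ae_restrict_iff' hK.measurableSet]
  exact Eventually.of_forall hC

theorem IsTest.memLp {U : Set (Coord N)} (hU : U ⊆ Metric.ball 0 1) {φ : Coord N → ℝ}
    (hφ : IsTest U φ) : MemLp φ 2 (hypVol N) :=
  memLp_of_continuousOn_of_support hφ.2.1 (hφ.2.2.trans hU) hφ.1.continuous.continuousOn
    (subset_tsupport φ) 2

theorem IsTest.integrable {U : Set (Coord N)} (hU : U ⊆ Metric.ball 0 1) {φ : Coord N → ℝ}
    (hφ : IsTest U φ) : Integrable φ (hypVol N) :=
  memLp_one_iff_integrable.1 (memLp_of_continuousOn_of_support hφ.2.1 (hφ.2.2.trans hU)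
    hφ.1.continuous.continuousOn (subset_tsupport φ) 1)

theorem memLp_two_of_lintegral_lt_top {w : Coord N → ℝ}
    (hm : AEStronglyMeasurable w (hypVol N))
    (h : ∫⁻ x, ENNReal.ofReal (w x ^ 2) ∂(hypVol N) < ⊤) : MemLp w 2 (hypVol N) := by
  rw [memLp_two_iff_integrable_sq hm]
  exact (lintegral_ofReal_ne_top_iff_integrable (hm.pow 2)
    (Eventually.of_forall fun x => sq_nonneg _)).1 h.ne

theorem lintegral_sq_eq_eLpNorm_sq (w : Coord N → ℝ) :
    ∫⁻ x, ENNReal.ofReal (w x ^ 2) ∂(hypVol N) = eLpNorm w 2 (hypVol N) ^ 2 := by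
  have h := eLpNorm_nnreal_pow_eq_lintegral (f := w) (μ := hypVol N) (p := 2) two_ne_zero
  simp only [NNReal.coe_ofNat, ENNReal.coe_ofNat, ENNReal.rpow_ofNat] at h
  rw [h]
  refine lintegral_congr fun x => ?_
  rw [← sq_abs, ENNReal.ofReal_pow (abs_nonneg _), ← Real.norm_eq_abs, ofReal_norm]

theorem lintegral_sq_polar (hN : 0 < N) {w : Coord N → ℝ} (hw : AEMeasurable w (hypVol N)) :
    ∫⁻ x, ENNReal.ofReal (w x ^ 2) ∂(hypVol N) = ∫⁻ σ : Metric.sphere (0 : Coord N) 1,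
      (∫⁻ s in Set.Ioi 0, ENNReal.ofReal (w (polar s (σ : Coord N)) ^ 2 * Real.sinh s ^ (N - 1)))
        ∂(sphereVol N) := by
  rw [lintegral_polar hN (hw.pow_const 2).ennreal_ofReal]
  refine lintegral_congr fun σ => setLIntegral_congr_fun measurableSet_Ioi fun s hs => ?_
  rw [mul_comm, ENNReal.ofReal_mul (sq_nonneg _)]

theorem integral_rayVol (N : ℕ) (f : ℝ → ℝ) :
    ∫ s, f s ∂(rayVol N) = ∫ s in Set.Ioi 0, Real.sinh s ^ (N - 1) * f s := by
  rw [rayVol, integral_withDensity_eq_integral_toReal_smul (measurable_rayDensity N)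
    (Eventually.of_forall fun _ => ENNReal.ofReal_lt_top)]
  refine setIntegral_congr_fun measurableSet_Ioi fun s hs => ?_
  have : 0 ≤ Real.sinh s ^ (N - 1) := pow_nonneg (Real.sinh_nonneg_iff.2 (le_of_lt hs)) _
  simp only [ENNReal.toReal_ofReal this, smul_eq_mul]

theorem integrable_polar (hN : 0 < N) {H : Coord N → ℝ} (hH : Integrable H (hypVol N)) :
    Integrable (fun p : Metric.sphere (0 : Coord N) 1 × ℝ => H (polar p.2 (p.1 : Coord N)))
      ((sphereVol N).prod (rayVol N)) :=
  (measurePreserving_polar hN).integrable_comp_of_integrable hH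

theorem integral_polar (hN : 0 < N) {H : Coord N → ℝ} (hH : Integrable H (hypVol N)) :
    ∫ x, H x ∂(hypVol N) = ∫ σ : Metric.sphere (0 : Coord N) 1,
      (∫ s in Set.Ioi 0, Real.sinh s ^ (N - 1) * H (polar s (σ : Coord N))) ∂(sphereVol N) := by
  have hmp := measurePreserving_polar hN
  have h1 := integral_map hmp.measurable.aemeasurable (f := H) (by
    rw [hmp.map_eq]; exact hH.aestronglyMeasurable)
  rw [hmp.map_eq] at h1
  rw [h1, integral_prod (fun p : Metric.sphere (0 : Coord N) 1 × ℝ =>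
    H (polar p.2 (p.1 : Coord N))) (integrable_polar hN hH)]
  refine integral_congr_ae (Eventually.of_forall fun σ => ?_)
  exact integral_rayVol N _

/-! ### Test functions in separated variables -/

/-- The function `a(r) β(σ)` in polar coordinates. -/
def sepVar (a : ℝ → ℝ) (β : Coord N → ℝ) (x : Coord N) : ℝ :=
  a (hypRadius x) * β (‖x‖⁻¹ • x)

theorem sepVar_polar (a : ℝ → ℝ) (β : Coord N → ℝ) {s : ℝ} (hs : 0 < s) {σ : Coord N}
    (hσ : ‖σ‖ = 1) : sepVar a β (polar s σ) = a s * β σ := by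
  rw [sepVar, hypRadius_polar hs hσ, direction_polar hs hσ]

theorem radialDeriv_sepVar_polar (a : ℝ → ℝ) (β : Coord N → ℝ) {s : ℝ} (hs : 0 < s) {σ : Coord N}
    (hσ : ‖σ‖ = 1) : radialDeriv (sepVar a β) (polar s σ) = deriv a s * β σ := by
  rw [radialDeriv_polar _ hs hσ]
  have : (fun s => sepVar a β (polar s σ)) =ᶠ[𝓝 s] fun s => a s * β σ := by
    filter_upwards [lt_mem_nhds hs] with t ht using sepVar_polar a β ht hσ
  rw [this.deriv_eq, deriv_mul_const_field]

theorem isTest_sepVar {a : ℝ → ℝ} (ha : IsRayTest a) {β : Coord N → ℝ} (hβ : ContDiff ℝ ∞ β) :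
    IsTest (puncturedBall N) (sepVar a β) := by
  obtain ⟨p, q, hp, hp1, hq1, hpq⟩ := ha.exists_Icc
  have hK : IsCompact ((fun z : ℝ × Coord N => polar z.1 z.2) ''
      (Set.Icc p q ×ˢ Metric.sphere 0 1)) := by
    refine (isCompact_Icc.prod (isCompact_sphere 0 1)).image ?_
    exact (contDiff_tanh_half.continuous.comp continuous_fst).smul continuous_snd
  refine isTest_of_contDiffOn hK ?_ ?_ ?_
  · rintro _ ⟨⟨s, σ⟩, ⟨hs, hσ⟩, rfl⟩
    exact polar_mem_puncturedBall (lt_of_lt_of_le hp hs.1) (mem_sphere_zero_iff_norm.1 hσ)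
  · refine ContDiffOn.mul (ha.1.comp_contDiffOn contDiffOn_hypRadius) (hβ.comp_contDiffOn ?_)
    refine ContDiffOn.smul (ContDiffOn.inv (contDiffOn_id.norm ℝ fun _ hx => hx.2) ?_)
      contDiffOn_id
    exact fun x hx => norm_ne_zero_iff.2 hx.2
  · intro x hx
    have h1 : hypRadius x ∈ Set.Ioo p q := by
      by_contra h
      exact hx (by rw [sepVar, hpq _ h, zero_mul])
    have hxb : x ∈ puncturedBall N := by
      by_contra h
      rw [hypRadius_eq_zero h] at h1
      exact absurd h1.1 (not_lt.2 hp.le)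
    exact ⟨(hypRadius x, ‖x‖⁻¹ • x), ⟨⟨h1.1.le, h1.2.le⟩,
      mem_sphere_zero_iff_norm.2 (norm_direction hxb.2)⟩, polar_hypRadius hxb⟩

/-! ### The Poincaré inequality for one radial derivative -/

/-- Square-integrability for a weight that is positive off `0` gives local integrability. -/
theorem locallyIntegrableOn_of_sq_sinh {m : ℕ} {f : ℝ → ℝ} (hf : Measurable f)
    (hfin : ∫⁻ s in Set.Ioi 0, ENNReal.ofReal (f s ^ 2 * Real.sinh s ^ m) ≠ ⊤) :
    LocallyIntegrableOn f (Set.Ioi 0) := by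
  have hpos : ∀ s : ℝ, 0 < s → 0 < Real.sinh s ^ m := fun s hs =>
    pow_pos (Real.sinh_pos_iff.2 hs) _
  have h1 : IntegrableOn (fun s => f s ^ 2 * Real.sinh s ^ m) (Set.Ioi 0) :=
    integrableOn_of_lintegral_ne_top (by fun_prop) (fun s hs =>
      mul_nonneg (sq_nonneg _) (hpos s hs).le) hfin
  have h2 : LocallyIntegrableOn (fun s => f s ^ 2 * Real.sinh s ^ m * (Real.sinh s ^ m)⁻¹)
      (Set.Ioi 0) :=
    h1.locallyIntegrableOn.mul_continuousOn
      ((contDiffOn_sinh_pow m).continuousOn.inv₀ fun s hs => (hpos s hs).ne')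
      isOpen_Ioi.isLocallyClosed
  have h3 : LocallyIntegrableOn
      (fun s => f s ^ 2 * Real.sinh s ^ m * (Real.sinh s ^ m)⁻¹ + 1) (Set.Ioi 0) :=
    h2.add ((locallyIntegrable_const 1).locallyIntegrableOn _)
  intro x hx
  obtain ⟨U, hU, hUi⟩ := h3 x hx
  refine ⟨U ∩ Set.Ioi 0, inter_mem hU self_mem_nhdsWithin, ?_⟩
  refine Integrable.mono' (hUi.mono_set Set.inter_subset_left) hf.aestronglyMeasurable ?_
  have hms : ∀ᵐ s ∂(volume.restrict (U ∩ Set.Ioi 0)), s ∈ Set.Ioi (0 : ℝ) :=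
    ae_restrict_of_ae_restrict_of_subset Set.inter_subset_right (ae_restrict_mem measurableSet_Ioi)
  filter_upwards [hms] with s hs
  rw [mul_assoc, mul_inv_cancel₀ (hpos s hs).ne', mul_one, Real.norm_eq_abs, ← sq_abs]
  nlinarith [sq_nonneg (|f s| - 1), abs_nonneg (f s)]

/-- The weight with which the weak form of the `j`-th step becomes an unweighted weak derivative on
almost every ray: `∂/∂r` needs none, and `w ↦ ∂w/∂r + (N - 1) coth r w` is
`sinh^{1-N} ∂/∂r (sinh^{N-1} w)`. -/
def stepWeight (N j : ℕ) (s : ℝ) : ℝ := if Even j then 1 else Real.sinh s ^ (N - 1)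

theorem contDiffOn_stepWeight (N j : ℕ) : ContDiffOn ℝ ∞ (stepWeight N j) (Set.Ioi 0) := by
  unfold stepWeight
  split_ifs <;> fun_prop

theorem measurable_stepWeight (N j : ℕ) : Measurable (stepWeight N j) := by
  unfold stepWeight
  split_ifs <;> fun_prop

/-- The one-dimensional Poincaré inequality on a ray, for the `j`-th step. -/
theorem ray_poincare (hN : 2 ≤ N) (j : ℕ) {F f g : ℝ → ℝ} (hF : LocallyAC F)
    (hFf : ∀ᵐ s ∂(volume.restrict (Set.Ioi 0)), F s = f s * stepWeight N j s)
    (hFg : ∀ᵐ s ∂(volume.restrict (Set.Ioi 0)), deriv F s = g s * stepWeight N j s)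
    (hfin : ∫⁻ s in Set.Ioi 0, ENNReal.ofReal (f s ^ 2 * Real.sinh s ^ (N - 1)) ≠ ⊤) :
    ENNReal.ofReal ((((N : ℝ) - 1) / 2) ^ 2) *
        ∫⁻ s in Set.Ioi 0, ENNReal.ofReal (f s ^ 2 * Real.sinh s ^ (N - 1)) ≤
      ∫⁻ s in Set.Ioi 0, ENNReal.ofReal (g s ^ 2 * Real.sinh s ^ (N - 1)) := by
  have hcast : (N : ℝ) - 1 = ((N - 1 : ℕ) : ℝ) := by
    rw [Nat.cast_sub (by omega), Nat.cast_one]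
  rw [hcast]
  rcases Nat.even_or_odd j with hj | hj
  · simp only [stepWeight, hj, if_true, mul_one] at hFf hFg
    have e1 : ∫⁻ s in Set.Ioi 0, ENNReal.ofReal (F s ^ 2 * Real.sinh s ^ (N - 1)) =
        ∫⁻ s in Set.Ioi 0, ENNReal.ofReal (f s ^ 2 * Real.sinh s ^ (N - 1)) :=
      lintegral_congr_ae (by filter_upwards [hFf] with s hs; rw [hs])
    have e2 : ∫⁻ s in Set.Ioi 0, ENNReal.ofReal (deriv F s ^ 2 * Real.sinh s ^ (N - 1)) =
        ∫⁻ s in Set.Ioi 0, ENNReal.ofReal (g s ^ 2 * Real.sinh s ^ (N - 1)) :=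
      lintegral_congr_ae (by filter_upwards [hFg] with s hs; rw [hs])
    rw [← e1, ← e2]
    exact sinh_pow_poincare (N - 1) hF (e1 ▸ hfin)
  -- with `F = sinh^{N-1} f` the weight `sinh^{N-1}` for `f` turns into `sinh^{1-N}` for `F`
  · simp only [stepWeight, Nat.not_even_iff_odd.2 hj, if_false] at hFf hFg
    have key : ∀ y s : ℝ, 0 < s → (y * Real.sinh s ^ (N - 1)) ^ 2 * (Real.sinh s ^ (N - 1))⁻¹ =
        y ^ 2 * Real.sinh s ^ (N - 1) := fun y s hs => by
      have := (pow_pos (Real.sinh_pos_iff.2 hs) (N - 1)).ne'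
      field_simp
    have e1 : ∫⁻ s in Set.Ioi 0, ENNReal.ofReal (F s ^ 2 * (Real.sinh s ^ (N - 1))⁻¹) =
        ∫⁻ s in Set.Ioi 0, ENNReal.ofReal (f s ^ 2 * Real.sinh s ^ (N - 1)) :=
      lintegral_congr_ae (by
        filter_upwards [hFf, ae_restrict_mem measurableSet_Ioi] with s hs h0
        rw [hs, key _ _ h0])
    have e2 : ∫⁻ s in Set.Ioi 0, ENNReal.ofReal (deriv F s ^ 2 * (Real.sinh s ^ (N - 1))⁻¹) =
        ∫⁻ s in Set.Ioi 0, ENNReal.ofReal (g s ^ 2 * Real.sinh s ^ (N - 1)) :=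
      lintegral_congr_ae (by
        filter_upwards [hFg, ae_restrict_mem measurableSet_Ioi] with s hs h0
        rw [hs, key _ _ h0])
    rw [← e1, ← e2]
    exact inv_sinh_pow_poincare (by omega) hF (e1 ▸ hfin)

theorem IsRayTest.mul_left {a ψ : ℝ → ℝ} (hψ : IsRayTest ψ) (ha : ContDiffOn ℝ ∞ a (Set.Ioi 0)) :
    IsRayTest (fun s => a s * ψ s) := by
  have hts : tsupport (fun s => a s * ψ s) ⊆ tsupport ψ := tsupport_mul_subset_right
  refine ⟨contDiff_iff_contDiffAt.2 fun x => ?_,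
    hψ.2.1.of_isClosed_subset (isClosed_tsupport _) hts, hts.trans hψ.2.2⟩
  by_cases hx : x ∈ tsupport (fun s => a s * ψ s)
  · exact (ha.contDiffAt (isOpen_Ioi.mem_nhds (hψ.2.2 (hts hx)))).mul hψ.1.contDiffAt
  · exact contDiffAt_const.congr_of_eventuallyEq (notMem_tsupport_iff_eventuallyEq.1 hx)

/-- For every test function `ψ` on the half-line there is a radial profile `a` with which the
integrand in the weak form of the `j`-th step becomes that of an unweighted weak derivative. -/
theorem exists_profile (N j : ℕ) {ψ : ℝ → ℝ} (hψ : IsRayTest ψ) :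
    ∃ a, IsRayTest a ∧ ∀ (β : Coord N → ℝ) (s : ℝ) (σ : Coord N), 0 < s → ‖σ‖ = 1 → ∀ y z : ℝ,
      Real.sinh s ^ (N - 1) *
        (z * sepVar a β (polar s σ) - y * gradStepAdj j (sepVar a β) (polar s σ)) =
      β σ * (z * stepWeight N j s * ψ s + y * stepWeight N j s * deriv ψ s) := by
  rcases Nat.even_or_odd j with hj | hj
  · have hinv : ContDiffOn ℝ ∞ (fun s : ℝ => (Real.sinh s ^ (N - 1))⁻¹) (Set.Ioi 0) :=
      ContDiffOn.inv (by fun_prop) fun s hs => (pow_pos (Real.sinh_pos_iff.2 hs) _).ne'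
    refine ⟨_, hψ.mul_left hinv, fun β s σ hs hσ y z => ?_⟩
    have hsh : Real.sinh s ≠ 0 := (Real.sinh_pos_iff.2 hs).ne'
    have hd := ((hasDerivAt_sinh_pow (N - 1) s).fun_inv (pow_ne_zero _ hsh)).mul
      (hψ.1.differentiable (by simp) s).hasDerivAt
    have hd' : deriv (fun s : ℝ => (Real.sinh s ^ (N - 1))⁻¹ * ψ s) s = _ := hd.deriv
    simp only [gradStepAdj, stepWeight, hj, if_true, radialDerivAdj]
    rw [radialDeriv_sepVar_polar _ _ hs hσ, sepVar_polar _ _ hs hσ, meanCurv_polar hs hσ, hd']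
    rcases N with _ | _ | n
    · simp [Subsingleton.elim σ 0] at hσ
    · simp; ring
    · have e : ((n + 1 + 1 : ℕ) : ℝ) - 1 = ((n + 1 : ℕ) : ℝ) := by push_cast; ring
      rw [e, Nat.add_sub_cancel, Nat.add_sub_cancel]
      field_simp
      ring
  · refine ⟨ψ, hψ, fun β s σ hs hσ y z => ?_⟩
    simp only [gradStepAdj, stepWeight, Nat.not_even_iff_odd.2 hj, if_false]
    rw [radialDeriv_sepVar_polar _ _ hs hσ, sepVar_polar _ _ hs hσ]
    ring

/-- A weak identity on the punctured ball, tested with functions in separated variables, holds on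
almost every ray. -/
theorem ae_ray_weak (hN : 0 < N) (j : ℕ) {F G : Coord N → ℝ} (hF : Measurable F)
    (hG : Measurable G) (hF2 : MemLp F 2 (hypVol N)) (hG2 : MemLp G 2 (hypVol N))
    (hw : ∀ φ, IsTest (puncturedBall N) φ →
      ∫ x, G x * φ x ∂(hypVol N) = ∫ x, F x * gradStepAdj j φ x ∂(hypVol N))
    {ψ : ℝ → ℝ} (hψ : IsRayTest ψ) :
    ∀ᵐ σ : Metric.sphere (0 : Coord N) 1 ∂(sphereVol N), ∫ s in Set.Ioi 0,
      (G (polar s (σ : Coord N)) * stepWeight N j s * ψ s +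
        F (polar s (σ : Coord N)) * stepWeight N j s * deriv ψ s) = 0 := by
  obtain ⟨a, ha, hid⟩ := exists_profile N j hψ
  set k : Coord N → ℝ := fun x => ∫ s in Set.Ioi 0,
    (G (polar s x) * stepWeight N j s * ψ s + F (polar s x) * stepWeight N j s * deriv ψ s) with hk
  have hpol : Measurable fun p : Coord N × ℝ => polar p.2 p.1 :=
    ((contDiff_tanh_half.continuous.comp continuous_snd).smul continuous_fst).measurable
  have hkm : StronglyMeasurable k := by
    have h1 : Measurable fun p : Coord N × ℝ => G (polar p.2 p.1) * stepWeight N j p.2 * ψ p.2 +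
        F (polar p.2 p.1) * stepWeight N j p.2 * deriv ψ p.2 := by
      have h2 : Measurable (Prod.snd : Coord N × ℝ → ℝ) := measurable_snd
      have hs := (measurable_stepWeight N j).comp h2
      have hp := (hψ.1.continuous.measurable).comp h2
      have hp' := (measurable_deriv ψ).comp h2
      exact (((hG.comp hpol).mul hs).mul hp).add (((hF.comp hpol).mul hs).mul hp')
    exact h1.stronglyMeasurable.integral_prod_right (ν := volume.restrict (Set.Ioi 0))
  have hball : puncturedBall N ⊆ Metric.ball 0 1 := Set.sdiff_subset
  -- the weak identity for a separated test function, in polar coordinates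
  have hH : ∀ β : Coord N → ℝ, ContDiff ℝ ∞ β →
      Integrable (fun x => G x * sepVar a β x - F x * gradStepAdj j (sepVar a β) x) (hypVol N) ∧
      ∫ x, (G x * sepVar a β x - F x * gradStepAdj j (sepVar a β) x) ∂(hypVol N) = 0 := by
    intro β hβ
    have ht := isTest_sepVar (N := N) ha hβ
    have i1 := hG2.integrable_mul (ht.memLp hball)
    have i2 := hF2.integrable_mul ((ht.gradStepAdj j).memLp hball)
    refine ⟨i1.sub i2, ?_⟩
    have := integral_sub i1 i2
    simp only [Pi.mul_apply] at this
    rw [this, hw _ ht, sub_self]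
  have hin : ∀ (β : Coord N → ℝ) (σ : Metric.sphere (0 : Coord N) 1),
      ∫ s in Set.Ioi 0, Real.sinh s ^ (N - 1) *
        (G (polar s (σ : Coord N)) * sepVar a β (polar s (σ : Coord N)) -
          F (polar s (σ : Coord N)) * gradStepAdj j (sepVar a β) (polar s (σ : Coord N))) =
      β σ * k σ := by
    intro β σ
    rw [hk, ← integral_const_mul]
    exact setIntegral_congr_fun measurableSet_Ioi fun s hs =>
      hid β s σ hs (norm_eq_of_mem_sphere σ) _ _
  have hint : Integrable (fun σ : Metric.sphere (0 : Coord N) 1 => k σ) (sphereVol N) := by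
    have h1 := (integrable_polar hN (hH (fun _ => 1) contDiff_const).1).integral_prod_left
    refine h1.congr (Eventually.of_forall fun σ => ?_)
    have h2 := hin (fun _ => 1) σ
    rw [one_mul] at h2
    exact (integral_rayVol N _).trans h2
  have hmeas : Measurable (Subtype.val : Metric.sphere (0 : Coord N) 1 → Coord N) :=
    measurable_subtype_coe
  have hloc : LocallyIntegrable k ((sphereVol N).map Subtype.val) :=
    ((integrable_map_measure hkm.aestronglyMeasurable hmeas.aemeasurable).2 hint).locallyIntegrable
  refine ae_of_ae_map hmeas.aemeasurable
    (ae_eq_zero_of_integral_contDiff_smul_eq_zero hloc fun β hβ _ => ?_)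
  refine (integral_map hmeas.aemeasurable
    (hβ.continuous.aestronglyMeasurable.smul hkm.aestronglyMeasurable)).trans ?_
  obtain ⟨hi, h0⟩ := hH β hβ
  rw [integral_polar hN hi] at h0
  rw [← h0]
  refine integral_congr_ae (Eventually.of_forall fun σ => ?_)
  exact (hin β σ).symm

theorem poincare_step_of_measurable (hN : 2 ≤ N) (j : ℕ) {F G : Coord N → ℝ} (hF : Measurable F)
    (hG : Measurable G) (hF2 : MemLp F 2 (hypVol N)) (hG2 : MemLp G 2 (hypVol N))
    (hw : ∀ φ, IsTest (puncturedBall N) φ →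
      ∫ x, G x * φ x ∂(hypVol N) = ∫ x, F x * gradStepAdj j φ x ∂(hypVol N)) :
    ENNReal.ofReal ((((N : ℝ) - 1) / 2) ^ 2) * ∫⁻ x, ENNReal.ofReal (F x ^ 2) ∂(hypVol N) ≤
      ∫⁻ x, ENNReal.ofReal (G x ^ 2) ∂(hypVol N) := by
  have hN0 : 0 < N := by omega
  obtain ⟨ψ, hψ, hAC⟩ := exists_isRayTest_locallyAC
  have hmeas : ∀ w : Coord N → ℝ, Measurable w → Measurable fun σ : Metric.sphere (0 : Coord N) 1 =>
      ∫⁻ s in Set.Ioi (0 : ℝ),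
        ENNReal.ofReal (w (polar s (σ : Coord N)) ^ 2 * Real.sinh s ^ (N - 1)) := by
    intro w hw
    refine Measurable.lintegral_prod_right' (ν := volume.restrict (Set.Ioi (0 : ℝ)))
      (f := fun p : Metric.sphere (0 : Coord N) 1 × ℝ =>
        ENNReal.ofReal (w (polar p.2 (p.1 : Coord N)) ^ 2 * Real.sinh p.2 ^ (N - 1))) ?_
    have h1 := hw.comp (continuous_polar (N := N)).measurable
    have h2 : Measurable fun p : Metric.sphere (0 : Coord N) 1 × ℝ => Real.sinh p.2 ^ (N - 1) := by
      fun_prop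
    exact ((h1.pow_const 2).mul h2).ennreal_ofReal
  have hfin : ∀ w : Coord N → ℝ, Measurable w → MemLp w 2 (hypVol N) →
      ∀ᵐ σ : Metric.sphere (0 : Coord N) 1 ∂(sphereVol N), ∫⁻ s in Set.Ioi 0,
        ENNReal.ofReal (w (polar s (σ : Coord N)) ^ 2 * Real.sinh s ^ (N - 1)) < ⊤ := by
    intro w hw hw2
    refine ae_lt_top (hmeas w hw) ?_
    rw [← lintegral_sq_polar hN0 hw.aemeasurable, lintegral_sq_eq_eLpNorm_sq]
    exact ENNReal.pow_ne_top hw2.eLpNorm_ne_top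
  rw [lintegral_sq_polar hN0 hF.aemeasurable, lintegral_sq_polar hN0 hG.aemeasurable,
    ← lintegral_const_mul _ (hmeas F hF)]
  refine lintegral_mono_ae ?_
  filter_upwards [hfin F hF hF2, hfin G hG hG2,
    ae_all_iff.2 fun n => ae_ray_weak hN0 j hF hG hF2 hG2 hw (hψ n)] with σ h1 h2 h3
  have hray : ∀ w : Coord N → ℝ, Measurable w → Measurable fun s => w (polar s (σ : Coord N)) :=
    fun w hw => hw.comp (continuous_polar.comp (Continuous.prodMk_right σ)).measurable
  have hcw := (contDiffOn_stepWeight N j).continuousOn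
  obtain ⟨A, hA, hAf, hAg⟩ := hAC _ _
    ((locallyIntegrableOn_of_sq_sinh (hray F hF) h1.ne).mul_continuousOn hcw
      isOpen_Ioi.isLocallyClosed)
    ((locallyIntegrableOn_of_sq_sinh (hray G hG) h2.ne).mul_continuousOn hcw
      isOpen_Ioi.isLocallyClosed) h3
  exact ray_poincare hN j hA hAf hAg h1.ne

/-- If `G` is weakly the next radial derivative of `F`, then `((N - 1) / 2)² ∫ F² ≤ ∫ G²`. -/
theorem poincare_step (hN : 2 ≤ N) (j : ℕ) {F G : Coord N → ℝ}
    (hF2 : MemLp F 2 (hypVol N)) (hG2 : MemLp G 2 (hypVol N))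
    (hw : ∀ φ, IsTest (puncturedBall N) φ →
      ∫ x, G x * φ x ∂(hypVol N) = ∫ x, F x * gradStepAdj j φ x ∂(hypVol N)) :
    ENNReal.ofReal ((((N : ℝ) - 1) / 2) ^ 2) * ∫⁻ x, ENNReal.ofReal (F x ^ 2) ∂(hypVol N) ≤
      ∫⁻ x, ENNReal.ofReal (G x ^ 2) ∂(hypVol N) := by
  obtain ⟨F', hF', hFF'⟩ := hF2.aestronglyMeasurable
  obtain ⟨G', hG', hGG'⟩ := hG2.aestronglyMeasurable
  have e1 : ∫⁻ x, ENNReal.ofReal (F x ^ 2) ∂(hypVol N) =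
      ∫⁻ x, ENNReal.ofReal (F' x ^ 2) ∂(hypVol N) :=
    lintegral_congr_ae (by filter_upwards [hFF'] with x hx; rw [hx])
  have e2 : ∫⁻ x, ENNReal.ofReal (G x ^ 2) ∂(hypVol N) =
      ∫⁻ x, ENNReal.ofReal (G' x ^ 2) ∂(hypVol N) :=
    lintegral_congr_ae (by filter_upwards [hGG'] with x hx; rw [hx])
  rw [e1, e2]
  refine poincare_step_of_measurable hN j hF'.measurable hG'.measurable (hF2.ae_eq hFF')
    (hG2.ae_eq hGG') fun φ hφ => ?_
  have h := hw φ hφ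
  rw [integral_congr_ae (show (fun x => G x * φ x) =ᵐ[hypVol N] fun x => G' x * φ x by
      filter_upwards [hGG'] with x hx; rw [hx]),
    integral_congr_ae (show (fun x => F x * gradStepAdj j φ x) =ᵐ[hypVol N]
      fun x => F' x * gradStepAdj j φ x by filter_upwards [hFF'] with x hx; rw [hx])] at h
  exact h

theorem HasWeakRadialGrad.aestronglyMeasurable (hN : 0 < N) {j : ℕ} {u w : Coord N → ℝ}
    (h : HasWeakRadialGrad j u w) : AEStronglyMeasurable w (hypVol N) := by
  have := h.1.aestronglyMeasurable
  rwa [show (Metric.ball 0 1 \ {0} : Set (Coord N)) = puncturedBall N from rfl,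
    restrict_hypVol_puncturedBall hN] at this

/-- The weak gradients of consecutive orders are related by one first order step. -/
theorem HasWeakRadialGrad.step {j : ℕ} {u v w : Coord N → ℝ} (hv : HasWeakRadialGrad j u v)
    (hw : HasWeakRadialGrad (j + 1) u w) {φ : Coord N → ℝ} (hφ : IsTest (puncturedBall N) φ) :
    ∫ x, w x * φ x ∂(hypVol N) = ∫ x, v x * gradStepAdj j φ x ∂(hypVol N) := by
  rw [hw.2 φ hφ, hv.2 _ (hφ.gradStepAdj j), radialGradAdj_succ]

theorem exists_of_radialEnergy_lt_top {j : ℕ} {u : Coord N → ℝ} (h : radialEnergy j u < ⊤) :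
    ∃ w, HasWeakRadialGrad j u w ∧ ∫⁻ x, ENNReal.ofReal (w x ^ 2) ∂(hypVol N) < ⊤ := by
  rw [radialEnergy, iInf_lt_iff] at h
  obtain ⟨w, hw⟩ := h
  rw [iInf_lt_iff] at hw
  obtain ⟨hw, hlt⟩ := hw
  exact ⟨w, hw, hlt⟩

theorem radialEnergy_le {j : ℕ} {u w : Coord N → ℝ} (h : HasWeakRadialGrad j u w) :
    radialEnergy j u ≤ ∫⁻ x, ENNReal.ofReal (w x ^ 2) ∂(hypVol N) :=
  iInf₂_le w h

/-- The radial Poincaré inequality, obtained by iterating `poincare_step` from order `l` to order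
`k`. Only the weak gradients of orders below `k` have to be square-integrable; membership in
a Sobolev space plays no role. -/
theorem poincare_radialEnergy (hN : 2 ≤ N) {k l : ℕ} (hlk : l < k) {u : Coord N → ℝ}
    (hfin : ∀ j < k, radialEnergy j u < ⊤) :
    ENNReal.ofReal ((((N : ℝ) - 1) / 2) ^ (2 * (k - l))) * radialEnergy l u ≤
      radialEnergy k u := by
  have hN0 : 0 < N := by omega
  refine le_iInf₂ fun w hw => ?_
  by_cases htop : ∫⁻ x, ENNReal.ofReal (w x ^ 2) ∂(hypVol N) = ⊤
  · rw [htop]; exact le_top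
  -- the weak gradients of all orders up to `k`
  have hall : ∀ j, ∃ v, j ≤ k → HasWeakRadialGrad j u v ∧
      ∫⁻ x, ENNReal.ofReal (v x ^ 2) ∂(hypVol N) < ⊤ ∧ (j = k → v = w) := by
    intro j
    rcases lt_trichotomy j k with h | h | h
    · obtain ⟨v, hv, hv'⟩ := exists_of_radialEnergy_lt_top (hfin j h)
      exact ⟨v, fun _ => ⟨hv, hv', fun h' => absurd h' h.ne⟩⟩
    · subst h
      exact ⟨w, fun _ => ⟨hw, lt_top_iff_ne_top.2 htop, fun _ => rfl⟩⟩
    · exact ⟨w, fun h' => absurd h' (not_le.2 h)⟩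
  choose v hv using hall
  have hL : ∀ j ≤ k, MemLp (v j) 2 (hypVol N) := fun j hj =>
    memLp_two_of_lintegral_lt_top ((hv j hj).1.aestronglyMeasurable hN0) (hv j hj).2.1
  have hstep : ∀ d, l + d ≤ k →
      ENNReal.ofReal ((((N : ℝ) - 1) / 2) ^ (2 * d)) *
        ∫⁻ x, ENNReal.ofReal (v l x ^ 2) ∂(hypVol N) ≤
      ∫⁻ x, ENNReal.ofReal (v (l + d) x ^ 2) ∂(hypVol N) := by
    intro d
    induction d with
    | zero => intro _; simp
    | succ d ih =>
      intro hd
      have h1 := ih (by omega)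
      have h2 := poincare_step hN (l + d) (hL (l + d) (by omega)) (hL (l + d + 1) (by omega))
        fun φ hφ => (hv (l + d) (by omega)).1.step (hv (l + d + 1) (by omega)).1 hφ
      have e : (((N : ℝ) - 1) / 2) ^ (2 * (d + 1)) =
          (((N : ℝ) - 1) / 2) ^ 2 * (((N : ℝ) - 1) / 2) ^ (2 * d) := by ring
      rw [e, ENNReal.ofReal_mul (sq_nonneg _), mul_assoc]
      exact (mul_le_mul_right h1 _).trans h2
  have hfinal := hstep (k - l) (by omega)
  rw [Nat.add_sub_cancel' hlk.le, (hv k le_rfl).2.2 rfl] at hfinal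
  exact (mul_le_mul_right (radialEnergy_le (hv l hlk.le).1) _).trans hfinal

/-! ### Classical radial gradients and integration by parts -/

/-- The `j`-th factor in the factorization of `∇_r^k` into first order operators. -/
def gradStep (j : ℕ) (f : Coord N → ℝ) (x : Coord N) : ℝ :=
  if Even j then radialDeriv f x else radialDeriv f x + meanCurv x * f x

/-- The classical `∇_r^k` of a smooth function. -/
def radialGrad : ℕ → (Coord N → ℝ) → Coord N → ℝ
  | 0, v => v
  | j + 1, v => gradStep j (radialGrad j v)

theorem contDiffOn_gradStep (j : ℕ) {f : Coord N → ℝ} (hf : ContDiffOn ℝ ∞ f (puncturedBall N)) :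
    ContDiffOn ℝ ∞ (gradStep j f) (puncturedBall N) := by
  unfold gradStep
  split_ifs
  · exact contDiffOn_radialDeriv hf
  · exact (contDiffOn_radialDeriv hf).add (contDiffOn_meanCurv.mul hf)

theorem contDiffOn_radialGrad (j : ℕ) {v : Coord N → ℝ}
    (hv : ContDiffOn ℝ ∞ v (puncturedBall N)) :
    ContDiffOn ℝ ∞ (radialGrad j v) (puncturedBall N) := by
  induction j with
  | zero => exact hv
  | succ j ih => exact contDiffOn_gradStep j ih

theorem radialDeriv_mul {f g : Coord N → ℝ} {x : Coord N} (hx : x ∈ puncturedBall N)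
    (hf : DifferentiableAt ℝ f x) (hg : DifferentiableAt ℝ g x) :
    radialDeriv (fun y => f y * g y) x = radialDeriv f x * g x + f x * radialDeriv g x := by
  rw [radialDeriv_eq_fderiv hx hf, radialDeriv_eq_fderiv hx hg,
    radialDeriv_eq_fderiv hx (hf.fun_mul hg), fderiv_fun_mul hf hg]
  simp only [add_apply, smul_apply, smul_eq_mul]
  ring

/-- The support of a test function meets every ray in a bounded set. -/
theorem IsTest.exists_ray_bound {U : Set (Coord N)} (hU : U ⊆ Metric.ball 0 1) {ξ : Coord N → ℝ}
    (hξ : IsTest U ξ) : ∃ M, 0 ≤ M ∧ ∀ (σ : Coord N), ‖σ‖ = 1 → ∀ s, M < |s| →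
      ξ (polar s σ) = 0 := by
  rcases (tsupport ξ).eq_empty_or_nonempty with he | hne
  · refine ⟨0, le_rfl, fun σ _ s _ => ?_⟩
    exact image_eq_zero_of_notMem_tsupport (by rw [he]; exact Set.notMem_empty _)
  · obtain ⟨x₀, hx₀, hmax⟩ := hξ.2.1.isCompact.exists_isMaxOn hne continuous_norm.continuousOn
    have h1 : ‖x₀‖ < 1 := mem_ball_zero_iff.1 (hU (hξ.2.2 hx₀))
    refine ⟨2 * Real.artanh ‖x₀‖, ?_, fun σ hσ s hs => ?_⟩
    · have := Real.artanh_nonneg (norm_nonneg x₀)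
      linarith
    · by_contra h
      have h2 : ‖polar s σ‖ ≤ ‖x₀‖ := hmax (subset_tsupport ξ h)
      rw [polar, norm_smul, hσ, mul_one, Real.norm_eq_abs, abs_le] at h2
      have key : ∀ r : ℝ, Real.tanh (r / 2) ≤ ‖x₀‖ → r ≤ 2 * Real.artanh ‖x₀‖ := fun r hr => by
        have h4 := Real.artanh_le_artanh (neg_one_lt_tanh_half r) h1 hr
        rw [Real.artanh_tanh] at h4
        linarith
      have h5 := key s h2.2
      have h6 := key (-s) (by rw [neg_div, Real.tanh_neg]; linarith [h2.1])
      exact absurd hs (not_lt.2 (abs_le.2 ⟨by linarith, h5⟩))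

theorem IsTest.contDiff_ray {U : Set (Coord N)} {ξ : Coord N → ℝ} (hξ : IsTest U ξ)
    (σ : Coord N) : ContDiff ℝ ∞ (fun s => ξ (polar s σ)) :=
  hξ.1.comp (contDiff_polar σ)

theorem IsTest.hasCompactSupport_ray {U : Set (Coord N)} (hU : U ⊆ Metric.ball 0 1)
    {ξ : Coord N → ℝ} (hξ : IsTest U ξ) {σ : Coord N} (hσ : ‖σ‖ = 1) :
    HasCompactSupport (fun s => ξ (polar s σ)) := by
  obtain ⟨M, _, hM⟩ := hξ.exists_ray_bound hU
  refine HasCompactSupport.intro (isCompact_Icc (a := -M) (b := M)) fun s hs => hM σ hσ s ?_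
  by_contra h
  exact hs (abs_le.1 (not_lt.1 h))

/-- The divergence theorem for `∂/∂r + (N - 1) coth r`. -/
theorem integral_radialDerivAdj_eq_zero (hN : 0 < N) {ξ : Coord N → ℝ}
    (hξ : IsTest (puncturedBall N) ξ) : ∫ x, radialDerivAdj ξ x ∂(hypVol N) = 0 := by
  have hball : puncturedBall N ⊆ Metric.ball 0 1 := Set.sdiff_subset
  rw [integral_polar hN (hξ.radialDerivAdj.integrable hball)]
  refine integral_eq_zero_of_ae (Eventually.of_forall fun σ => ?_)
  have hσ : ‖(σ : Coord N)‖ = 1 := norm_eq_of_mem_sphere σ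
  have hc := (hξ.contDiff_ray (σ : Coord N))
  set f : ℝ → ℝ := fun s => Real.sinh s ^ (N - 1) * ξ (polar s (σ : Coord N)) with hf
  have hfc : ContDiff ℝ 1 f :=
    ContDiff.mul (by fun_prop) (hc.of_le (by exact_mod_cast le_top))
  have hfs : HasCompactSupport f := (hξ.hasCompactSupport_ray hball hσ).mul_left
  have h1 := hfs.integral_Ioi_deriv_eq hfc 0
  have h0 : f 0 = 0 := by
    have : ξ (polar 0 (σ : Coord N)) = 0 := hξ.eq_zero (by simp [polar])
    rw [hf]; simp only [this, mul_zero]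
  rw [h0, neg_zero] at h1
  have h2 : ∫ s in Set.Ioi 0, Real.sinh s ^ (N - 1) * radialDerivAdj ξ (polar s (σ : Coord N)) =
      ∫ s in Set.Ioi 0, -deriv f s := by
    refine setIntegral_congr_fun measurableSet_Ioi fun s hs => ?_
    have hs0 : 0 < s := hs
    have hsh : Real.sinh s ≠ 0 := (Real.sinh_pos_iff.2 hs0).ne'
    have hd := (hasDerivAt_sinh_pow (N - 1) s).mul
      (hc.differentiable (by simp) s).hasDerivAt
    have hd' : deriv f s = _ := hd.deriv
    rw [hd', radialDerivAdj, radialDeriv_polar _ hs0 hσ, meanCurv_polar hs0 hσ]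
    obtain ⟨n, rfl⟩ : ∃ n, N = n + 1 := ⟨N - 1, by omega⟩
    rw [Nat.add_sub_cancel]
    have e : ((n + 1 : ℕ) : ℝ) - 1 = n := by push_cast; ring
    rw [e]
    rcases n with _ | n
    · simp
    · rw [Nat.add_sub_cancel]
      field_simp
      ring
  show ∫ s in Set.Ioi 0, Real.sinh s ^ (N - 1) * radialDerivAdj ξ (polar s (σ : Coord N)) = 0
  rw [h2, integral_neg, h1, neg_zero]

/-- Integration by parts for one step; there is no boundary term because `φ` vanishes near the
pole. -/
theorem integral_gradStep_mul (hN : 0 < N) (j : ℕ) {f φ : Coord N → ℝ}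
    (hf : ContDiffOn ℝ ∞ f (puncturedBall N)) (hφ : IsTest (puncturedBall N) φ) :
    ∫ x, gradStep j f x * φ x ∂(hypVol N) = ∫ x, f x * gradStepAdj j φ x ∂(hypVol N) := by
  have hball : puncturedBall N ⊆ Metric.ball 0 1 := Set.sdiff_subset
  have i1 := (hφ.mul_left (contDiffOn_gradStep j hf)).integrable hball
  have i2 := ((hφ.gradStepAdj j).mul_left hf).integrable hball
  rw [← sub_eq_zero, ← integral_sub i1 i2, ← neg_eq_zero, ← integral_neg,
    ← integral_radialDerivAdj_eq_zero hN (hφ.mul_left hf)]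
  refine integral_congr_ae ?_
  filter_upwards [ae_mem_puncturedBall hN] with x hx
  have hd := radialDeriv_mul hx ((hf.contDiffAt
    ((isOpen_puncturedBall N).mem_nhds hx)).differentiableAt (by simp))
    (hφ.1.differentiable (by simp) x)
  rw [radialDerivAdj, hd]
  unfold gradStep gradStepAdj
  split_ifs
  · rw [radialDerivAdj]; ring
  · ring

theorem locallyIntegrableOn_puncturedBall_iff (w : Coord N → ℝ) :
    LocallyIntegrableOn w (Metric.ball 0 1 \ {0}) (hypVol N) ↔
      ∀ K ⊆ puncturedBall N, IsCompact K → IntegrableOn w K (hypVol N) :=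
  locallyIntegrableOn_iff (isOpen_puncturedBall N).isLocallyClosed

theorem _root_.MeasureTheory.MemLp.locallyIntegrableOn_puncturedBall {w : Coord N → ℝ}
    (hw : MemLp w 2 (hypVol N)) : LocallyIntegrableOn w (Metric.ball 0 1 \ {0}) (hypVol N) := by
  refine (locallyIntegrableOn_puncturedBall_iff w).2 fun K hK hKc => ?_
  have : IsFiniteMeasure ((hypVol N).restrict K) :=
    ⟨by rw [Measure.restrict_apply_univ]
        exact hypVol_lt_top_of_isCompact hKc (hK.trans Set.sdiff_subset)⟩
  exact (hw.restrict K).integrable one_le_two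

/-- Classical radial gradients are weak radial gradients. -/
theorem hasWeakRadialGrad_radialGrad (hN : 0 < N) (j : ℕ) {v : Coord N → ℝ}
    (hv : ContDiffOn ℝ ∞ v (puncturedBall N)) : HasWeakRadialGrad j v (radialGrad j v) := by
  constructor
  · refine (locallyIntegrableOn_puncturedBall_iff _).2 fun K hK hKc => ?_
    have hc := (contDiffOn_radialGrad j hv).continuousOn.mono hK
    obtain ⟨C, hC⟩ := hKc.exists_bound_of_continuousOn hc
    have : IsFiniteMeasure ((hypVol N).restrict K) :=
      ⟨by rw [Measure.restrict_apply_univ]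
          exact hypVol_lt_top_of_isCompact hKc (hK.trans Set.sdiff_subset)⟩
    refine Integrable.of_bound (hc.aestronglyMeasurable hKc.measurableSet) C ?_
    rw [ae_restrict_iff' hKc.measurableSet]
    exact Eventually.of_forall hC
  · induction j with
    | zero => intro φ _; rw [radialGradAdj_zero]; rfl
    | succ j ih =>
      intro φ hφ
      rw [radialGradAdj_succ, ← ih _ (hφ.gradStepAdj j)]
      exact integral_gradStep_mul hN j (contDiffOn_radialGrad j hv) hφ

/-- Weak radial gradients are unique. -/
theorem HasWeakRadialGrad.ae_eq (hN : 0 < N) {j : ℕ} {u w w' : Coord N → ℝ}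
    (hw : HasWeakRadialGrad j u w) (hw' : HasWeakRadialGrad j u w') : w =ᵐ[hypVol N] w' := by
  have hint : ∀ {v}, HasWeakRadialGrad j u v → ∀ φ, IsTest (puncturedBall N) φ →
      Integrable (fun x => v x * φ x) (hypVol N) := by
    intro v hv φ hφ
    have h1 := (locallyIntegrableOn_puncturedBall_iff v).1 hv.1 _ hφ.2.2 hφ.2.1
    have h2 : IntegrableOn (fun x => v x * φ x) (tsupport φ) (hypVol N) :=
      h1.mul_continuousOn hφ.1.continuous.continuousOn hφ.2.1
    refine (integrableOn_iff_integrable_of_support_subset fun x hx => ?_).1 h2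
    exact subset_tsupport φ (right_ne_zero_of_mul hx)
  have h := (isOpen_puncturedBall N).ae_eq_zero_of_integral_contDiff_smul_eq_zero
    (μ := hypVol N) (f := w - w') (hw.1.sub hw'.1) fun φ h1 h2 h3 => by
      have hφ : IsTest (puncturedBall N) φ := ⟨h1, h2, h3⟩
      have e : ∀ x, φ x • (w - w') x = w x * φ x - w' x * φ x := fun x => by
        rw [Pi.sub_apply, smul_eq_mul]; ring
      simp only [e]
      rw [integral_sub (hint hw φ hφ) (hint hw' φ hφ), hw.2 φ hφ, hw'.2 φ hφ, sub_self]
  filter_upwards [h, ae_mem_puncturedBall hN] with x hx hxm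
  have := hx hxm
  rw [Pi.sub_apply] at this
  linarith

/-- Since the weak gradient is unique, any one of them computes the energy. -/
theorem radialEnergy_eq (hN : 0 < N) {j : ℕ} {u w : Coord N → ℝ} (hw : HasWeakRadialGrad j u w) :
    radialEnergy j u = ∫⁻ x, ENNReal.ofReal (w x ^ 2) ∂(hypVol N) := by
  refine le_antisymm (radialEnergy_le hw) (le_iInf₂ fun w' hw' => le_of_eq ?_)
  refine lintegral_congr_ae ?_
  filter_upwards [hw.ae_eq hN hw'] with x hx
  rw [hx]

/-! ### Radial gradients along a ray -/

/-- The radial gradient of order `j` of a function of the radial variable alone. -/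
def rayGrad (N : ℕ) : ℕ → (ℝ → ℝ) → ℝ → ℝ
  | 0, f => f
  | j + 1, f => fun s => if Even j then deriv (rayGrad N j f) s else
      deriv (rayGrad N j f) s + ((N : ℝ) - 1) * (Real.cosh s / Real.sinh s) * rayGrad N j f s

theorem radialGrad_polar (j : ℕ) (v : Coord N → ℝ) {σ : Coord N} (hσ : ‖σ‖ = 1) {s : ℝ}
    (hs : 0 < s) : radialGrad j v (polar s σ) = rayGrad N j (fun s => v (polar s σ)) s := by
  induction j generalizing s with
  | zero => rfl
  | succ j ih =>
    have hd : deriv (fun s => radialGrad j v (polar s σ)) s =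
        deriv (rayGrad N j (fun s => v (polar s σ))) s := by
      refine Filter.EventuallyEq.deriv_eq ?_
      filter_upwards [lt_mem_nhds hs] with t ht using ih ht
    simp only [radialGrad, rayGrad, gradStep]
    rw [radialDeriv_polar _ hs hσ, hd, meanCurv_polar hs hσ, ih hs]

theorem rayGrad_congr (j : ℕ) {f g : ℝ → ℝ} (h : Set.EqOn f g (Set.Ioi 0)) :
    Set.EqOn (rayGrad N j f) (rayGrad N j g) (Set.Ioi 0) := by
  induction j with
  | zero => exact h
  | succ j ih =>
    intro s hs
    have hd : deriv (rayGrad N j f) s = deriv (rayGrad N j g) s := by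
      refine Filter.EventuallyEq.deriv_eq ?_
      filter_upwards [lt_mem_nhds (show (0 : ℝ) < s from hs)] with t ht using ih ht
    simp only [rayGrad]
    rw [hd, ih hs]

/-! ### Iterated covariant derivatives in the radial direction -/

theorem contDiffOn_christoffel (m i j : Fin N) :
    ContDiffOn ℝ ∞ (fun x : Coord N => christoffel x m i j) (Metric.ball 0 1) := by
  have hcoord : ∀ i : Fin N, ContDiffOn ℝ ∞ (fun x : Coord N => x i) (Metric.ball 0 1) := fun i =>
    (EuclideanSpace.proj (𝕜 := ℝ) i).contDiff.contDiffOn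
  unfold christoffel
  refine ContDiffOn.mul (ContDiffOn.div contDiffOn_const (contDiffOn_const.sub
    (contDiffOn_id.norm_sq ℝ)) fun x hx => ?_) ?_
  · have h1 : ‖x‖ < 1 := mem_ball_zero_iff.1 hx
    have h2 := norm_nonneg x
    nlinarith
  · refine ContDiffOn.sub (ContDiffOn.add ?_ ?_) ?_ <;> split_ifs <;>
      first | exact hcoord _ | exact contDiffOn_const

theorem contDiffOn_covDeriv {j : ℕ} {T : Coord N → (Fin j → Fin N) → ℝ}
    (hT : ∀ I, ContDiffOn ℝ ∞ (fun x => T x I) (Metric.ball 0 1)) (I : Fin (j + 1) → Fin N) :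
    ContDiffOn ℝ ∞ (fun x => covDeriv T x I) (Metric.ball 0 1) := by
  unfold covDeriv
  refine ContDiffOn.sub ?_ ?_
  · exact ((hT _).fderiv_of_isOpen Metric.isOpen_ball (by simp)).clm_apply contDiffOn_const
  · exact ContDiffOn.sum fun s _ => ContDiffOn.sum fun m _ =>
      (contDiffOn_christoffel _ _ _).mul (hT _)

theorem contDiffOn_iterCovDeriv {v : Coord N → ℝ} (hv : ContDiff ℝ ∞ v) (j : ℕ)
    (I : Fin j → Fin N) : ContDiffOn ℝ ∞ (fun x => iterCovDeriv v j x I) (Metric.ball 0 1) := by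
  induction j with
  | zero => exact hv.contDiffOn
  | succ j ih => exact contDiffOn_covDeriv ih I

theorem sum_sq_eq_one {σ : Coord N} (hσ : ‖σ‖ = 1) : ∑ i, σ i ^ 2 = 1 := by
  rw [← EuclideanSpace.real_norm_sq_eq, hσ, one_pow]

/-- Contracting the connection with the radial direction gives a multiple of the identity: radial
parallel transport only rescales the ball coordinates. -/
theorem sum_christoffel_radial {σ : Coord N} (hσ : ‖σ‖ = 1) (t : ℝ) (m p : Fin N) :
    ∑ i, σ i * christoffel (t • σ) m i p = 2 * t / (1 - t ^ 2) * if m = p then 1 else 0 := by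
  have hn : ‖t • σ‖ ^ 2 = t ^ 2 := by
    rw [norm_smul, hσ, mul_one, Real.norm_eq_abs, sq_abs]
  simp only [christoffel, hn, PiLp.smul_apply, smul_eq_mul]
  have e : ∀ i, σ i * (2 / (1 - t ^ 2) * ((if m = i then t * σ p else 0) +
      (if m = p then t * σ i else 0) - if i = p then t * σ m else 0)) =
      2 / (1 - t ^ 2) * ((if m = i then t * σ p * σ i else 0) +
        ((if m = p then t else 0) * σ i ^ 2) - if i = p then t * σ m * σ i else 0) := by
    intro i
    split_ifs <;> ring
  simp only [e]
  rw [← Finset.mul_sum, Finset.sum_sub_distrib, Finset.sum_add_distrib, ← Finset.mul_sum,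
    sum_sq_eq_one hσ, Finset.sum_ite_eq, Finset.sum_ite_eq']
  simp only [Finset.mem_univ, if_true]
  split_ifs <;> ring

theorem sum_mul_fderiv_single {f : Coord N → ℝ} {x σ : Coord N} :
    ∑ i, σ i * fderiv ℝ f x (EuclideanSpace.single i 1) = fderiv ℝ f x σ := by
  conv_rhs => rw [← (EuclideanSpace.basisFun (Fin N) ℝ).sum_repr σ]
  rw [map_sum]
  refine Finset.sum_congr rfl fun i _ => ?_
  rw [map_smul, EuclideanSpace.basisFun_repr, EuclideanSpace.basisFun_apply, smul_eq_mul]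

/-- The covariant derivative of a tensor field in a radial direction is the radial derivative of its
components corrected by a scalar multiple. -/
theorem sum_covDeriv_radial {j : ℕ} (T : Coord N → (Fin j → Fin N) → ℝ) {σ : Coord N}
    (hσ : ‖σ‖ = 1) (t : ℝ) (I : Fin j → Fin N) :
    ∑ i, σ i * covDeriv T (t • σ) (Fin.cons i I : Fin (j + 1) → Fin N) =
      fderiv ℝ (fun y => T y I) (t • σ) σ - j * (2 * t / (1 - t ^ 2)) * T (t • σ) I := by
  simp only [covDeriv, Fin.cons_zero, Fin.cons_succ, mul_sub, Finset.sum_sub_distrib,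
    sum_mul_fderiv_single]
  congr 1
  have e : ∀ s : Fin j, ∑ i, σ i * ∑ m, christoffel (t • σ) m i (I s) *
      T (t • σ) (Function.update I s m) = 2 * t / (1 - t ^ 2) * T (t • σ) I := by
    intro s
    simp only [Finset.mul_sum]
    rw [Finset.sum_comm]
    have e2 : ∀ m, ∑ i, σ i * (christoffel (t • σ) m i (I s) *
        T (t • σ) (Function.update I s m)) =
        if m = I s then 2 * t / (1 - t ^ 2) * T (t • σ) (Function.update I s m) else 0 := by
      intro m
      simp only [← mul_assoc]
      rw [← Finset.sum_mul, sum_christoffel_radial hσ]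
      split_ifs <;> ring
    simp only [e2]
    rw [Finset.sum_ite_eq', if_pos (Finset.mem_univ _), Function.update_eq_self]
  have e3 : ∑ i, σ i * ∑ s, ∑ m, christoffel (t • σ) m i (I s) *
      T (t • σ) (Function.update I s m) = ∑ s : Fin j, ∑ i, σ i * ∑ m,
        christoffel (t • σ) m i (I s) * T (t • σ) (Function.update I s m) := by
    rw [Finset.sum_comm]
    exact Finset.sum_congr rfl fun i _ => Finset.mul_sum _ _ _
  rw [e3]
  simp only [e, Finset.sum_const, Finset.card_univ, Fintype.card_fin, nsmul_eq_mul]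
  ring

/-- The `j`-th covariant derivative evaluated on `j` copies of the unit radial vector, at radius `s`
in the direction `σ`. -/
def radialContraction (v : Coord N → ℝ) (σ : Coord N) (j : ℕ) (s : ℝ) : ℝ :=
  ((1 - Real.tanh (s / 2) ^ 2) / 2) ^ j *
    ∑ I : Fin j → Fin N, (∏ r, σ (I r)) * iterCovDeriv v j (polar s σ) I

theorem sum_fin_succ_arrow {j : ℕ} (F : (Fin (j + 1) → Fin N) → ℝ) :
    ∑ I, F I = ∑ I : Fin j → Fin N, ∑ i, F (Fin.cons i I : Fin (j + 1) → Fin N) := by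
  rw [← (Fin.consEquiv fun _ : Fin (j + 1) => Fin N).sum_comp, Fintype.sum_prod_type,
    Finset.sum_comm]
  rfl

/-- The unit radial field is parallel along rays, so differentiating the contraction along a ray
raises the order by one. -/
theorem hasDerivAt_radialContraction {v : Coord N → ℝ} (hv : ContDiff ℝ ∞ v) {σ : Coord N}
    (hσ : ‖σ‖ = 1) (j : ℕ) (s : ℝ) :
    HasDerivAt (radialContraction v σ j) (radialContraction v σ (j + 1) s) s := by
  set t := Real.tanh (s / 2) with ht
  have ht1 : 1 - t ^ 2 ≠ 0 := by
    have h1 := tanh_half_lt_one s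
    have h2 := neg_one_lt_tanh_half s
    nlinarith
  -- the derivative of the length factor cancels the scalar correction of `sum_covDeriv_radial`
  have hy : HasDerivAt (fun s : ℝ => ((1 - Real.tanh (s / 2) ^ 2) / 2) ^ j)
      (j * ((1 - t ^ 2) / 2) ^ (j - 1) * (-(t * ((1 - t ^ 2) / 2)))) s := by
    have h := ((((hasDerivAt_tanh_half s).fun_pow 2).const_sub 1).div_const 2).fun_pow j
    refine h.congr_deriv ?_
    simp only [← ht]
    norm_num
    ring_nf
  have hI : ∀ I : Fin j → Fin N, HasDerivAt
      (fun s => (∏ r, σ (I r)) * iterCovDeriv v j (polar s σ) I)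
      ((∏ r, σ (I r)) *
        ((1 - t ^ 2) / 2 * fderiv ℝ (fun x => iterCovDeriv v j x I) (t • σ) σ)) s := by
    intro I
    have hd : DifferentiableAt ℝ (fun x => iterCovDeriv v j x I) (polar s σ) :=
      ((contDiffOn_iterCovDeriv hv j I).contDiffAt
        (Metric.isOpen_ball.mem_nhds (polar_mem_ball s hσ))).differentiableAt (by simp)
    have h := hd.hasFDerivAt.comp_hasDerivAt s (hasDerivAt_polar s σ)
    rw [map_smul, smul_eq_mul] at h
    exact h.const_mul _
  have h := hy.mul (HasDerivAt.fun_sum (u := Finset.univ) fun I _ => hI I)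
  refine h.congr_deriv ?_
  rw [radialContraction, sum_fin_succ_arrow]
  simp only [Fin.prod_univ_succ, Fin.cons_zero, Fin.cons_succ, iterCovDeriv]
  have e : ∀ I : Fin j → Fin N, ∑ i, σ i * (∏ r, σ (I r)) *
      covDeriv (iterCovDeriv v j) (polar s σ) (Fin.cons i I : Fin (j + 1) → Fin N) =
      (∏ r, σ (I r)) * (fderiv ℝ (fun y => iterCovDeriv v j y I) (t • σ) σ -
        j * (2 * t / (1 - t ^ 2)) * iterCovDeriv v j (t • σ) I) := by
    intro I
    rw [← sum_covDeriv_radial _ hσ, Finset.mul_sum]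
    refine Finset.sum_congr rfl fun i _ => ?_
    rw [polar]; ring
  simp only [e]
  rw [Finset.mul_sum, Finset.mul_sum, Finset.mul_sum, ← Finset.sum_add_distrib]
  refine Finset.sum_congr rfl fun I _ => ?_
  rw [polar, ← ht]
  rcases j with _ | j
  · simp
  · rw [Nat.add_sub_cancel]
    field_simp
    ring

/-- Radial curves are geodesics, so the `j`-th derivative along a ray is the `j`-th covariant
derivative evaluated on the radial direction. -/
theorem iteratedDeriv_ray {v : Coord N → ℝ} (hv : ContDiff ℝ ∞ v) {σ : Coord N} (hσ : ‖σ‖ = 1)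
    (j : ℕ) : iteratedDeriv j (fun s => v (polar s σ)) = radialContraction v σ j := by
  induction j with
  | zero =>
    funext s
    simp [radialContraction, iterCovDeriv]
  | succ j ih =>
    rw [iteratedDeriv_succ, ih]
    funext s
    exact (hasDerivAt_radialContraction hv hσ j s).deriv

/-- Cauchy-Schwarz for the contraction with copies of the unit radial vector. -/
theorem sq_iteratedDeriv_ray_le {v : Coord N → ℝ} (hv : ContDiff ℝ ∞ v) {σ : Coord N}
    (hσ : ‖σ‖ = 1) (j : ℕ) {s : ℝ} (hs : 0 < s) :
    iteratedDeriv j (fun s => v (polar s σ)) s ^ 2 ≤ covNormSq j v (polar s σ) := by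
  rw [iteratedDeriv_ray hv hσ, radialContraction, covNormSq, norm_polar hs hσ, mul_pow, ← pow_mul,
    mul_comm j 2]
  have hy : 0 ≤ ((1 - Real.tanh (s / 2) ^ 2) / 2) ^ (2 * j) := by
    rw [pow_mul]; positivity
  refine mul_le_mul_of_nonneg_left ?_ hy
  have h1 := Finset.sum_mul_sq_le_sq_mul_sq Finset.univ (fun I : Fin j → Fin N => ∏ r, σ (I r))
    (fun I => iterCovDeriv v j (polar s σ) I)
  have h2 : ∑ I : Fin j → Fin N, (∏ r, σ (I r)) ^ 2 = 1 := by
    simp only [← Finset.prod_pow]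
    rw [← Fintype.piFinset_univ, ← Finset.prod_univ_sum (fun _ => Finset.univ)
      (fun (_ : Fin j) (i : Fin N) => σ i ^ 2), sum_sq_eq_one hσ, Finset.prod_const_one]
  rwa [h2, one_mul] at h1

theorem iterCovDeriv_eventuallyEq_zero {v : Coord N → ℝ} {x : Coord N} (hv : v =ᶠ[𝓝 x] 0) (j : ℕ) :
    ∀ᶠ y in 𝓝 x, ∀ I, iterCovDeriv v j y I = 0 := by
  induction j with
  | zero => filter_upwards [hv] with y hy I using hy
  | succ j ih =>
    filter_upwards [ih.eventually_nhds] with y hy I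
    have h0 : ∀ I, (fun z => iterCovDeriv v j z I) =ᶠ[𝓝 y] fun _ => 0 := fun I => by
      filter_upwards [hy] with z hz using hz I
    simp only [iterCovDeriv, covDeriv]
    rw [(h0 _).fderiv_eq, fderiv_fun_const]
    simp [hy.self_of_nhds]

theorem continuousOn_covNormSq {v : Coord N → ℝ} (hv : ContDiff ℝ ∞ v) (j : ℕ) :
    ContinuousOn (covNormSq j v) (Metric.ball 0 1) := by
  unfold covNormSq
  refine ContinuousOn.mul (by fun_prop) (continuousOn_finsetSum _ fun I _ => ?_)
  exact ((contDiffOn_iterCovDeriv hv j I).continuousOn).pow 2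

theorem aemeasurable_covNormSq {v : Coord N → ℝ} (hv : ContDiff ℝ ∞ v) (j : ℕ) :
    AEMeasurable (covNormSq j v) (hypVol N) :=
  (((continuousOn_covNormSq hv j).aestronglyMeasurable measurableSet_ball).mono_ac
    (withDensity_absolutelyContinuous _ _)).aemeasurable

/-- The `L²` norm of a covariant derivative of a test function is finite. -/
theorem lintegral_covNormSq_lt_top {v : Coord N → ℝ} (hv : IsTest (Metric.ball 0 1) v) (j : ℕ) :
    ∫⁻ x, ENNReal.ofReal (covNormSq j v x) ∂(hypVol N) < ⊤ := by
  have hs : Function.support (covNormSq j v) ⊆ tsupport v := by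
    intro x hx
    by_contra h
    refine hx ?_
    have h0 := (iterCovDeriv_eventuallyEq_zero
      (notMem_tsupport_iff_eventuallyEq.1 h) j).self_of_nhds
    simp [covNormSq, h0]
  have h := memLp_one_iff_integrable.1 (memLp_of_continuousOn_of_support (p := 1) hv.2.1 hv.2.2
    ((continuousOn_covNormSq hv.1 j).mono hv.2.2) hs)
  exact lt_of_le_of_lt (lintegral_ofReal_le_lintegral_enorm _) h.2

/-! ### Hardy inequalities on a ray -/

theorem integrableOn_of_hasCompactSupport {f : ℝ → ℝ} (hf : Continuous f)
    (hs : HasCompactSupport f) (U : Set ℝ) : IntegrableOn f U :=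
  (hf.integrable_of_hasCompactSupport hs).integrableOn

/-- Hardy's inequality with the weights `coth^{2a+2} sinh^{p+2a+2}` and `coth^{2a} sinh^{p+2a+2}`
on the half-line, for functions that need not vanish at `0`. -/
theorem hardy_coth {f : ℝ → ℝ} (hf : ContDiff ℝ 1 f) (hs : HasCompactSupport f) (a p : ℕ) :
    ∫ s in Set.Ioi 0, f s ^ 2 * (Real.cosh s ^ (2 * a + 2) * Real.sinh s ^ p) ≤
      4 * ∫ s in Set.Ioi 0, deriv f s ^ 2 * (Real.cosh s ^ (2 * a) * Real.sinh s ^ (p + 2)) := by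
  have hfc := hf.continuous
  have hdc : Continuous (deriv f) := hf.continuous_deriv le_rfl
  have hsd : HasCompactSupport (deriv f) := hs.deriv
  -- the vector field whose divergence gives the inequality
  set V : ℝ → ℝ := fun s => f s ^ 2 * (Real.cosh s ^ (2 * a + 1) * Real.sinh s ^ (p + 1)) with hV
  have hVs : HasCompactSupport V := by
    have : HasCompactSupport (fun s => f s ^ 2) := hs.comp_left (g := fun y => y ^ 2) (by simp)
    exact this.mul_right
  have hVc : ContDiff ℝ 1 V := by rw [hV]; fun_prop
  have h0 : ∫ s in Set.Ioi 0, deriv V s = 0 := by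
    rw [hVs.integral_Ioi_deriv_eq hVc, hV]; simp
  have s2 : HasCompactSupport (fun s => f s ^ 2 * (Real.cosh s ^ (2 * a + 2) * Real.sinh s ^ p)) :=
    (hs.comp_left (g := fun y => y ^ 2) (by simp)).mul_right
  have s3 : HasCompactSupport
      (fun s => deriv f s ^ 2 * (Real.cosh s ^ (2 * a) * Real.sinh s ^ (p + 2))) :=
    (hsd.comp_left (g := fun y => y ^ 2) (by simp)).mul_right
  have i1 : IntegrableOn (deriv V) (Set.Ioi 0) :=
    integrableOn_of_hasCompactSupport (hVc.continuous_deriv le_rfl) hVs.deriv _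
  have i2 := integrableOn_of_hasCompactSupport (by fun_prop) s2 (Set.Ioi 0)
  have i3 := integrableOn_of_hasCompactSupport (by fun_prop) s3 (Set.Ioi 0)
  have key : ∫ s in Set.Ioi 0, f s ^ 2 * (Real.cosh s ^ (2 * a + 2) * Real.sinh s ^ p) ≤
      ∫ s in Set.Ioi 0, (2 * deriv V s +
        4 * (deriv f s ^ 2 * (Real.cosh s ^ (2 * a) * Real.sinh s ^ (p + 2)))) := by
    refine setIntegral_mono_on i2 ((i1.const_mul 2).add (i3.const_mul 4)) measurableSet_Ioi
      fun s hs0 => ?_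
    have hsh : 0 < Real.sinh s := Real.sinh_pos_iff.2 hs0
    have hch : 0 < Real.cosh s := Real.cosh_pos s
    have hd := (((hf.differentiable one_ne_zero s).hasDerivAt.pow 2).mul
      (((Real.hasDerivAt_cosh s).pow (2 * a + 1)).mul ((Real.hasDerivAt_sinh s).pow (p + 1))))
    have hd' : deriv V s = _ := hd.deriv
    rw [hd']
    simp only [Pi.mul_apply, Pi.pow_apply, Nat.cast_add, Nat.cast_mul,
      Nat.cast_ofNat, Nat.cast_one, Nat.add_one_sub_one]
    have hA : 0 ≤ Real.cosh s ^ (2 * a) * Real.sinh s ^ p := by positivity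
    have e : 2 * ((2 : ℝ) * f s ^ 1 * deriv f s *
          (Real.cosh s ^ (2 * a + 1) * Real.sinh s ^ (p + 1)) +
        f s ^ 2 * ((2 * (a : ℝ) + 1) * Real.cosh s ^ (2 * a) * Real.sinh s * Real.sinh s ^ (p + 1) +
          Real.cosh s ^ (2 * a + 1) * (((p : ℝ) + 1) * Real.sinh s ^ p * Real.cosh s))) +
        4 * (deriv f s ^ 2 * (Real.cosh s ^ (2 * a) * Real.sinh s ^ (p + 2))) -
        f s ^ 2 * (Real.cosh s ^ (2 * a + 2) * Real.sinh s ^ p) =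
        (Real.cosh s ^ (2 * a) * Real.sinh s ^ p) *
          ((2 * deriv f s * Real.sinh s + f s * Real.cosh s) ^ 2 +
            2 * (2 * a + 1) * (f s * Real.sinh s) ^ 2 + 2 * p * (f s * Real.cosh s) ^ 2) := by
      ring
    have hpos : 0 ≤ (Real.cosh s ^ (2 * a) * Real.sinh s ^ p) *
          ((2 * deriv f s * Real.sinh s + f s * Real.cosh s) ^ 2 +
            2 * (2 * a + 1) * (f s * Real.sinh s) ^ 2 + 2 * p * (f s * Real.cosh s) ^ 2) := by
      positivity
    rw [← sub_nonneg, e]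
    exact hpos
  rw [integral_add (i1.const_mul 2) (i3.const_mul 4), integral_const_mul, integral_const_mul, h0,
    mul_zero, zero_add] at key
  exact key

theorem contDiff_iteratedDeriv {f : ℝ → ℝ} (hf : ContDiff ℝ ∞ f) (i : ℕ) :
    ContDiff ℝ ∞ (iteratedDeriv i f) := by
  induction i with
  | zero => simpa using hf
  | succ i ih => rw [iteratedDeriv_succ]; exact (contDiff_infty_iff_deriv.1 ih).2

theorem hasCompactSupport_iteratedDeriv {f : ℝ → ℝ} (hf : HasCompactSupport f) (i : ℕ) :
    HasCompactSupport (iteratedDeriv i f) := by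
  induction i with
  | zero => simpa using hf
  | succ i ih => rw [iteratedDeriv_succ]; exact ih.deriv

/-- The powers of `coth` are removed one by one, each at the price of one derivative. -/
theorem hardy_coth_iterate {f : ℝ → ℝ} (hf : ContDiff ℝ ∞ f) (hs : HasCompactSupport f)
    (b i p : ℕ) :
    ∫ s in Set.Ioi 0, iteratedDeriv i f s ^ 2 * (Real.cosh s ^ (2 * b) * Real.sinh s ^ p) ≤
      4 ^ b * ∫ s in Set.Ioi 0, iteratedDeriv (i + b) f s ^ 2 * Real.sinh s ^ (p + 2 * b) := by
  induction b generalizing i p with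
  | zero => simp
  | succ b ih =>
    have h1 := hardy_coth ((contDiff_iteratedDeriv hf i).of_le (by exact_mod_cast le_top))
      (hasCompactSupport_iteratedDeriv hs i) b p
    rw [← iteratedDeriv_succ] at h1
    have h2 := ih (i + 1) (p + 2)
    rw [show i + 1 + b = i + (b + 1) by ring, show p + 2 + 2 * b = p + 2 * (b + 1) by ring] at h2
    rw [show 2 * (b + 1) = 2 * b + 2 by ring, pow_succ]
    rw [show 2 * (b + 1) = 2 * b + 2 by ring] at h2
    linarith

/-- The operators `f ↦ ∑ c_{b,i} coth^b f^{(i)}` on the half-line with `i ≥ 1` and `b + i ≤ d`. -/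
inductive RayOp : ℕ → ((ℝ → ℝ) → ℝ → ℝ) → Prop
  | mono (d b i : ℕ) (hi : 1 ≤ i) (h : b + i ≤ d) :
      RayOp d (fun f s => (Real.cosh s / Real.sinh s) ^ b * iteratedDeriv i f s)
  | add {d : ℕ} {S T : (ℝ → ℝ) → ℝ → ℝ} (hS : RayOp d S) (hT : RayOp d T) :
      RayOp d (fun f s => S f s + T f s)
  | smul {d : ℕ} {T : (ℝ → ℝ) → ℝ → ℝ} (c : ℝ) (hT : RayOp d T) : RayOp d (fun f s => c * T f s)

theorem RayOp.exists_deriv {d : ℕ} {T : (ℝ → ℝ) → ℝ → ℝ} (hT : RayOp d T) :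
    ∃ T', RayOp (d + 1) T' ∧ ∀ f, ContDiff ℝ ∞ f → ∀ s, 0 < s →
      HasDerivAt (T f) (T' f s) s := by
  induction hT with
  | mono b i hi h =>
    refine ⟨fun f s => (b : ℝ) * ((Real.cosh s / Real.sinh s) ^ (b - 1) * iteratedDeriv i f s) +
      ((-b : ℝ) * ((Real.cosh s / Real.sinh s) ^ (b + 1) * iteratedDeriv i f s) +
        (Real.cosh s / Real.sinh s) ^ b * iteratedDeriv (i + 1) f s),
      .add (.smul _ (.mono _ _ _ hi (by omega))) (.add (.smul _ (.mono _ _ _ hi (by omega)))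
        (.mono _ _ _ (by omega) (by omega))), fun f hf s hs => ?_⟩
    have hsh : Real.sinh s ≠ 0 := (Real.sinh_pos_iff.2 hs).ne'
    have h1 := (((Real.hasDerivAt_cosh s).fun_div (Real.hasDerivAt_sinh s) hsh).fun_pow b).mul
      ((contDiff_iteratedDeriv hf i).differentiable (by simp) s).hasDerivAt
    refine h1.congr_deriv ?_
    have e : (Real.sinh s * Real.sinh s - Real.cosh s * Real.cosh s) / Real.sinh s ^ 2 =
        1 - (Real.cosh s / Real.sinh s) ^ 2 := by field_simp
    rw [← iteratedDeriv_succ, e]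
    beta_reduce
    generalize Real.cosh s / Real.sinh s = q
    rcases b with _ | b
    · simp
    · rw [Nat.add_sub_cancel]
      ring
  | add hS hT ihS ihT =>
    obtain ⟨S', hS', hS''⟩ := ihS
    obtain ⟨T', hT', hT''⟩ := ihT
    exact ⟨_, .add hS' hT', fun f hf s hs => (hS'' f hf s hs).add (hT'' f hf s hs)⟩
  | smul c hT ih =>
    obtain ⟨T', hT', hT''⟩ := ih
    exact ⟨_, .smul c hT', fun f hf s hs => (hT'' f hf s hs).const_mul c⟩

theorem RayOp.exists_coth_mul {d : ℕ} {T : (ℝ → ℝ) → ℝ → ℝ} (hT : RayOp d T) :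
    ∃ T', RayOp (d + 1) T' ∧ ∀ f s, T' f s = Real.cosh s / Real.sinh s * T f s := by
  induction hT with
  | mono b i hi h =>
    exact ⟨_, .mono (d + 1) (b + 1) i hi (by omega), fun f s => by rw [pow_succ]; ring⟩
  | add hS hT ihS ihT =>
    obtain ⟨S', hS', hS''⟩ := ihS
    obtain ⟨T', hT', hT''⟩ := ihT
    exact ⟨_, .add hS' hT', fun f s => by rw [hS'', hT'']; ring⟩
  | smul c hT ih =>
    obtain ⟨T', hT', hT''⟩ := ih
    exact ⟨_, .smul c hT', fun f s => by rw [hT'']; ring⟩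

theorem RayOp.exists_sq_le {d : ℕ} {T : (ℝ → ℝ) → ℝ → ℝ} (hT : RayOp d T) :
    ∃ C : ℝ, 0 ≤ C ∧ ∀ f s, 0 < s → T f s ^ 2 ≤ C * ∑ i ∈ Finset.Icc 1 d,
      iteratedDeriv i f s ^ 2 * (Real.cosh s / Real.sinh s) ^ (2 * (d - i)) := by
  have hcoth : ∀ s : ℝ, 0 < s → 1 ≤ Real.cosh s / Real.sinh s := fun s hs => by
    rw [one_le_div (Real.sinh_pos_iff.2 hs)]; exact (Real.sinh_lt_cosh s).le
  induction hT with
  | mono b i hi h =>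
    refine ⟨1, zero_le_one, fun f s hs => ?_⟩
    have h1 := hcoth s hs
    have h2 : ((Real.cosh s / Real.sinh s) ^ b * iteratedDeriv i f s) ^ 2 ≤
        iteratedDeriv i f s ^ 2 * (Real.cosh s / Real.sinh s) ^ (2 * (d - i)) := by
      rw [mul_pow, ← pow_mul, mul_comm]
      exact mul_le_mul_of_nonneg_left (pow_le_pow_right₀ h1 (by omega)) (sq_nonneg _)
    rw [one_mul]
    refine h2.trans (Finset.single_le_sum (f := fun i => iteratedDeriv i f s ^ 2 *
      (Real.cosh s / Real.sinh s) ^ (2 * (d - i))) (fun i _ => ?_)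
      (Finset.mem_Icc.2 ⟨hi, by omega⟩))
    have := (zero_le_one.trans h1)
    positivity
  | add hS hT ihS ihT =>
    obtain ⟨C, hC, hC'⟩ := ihS
    obtain ⟨D, hD, hD'⟩ := ihT
    refine ⟨2 * C + 2 * D, by positivity, fun f s hs => ?_⟩
    have h1 := hC' f s hs
    have h2 := hD' f s hs
    rw [add_mul, mul_assoc, mul_assoc]
    refine (add_sq_le (a := _) (b := _)).trans ?_
    linarith
  | smul c hT ih =>
    obtain ⟨C, hC, hC'⟩ := ih
    refine ⟨c ^ 2 * C, by positivity, fun f s hs => ?_⟩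
    rw [mul_pow, mul_assoc]
    exact mul_le_mul_of_nonneg_left (hC' f s hs) (sq_nonneg c)

/-- The radial gradient of order `j ≥ 1` involves only derivatives of order at least one, with the
coefficient of `f^{(i)}` a polynomial in `coth` of degree at most `j - i`. -/
theorem exists_rayOp_rayGrad (N j : ℕ) (hj : 1 ≤ j) :
    ∃ T, RayOp j T ∧ ∀ f, ContDiff ℝ ∞ f → ∀ s, 0 < s → rayGrad N j f s = T f s := by
  induction j, hj using Nat.le_induction with
  | base =>
    refine ⟨_, .mono 1 0 1 le_rfl le_rfl, fun f hf s hs => ?_⟩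
    simp [rayGrad, iteratedDeriv_one]
  | succ j hj ih =>
    obtain ⟨T, hT, hTf⟩ := ih
    obtain ⟨T', hT', hTd⟩ := hT.exists_deriv
    obtain ⟨T'', hT'', hTc⟩ := hT.exists_coth_mul
    have hd : ∀ f, ContDiff ℝ ∞ f → ∀ s, 0 < s → deriv (rayGrad N j f) s = T' f s := by
      intro f hf s hs
      have : rayGrad N j f =ᶠ[𝓝 s] T f := by
        filter_upwards [lt_mem_nhds hs] with t ht using hTf f hf t ht
      rw [this.deriv_eq, (hTd f hf s hs).deriv]
    by_cases he : Even j
    · refine ⟨T', hT', fun f hf s hs => ?_⟩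
      simp only [rayGrad, he, if_true]
      exact hd f hf s hs
    · refine ⟨_, .add hT' (.smul ((N : ℝ) - 1) hT''), fun f hf s hs => ?_⟩
      simp only [rayGrad, he, if_false]
      rw [hd f hf s hs, hTf f hf s hs, hTc]
      ring

/-- The radial gradient of order `j` on a ray is controlled by the `j`-th derivative, as long as
Hardy's inequality applies. -/
theorem exists_lintegral_rayGrad_le (N j : ℕ) (hj : 2 * j ≤ N + 1) :
    ∃ C : ℝ, 0 ≤ C ∧ ∀ f, ContDiff ℝ ∞ f → HasCompactSupport f →
      ∫⁻ s in Set.Ioi 0, ENNReal.ofReal (rayGrad N j f s ^ 2 * Real.sinh s ^ (N - 1)) ≤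
        ENNReal.ofReal C *
          ∫⁻ s in Set.Ioi 0, ENNReal.ofReal (iteratedDeriv j f s ^ 2 * Real.sinh s ^ (N - 1)) := by
  rcases Nat.eq_zero_or_pos j with rfl | hj1
  · exact ⟨1, zero_le_one, fun f _ _ => by simp [rayGrad]⟩
  obtain ⟨T, hT, hTf⟩ := exists_rayOp_rayGrad N j hj1
  obtain ⟨C, hC, hCle⟩ := hT.exists_sq_le
  refine ⟨C * ∑ i ∈ Finset.Icc 1 j, 4 ^ (j - i), by positivity, fun f hf hs => ?_⟩
  have hW : ∀ s : ℝ, 0 < s → 0 ≤ Real.sinh s ^ (N - 1) := fun s hs =>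
    pow_nonneg (Real.sinh_pos_iff.2 hs).le _
  set E : ℕ → ℝ → ℝ := fun i s => iteratedDeriv i f s ^ 2 *
    (Real.cosh s ^ (2 * (j - i)) * Real.sinh s ^ (N - 1 - 2 * (j - i))) with hE
  have hEi : ∀ i, IntegrableOn (E i) (Set.Ioi 0) := fun i => by
    refine integrableOn_of_hasCompactSupport ?_ ?_ _
    · have := (contDiff_iteratedDeriv hf i).continuous
      fun_prop
    · exact ((hasCompactSupport_iteratedDeriv hs i).comp_left
        (g := fun y => y ^ 2) (by simp)).mul_right
  have hpt : ∀ s ∈ Set.Ioi (0 : ℝ), rayGrad N j f s ^ 2 * Real.sinh s ^ (N - 1) ≤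
      C * ∑ i ∈ Finset.Icc 1 j, E i s := by
    intro s hs0
    have hsh : Real.sinh s ≠ 0 := (Real.sinh_pos_iff.2 hs0).ne'
    rw [hTf f hf s hs0]
    refine (mul_le_mul_of_nonneg_right (hCle f s hs0) (hW s hs0)).trans (le_of_eq ?_)
    rw [mul_assoc, Finset.sum_mul]
    congr 1
    refine Finset.sum_congr rfl fun i hi => ?_
    have hi' := Finset.mem_Icc.1 hi
    rw [hE]
    simp only
    rw [div_pow, mul_assoc]
    congr 1
    have e : N - 1 = (N - 1 - 2 * (j - i)) + 2 * (j - i) := by omega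
    conv_lhs => rw [e, pow_add]
    field_simp
  have hbase : IntegrableOn (fun s => iteratedDeriv j f s ^ 2 * Real.sinh s ^ (N - 1))
      (Set.Ioi 0) := by
    refine integrableOn_of_hasCompactSupport ?_ ?_ _
    · have := (contDiff_iteratedDeriv hf j).continuous
      fun_prop
    · exact ((hasCompactSupport_iteratedDeriv hs j).comp_left
        (g := fun y => y ^ 2) (by simp)).mul_right
  have hint : ∫ s in Set.Ioi 0, C * ∑ i ∈ Finset.Icc 1 j, E i s ≤
      (C * ∑ i ∈ Finset.Icc 1 j, 4 ^ (j - i)) *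
        ∫ s in Set.Ioi 0, iteratedDeriv j f s ^ 2 * Real.sinh s ^ (N - 1) := by
    rw [integral_const_mul, integral_finsetSum _ fun i _ => hEi i, mul_assoc, Finset.sum_mul]
    refine mul_le_mul_of_nonneg_left (Finset.sum_le_sum fun i hi => ?_) hC
    have hi' := Finset.mem_Icc.1 hi
    have h := hardy_coth_iterate hf hs (j - i) i (N - 1 - 2 * (j - i))
    rwa [show i + (j - i) = j by omega,
      show N - 1 - 2 * (j - i) + 2 * (j - i) = N - 1 by omega] at h
  calc ∫⁻ s in Set.Ioi 0, ENNReal.ofReal (rayGrad N j f s ^ 2 * Real.sinh s ^ (N - 1))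
      ≤ ∫⁻ s in Set.Ioi 0, ENNReal.ofReal (C * ∑ i ∈ Finset.Icc 1 j, E i s) :=
        setLIntegral_mono' measurableSet_Ioi fun s hs0 => ENNReal.ofReal_le_ofReal (hpt s hs0)
    _ = ENNReal.ofReal (∫ s in Set.Ioi 0, C * ∑ i ∈ Finset.Icc 1 j, E i s) := by
        rw [ofReal_integral_eq_lintegral_ofReal
          ((integrable_finsetSum _ fun i _ => hEi i).const_mul C)]
        rw [EventuallyLE, ae_restrict_iff' measurableSet_Ioi]
        refine Eventually.of_forall fun s hs0 => ?_
        exact (mul_nonneg (sq_nonneg _) (hW s hs0)).trans (hpt s hs0)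
    _ ≤ _ := by
        rw [← ofReal_integral_eq_lintegral_ofReal hbase, ← ENNReal.ofReal_mul (by positivity)]
        · exact ENNReal.ofReal_le_ofReal hint
        · rw [EventuallyLE, ae_restrict_iff' measurableSet_Ioi]
          exact Eventually.of_forall fun s hs0 => mul_nonneg (sq_nonneg _) (hW s hs0)

/-! ### Radial gradients of Sobolev functions -/

theorem aestronglyMeasurable_radialGrad (hN : 0 < N) (j : ℕ) {v : Coord N → ℝ}
    (hv : ContDiffOn ℝ ∞ v (puncturedBall N)) :
    AEStronglyMeasurable (radialGrad j v) (hypVol N) :=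
  (hasWeakRadialGrad_radialGrad hN j hv).aestronglyMeasurable hN

/-- The radial gradient of order `j` is controlled by the `j`-th covariant derivative. -/
theorem exists_lintegral_radialGrad_le (hN : 0 < N) (j : ℕ) (hj : 2 * j ≤ N + 1) :
    ∃ C : ℝ, 0 ≤ C ∧ ∀ v : Coord N → ℝ, IsTest (Metric.ball 0 1) v →
      ∫⁻ x, ENNReal.ofReal (radialGrad j v x ^ 2) ∂(hypVol N) ≤
        ENNReal.ofReal C * ∫⁻ x, ENNReal.ofReal (covNormSq j v x) ∂(hypVol N) := by
  obtain ⟨C, hC, hCle⟩ := exists_lintegral_rayGrad_le N j hj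
  refine ⟨C, hC, fun v hv => ?_⟩
  rw [lintegral_sq_polar hN (aestronglyMeasurable_radialGrad hN j hv.1.contDiffOn).aemeasurable,
    lintegral_polar hN (aemeasurable_covNormSq hv.1 j).ennreal_ofReal,
    ← lintegral_const_mul' _ _ ENNReal.ofReal_ne_top]
  refine lintegral_mono fun σ => ?_
  have hσ : ‖(σ : Coord N)‖ = 1 := norm_eq_of_mem_sphere σ
  have h1 := hCle _ (hv.contDiff_ray (σ : Coord N)) (hv.hasCompactSupport_ray subset_rfl hσ)
  have e : ∫⁻ s in Set.Ioi 0, ENNReal.ofReal (radialGrad j v (polar s (σ : Coord N)) ^ 2 *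
      Real.sinh s ^ (N - 1)) = ∫⁻ s in Set.Ioi 0,
        ENNReal.ofReal (rayGrad N j (fun s => v (polar s (σ : Coord N))) s ^ 2 *
          Real.sinh s ^ (N - 1)) :=
    setLIntegral_congr_fun measurableSet_Ioi fun s hs => by
      rw [radialGrad_polar j v hσ hs]
  rw [e]
  refine h1.trans (mul_le_mul_right (setLIntegral_mono' measurableSet_Ioi fun s hs => ?_) _)
  have hW : 0 ≤ Real.sinh s ^ (N - 1) := pow_nonneg (Real.sinh_pos_iff.2 hs).le _
  rw [← ENNReal.ofReal_mul hW, mul_comm]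
  exact ENNReal.ofReal_le_ofReal
    (mul_le_mul_of_nonneg_left (sq_iteratedDeriv_ray_le hv.1 hσ j hs) hW)

theorem radialGrad_sub (j : ℕ) {u v : Coord N → ℝ} (hu : ContDiffOn ℝ ∞ u (puncturedBall N))
    (hv : ContDiffOn ℝ ∞ v (puncturedBall N)) {x : Coord N} (hx : x ∈ puncturedBall N) :
    radialGrad j (u - v) x = radialGrad j u x - radialGrad j v x := by
  induction j generalizing x with
  | zero => rfl
  | succ j ih =>
    have hd : ∀ {w : Coord N → ℝ}, ContDiffOn ℝ ∞ w (puncturedBall N) →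
        DifferentiableAt ℝ (radialGrad j w) x := fun hw =>
      ((contDiffOn_radialGrad j hw).contDiffAt
        ((isOpen_puncturedBall N).mem_nhds hx)).differentiableAt (by simp)
    have h1 : radialDeriv (radialGrad j (u - v)) x =
        radialDeriv (radialGrad j u) x - radialDeriv (radialGrad j v) x := by
      rw [radialDeriv_congr (v := fun x => radialGrad j u x - radialGrad j v x)
        (fun y hy => ih hy) hx, radialDeriv_eq_fderiv hx ((hd hu).fun_sub (hd hv)),
        radialDeriv_eq_fderiv hx (hd hu), radialDeriv_eq_fderiv hx (hd hv),
        fderiv_fun_sub (hd hu) (hd hv)]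
      simp only [sub_apply]
      ring
    simp only [radialGrad, gradStep]
    rw [h1, ih hx]
    split_ifs
    · rfl
    · ring

/-- Strong convergence in `L²` implies weak convergence. -/
theorem tendsto_integral_mul_of_tendsto_eLpNorm {α : Type*} [MeasurableSpace α] {μ : Measure α}
    {f : ℕ → α → ℝ} {g φ : α → ℝ} (hf : ∀ n, MemLp (f n) 2 μ) (hg : MemLp g 2 μ)
    (hφ : MemLp φ 2 μ) (h : Tendsto (fun n => eLpNorm (f n - g) 2 μ) atTop (𝓝 0)) :
    Tendsto (fun n => ∫ x, f n x * φ x ∂μ) atTop (𝓝 (∫ x, g x * φ x ∂μ)) := by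
  have h1 : Tendsto (fun n => (hf n).toLp (f n)) atTop (𝓝 (hg.toLp g)) := by
    rw [Lp.tendsto_Lp_iff_tendsto_eLpNorm']
    refine h.congr fun n => eLpNorm_congr_ae ?_
    filter_upwards [(hf n).coeFn_toLp, hg.coeFn_toLp] with x hx1 hx2
    rw [Pi.sub_apply, Pi.sub_apply, hx1, hx2]
  have h2 := Filter.Tendsto.inner (𝕜 := ℝ) (tendsto_const_nhds (x := hφ.toLp φ)) h1
  have e : ∀ {w : α → ℝ} (hw : MemLp w 2 μ),
      inner ℝ (hφ.toLp φ) (hw.toLp w) = ∫ x, w x * φ x ∂μ := by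
    intro w hw
    rw [L2.inner_def]
    refine integral_congr_ae ?_
    filter_upwards [hw.coeFn_toLp, hφ.coeFn_toLp] with x hx1 hx2
    rw [hx1, hx2]; rfl
  rw [e hg] at h2
  exact h2.congr fun n => e (hf n)

/-- Completeness of `L²`, for sequences of functions rather than of classes. -/
theorem exists_memLp_tendsto_of_cauchy {α : Type*} [MeasurableSpace α] {μ : Measure α}
    {f : ℕ → α → ℝ}
    (hf : ∀ n, MemLp (f n) 2 μ)
    (h : Tendsto (fun p : ℕ × ℕ => eLpNorm (f p.1 - f p.2) 2 μ) atTop (𝓝 0)) :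
    ∃ g, MemLp g 2 μ ∧ Tendsto (fun n => eLpNorm (f n - g) 2 μ) atTop (𝓝 0) := by
  have hc : CauchySeq fun n => (hf n).toLp (f n) := by
    rw [cauchySeq_iff_tendsto_dist_atTop_0]
    have h1 := (ENNReal.tendsto_toReal ENNReal.zero_ne_top).comp h
    rw [ENNReal.toReal_zero] at h1
    refine h1.congr fun p => ?_
    rw [Lp.dist_def, Function.comp]
    congr 1
    refine eLpNorm_congr_ae ?_
    filter_upwards [(hf p.1).coeFn_toLp, (hf p.2).coeFn_toLp] with x hx1 hx2
    rw [Pi.sub_apply, Pi.sub_apply, hx1, hx2]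
  obtain ⟨g, hg⟩ := cauchySeq_tendsto_of_complete hc
  refine ⟨g, Lp.memLp g, ?_⟩
  rw [Lp.tendsto_Lp_iff_tendsto_eLpNorm'] at hg
  refine hg.congr fun n => eLpNorm_congr_ae ?_
  filter_upwards [(hf n).coeFn_toLp] with x hx
  rw [Pi.sub_apply, Pi.sub_apply, hx]

/-- A function in `H^k` has square-integrable weak radial gradients of all orders `j ≤ k` with
`2 j ≤ N + 1`: they are the `L²` limits of those of the approximating test functions. -/
theorem radialEnergy_lt_top_of_memSobolev (hN : 0 < N) {k j : ℕ} (hjk : j ≤ k)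
    (hj : 2 * j ≤ N + 1) {u : Coord N → ℝ} (hu : MemSobolev N k u) : radialEnergy j u < ⊤ := by
  obtain ⟨hu2, v, hv, hvu, hcauchy⟩ := hu
  obtain ⟨C, hC, hCle⟩ := exists_lintegral_radialGrad_le hN j hj
  have hsm : ∀ n, ContDiffOn ℝ ∞ (v n) (puncturedBall N) := fun n => (hv n).1.contDiffOn
  have hw2 : ∀ n, MemLp (radialGrad j (v n)) 2 (hypVol N) := fun n =>
    memLp_two_of_lintegral_lt_top (aestronglyMeasurable_radialGrad hN j (hsm n))
      (lt_of_le_of_lt (hCle _ (hv n))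
        (ENNReal.mul_lt_top ENNReal.ofReal_lt_top (lintegral_covNormSq_lt_top (hv n) j)))
  have hC' : Tendsto (fun p : ℕ × ℕ =>
      eLpNorm (radialGrad j (v p.1) - radialGrad j (v p.2)) 2 (hypVol N) ^ 2) atTop (𝓝 0) := by
    have h1 := ENNReal.Tendsto.const_mul (a := ENNReal.ofReal C) (hcauchy j hjk)
      (Or.inr ENNReal.ofReal_ne_top)
    rw [mul_zero] at h1
    refine tendsto_of_tendsto_of_tendsto_of_le_of_le tendsto_const_nhds h1 (fun _ => zero_le)
      fun p => ?_
    rw [← lintegral_sq_eq_eLpNorm_sq]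
    refine le_trans (le_of_eq (lintegral_congr_ae ?_)) (hCle _ ((hv p.1).sub (hv p.2)))
    filter_upwards [ae_mem_puncturedBall hN] with x hx
    rw [radialGrad_sub j (hsm p.1) (hsm p.2) hx, Pi.sub_apply]
  have hC2 : Tendsto (fun p : ℕ × ℕ =>
      eLpNorm (radialGrad j (v p.1) - radialGrad j (v p.2)) 2 (hypVol N)) atTop (𝓝 0) := by
    have h1 := hC'.ennrpow_const (1 / 2)
    rw [ENNReal.zero_rpow_of_pos (by norm_num)] at h1
    refine h1.congr fun p => ?_
    rw [← ENNReal.rpow_two, ← ENNReal.rpow_mul]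
    norm_num
  obtain ⟨w, hw, hlim⟩ := exists_memLp_tendsto_of_cauchy hw2 hC2
  have hweak : HasWeakRadialGrad j u w := by
    refine ⟨hw.locallyIntegrableOn_puncturedBall, fun φ hφ => ?_⟩
    have hball : puncturedBall N ⊆ Metric.ball 0 1 := Set.sdiff_subset
    have h1 := tendsto_integral_mul_of_tendsto_eLpNorm hw2 hw (hφ.memLp hball) hlim
    have h2 := tendsto_integral_mul_of_tendsto_eLpNorm (fun n => (hv n).memLp subset_rfl) hu2
      ((hφ.radialGradAdj j).memLp hball) hvu
    refine tendsto_nhds_unique h1 (h2.congr fun n => ?_)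
    exact ((hasWeakRadialGrad_radialGrad hN j (hsm n)).2 φ hφ).symm
  refine lt_of_le_of_lt (radialEnergy_le hweak) ?_
  rw [lintegral_sq_eq_eLpNorm_sq]
  exact ENNReal.pow_lt_top hw.eLpNorm_lt_top

/-! ### Slowly modulated exponentials and optimality -/

/-- The ray profile `e^{-(N - 1) s / 2} χ(ε s)`. The exponential is the borderline case of
square-integrability for the volume `sinh^{N-1} s ds`, and the cutoff varies slowly for
small `ε`. -/
def slowProfile (N : ℕ) (χ : ℝ → ℝ) (ε s : ℝ) : ℝ :=
  Real.exp (-(((N : ℝ) - 1) / 2 * s)) * χ (ε * s)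

theorem isRayTest_slowProfile {χ : ℝ → ℝ} (hχ : ContDiff ℝ ∞ χ)
    (hs : ∀ t, t ∉ Set.Icc (1 : ℝ) 2 → χ t = 0) {ε : ℝ} (hε : 0 < ε) :
    IsRayTest (slowProfile N χ ε) := by
  have h0 : Function.support (slowProfile N χ ε) ⊆ Set.Icc (1 / ε) (2 / ε) := by
    intro s h
    by_contra hn
    refine h ?_
    rw [slowProfile, hs _ (fun h1 => hn ?_), mul_zero]
    exact ⟨by rw [div_le_iff₀ hε]; linarith [h1.1], by rw [le_div_iff₀ hε]; linarith [h1.2]⟩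
  have h1 : tsupport (slowProfile N χ ε) ⊆ Set.Icc (1 / ε) (2 / ε) :=
    closure_minimal h0 isClosed_Icc
  refine ⟨?_, HasCompactSupport.of_support_subset_isCompact isCompact_Icc h0, fun s h => ?_⟩
  · exact ContDiff.mul (by fun_prop) (hχ.comp (by fun_prop))
  · exact lt_of_lt_of_le (by positivity) (h1 h).1

theorem hasDerivAt_coth {s : ℝ} (hs : 0 < s) :
    HasDerivAt (fun s => Real.cosh s / Real.sinh s)
      (1 - (Real.cosh s / Real.sinh s) ^ 2) s := by
  have hsh : Real.sinh s ≠ 0 := (Real.sinh_pos_iff.2 hs).ne'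
  refine ((Real.hasDerivAt_cosh s).fun_div (Real.hasDerivAt_sinh s) hsh).congr_deriv ?_
  field_simp

/-- On slow profiles the radial gradients act through a symbol `G`, a smooth function of `ε`, of
`coth s - 1` and of the slow variable `t = ε s`. Both `ε` and `coth s - 1` vanish in the limit,
where the symbol reduces to multiplication by `± ((N - 1) / 2) ^ j`. -/
theorem exists_symbol_rayGrad (N j : ℕ) {χ : ℝ → ℝ} (hχ : ContDiff ℝ ∞ χ)
    (hs : ∀ t, t ∉ Set.Icc (1 : ℝ) 2 → χ t = 0) :
    ∃ G : ℝ × ℝ × ℝ → ℝ, ContDiff ℝ ∞ G ∧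
      (∀ z : ℝ × ℝ × ℝ, z.2.2 ∉ Set.Icc (1 : ℝ) 2 → G z = 0) ∧
      (∀ t, G (0, 0, t) ^ 2 = (((N : ℝ) - 1) / 2) ^ (2 * j) * χ t ^ 2) ∧
      ∀ ε s, 0 < s → rayGrad N j (slowProfile N χ ε) s =
        Real.exp (-(((N : ℝ) - 1) / 2 * s)) * G (ε, Real.cosh s / Real.sinh s - 1, ε * s) := by
  set c : ℝ := ((N : ℝ) - 1) / 2 with hc
  have hN2 : (N : ℝ) - 1 = 2 * c := by rw [hc]; ring
  induction j with
  | zero =>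
    refine ⟨fun z => χ z.2.2, hχ.comp (by fun_prop), fun z hz => hs _ hz, fun t => by simp,
      fun ε s _ => rfl⟩
  | succ j ih =>
    obtain ⟨G, hG, hG0, hGlim, hGeq⟩ := ih
    -- along the ray, `coth s - 1` has derivative `-q (q + 2)` at the value `q`
    refine ⟨fun z => fderiv ℝ G z (0, -(z.2.1 * (z.2.1 + 2)), z.1) +
      (if Even j then -c * G z else c * G z + 2 * c * z.2.1 * G z), ?_, ?_, ?_, ?_⟩
    · refine ContDiff.add ((hG.fderiv_right (by simp)).clm_apply (by fun_prop)) ?_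
      split_ifs
      · fun_prop
      · fun_prop
    · intro z hz
      have hev : G =ᶠ[𝓝 z] fun _ => 0 := by
        have ho : IsOpen {z : ℝ × ℝ × ℝ | z.2.2 ∉ Set.Icc (1 : ℝ) 2} :=
          isClosed_Icc.isOpen_compl.preimage (by fun_prop : Continuous fun z : ℝ × ℝ × ℝ => z.2.2)
        filter_upwards [ho.mem_nhds hz] with y hy using hG0 y hy
      simp only [hev.fderiv_eq, hG0 z hz]
      simp
    · intro t
      have hz : ((0 : ℝ), (0 : ℝ), (0 : ℝ)) = 0 := rfl
      simp only [mul_zero, zero_mul, add_zero, neg_zero]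
      rw [hz, map_zero, zero_add]
      have e : (if Even j then -c * G (0, 0, t) else c * G (0, 0, t)) ^ 2 =
          c ^ 2 * G (0, 0, t) ^ 2 := by
        split_ifs <;> ring
      rw [e, hGlim]
      ring
    · intro ε s hs0
      have hd : HasDerivAt (fun s => G (ε, Real.cosh s / Real.sinh s - 1, ε * s))
          (fderiv ℝ G (ε, Real.cosh s / Real.sinh s - 1, ε * s)
            (0, 1 - (Real.cosh s / Real.sinh s) ^ 2, ε)) s := by
        have h1 := (hasDerivAt_const s ε).prodMk
          (((hasDerivAt_coth hs0).sub_const 1).prodMk ((hasDerivAt_id s).const_mul ε))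
        rw [mul_one] at h1
        exact ((hG.differentiable (by simp)) _).hasFDerivAt.comp_hasDerivAt s h1
      have he : HasDerivAt (fun s => Real.exp (-(c * s))) (Real.exp (-(c * s)) * -c) s := by
        have := (((hasDerivAt_id s).const_mul c).neg).exp
        rwa [mul_one] at this
      have hev : rayGrad N j (slowProfile N χ ε) =ᶠ[𝓝 s] fun s =>
          Real.exp (-(c * s)) * G (ε, Real.cosh s / Real.sinh s - 1, ε * s) := by
        filter_upwards [lt_mem_nhds hs0] with y hy using hGeq ε y hy
      simp only [rayGrad]
      rw [hev.deriv_eq, (he.fun_mul hd).deriv, hGeq ε s hs0, hN2]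
      have e : 1 - (Real.cosh s / Real.sinh s) ^ 2 = -((Real.cosh s / Real.sinh s - 1) *
          (Real.cosh s / Real.sinh s - 1 + 2)) := by ring
      rw [← e]
      split_ifs <;> ring

theorem coth_sub_one_eq {s : ℝ} (hs : 0 < s) :
    Real.cosh s / Real.sinh s - 1 = Real.exp (-s) / Real.sinh s := by
  have hsh : Real.sinh s ≠ 0 := (Real.sinh_pos_iff.2 hs).ne'
  rw [← Real.cosh_sub_sinh]
  field_simp

theorem coth_sub_one_le {s : ℝ} (hs : 1 ≤ s) :
    Real.cosh s / Real.sinh s - 1 ≤ Real.exp (-s) := by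
  rw [coth_sub_one_eq (by linarith)]
  exact div_le_self (Real.exp_pos _).le (hs.trans (Real.self_le_sinh_iff.2 (by linarith)))

/-- As `ε → 0`, every radial gradient of the slow profile contributes, after rescaling, a factor
`((N - 1) / 2)²` to the energy on a ray. -/
theorem tendsto_lintegral_rayGrad_slowProfile (hN : 0 < N) (j : ℕ) {χ : ℝ → ℝ}
    (hχ : ContDiff ℝ ∞ χ) (hs : ∀ t, t ∉ Set.Icc (1 : ℝ) 2 → χ t = 0) :
    Tendsto (fun ε => ENNReal.ofReal ε * ∫⁻ s in Set.Ioi 0,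
        ENNReal.ofReal (rayGrad N j (slowProfile N χ ε) s ^ 2 * Real.sinh s ^ (N - 1)))
      (𝓝[>] 0) (𝓝 (ENNReal.ofReal ((((N : ℝ) - 1) / 2) ^ (2 * j)) *
        ∫⁻ t in Set.Ioi 0, ENNReal.ofReal (χ t ^ 2 * (1 / 2) ^ (N - 1)))) := by
  obtain ⟨G, hG, hG0, hGlim, hGeq⟩ := exists_symbol_rayGrad N j hχ hs
  set c : ℝ := ((N : ℝ) - 1) / 2 with hc
  set F : ℝ → ℝ → ℝ := fun ε t =>
    G (ε, Real.cosh (t / ε) / Real.sinh (t / ε) - 1, t) ^ 2 *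
      ((1 - Real.exp (-(2 * (t / ε)))) / 2) ^ (N - 1) with hF
  -- substitute `t = ε s`; the weight `e^{-(N - 1) s} sinh^{N - 1} s` is bounded
  have hsub : ∀ ε : ℝ, 0 < ε → ENNReal.ofReal ε * ∫⁻ s in Set.Ioi 0,
        ENNReal.ofReal (rayGrad N j (slowProfile N χ ε) s ^ 2 * Real.sinh s ^ (N - 1)) =
      ∫⁻ t in Set.Ioi 0, ENNReal.ofReal (F ε t) := by
    intro ε hε
    have himg : (fun s => ε * s) '' Set.Ioi 0 = Set.Ioi 0 := by
      rw [Set.image_mul_left_Ioi hε, mul_zero]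
    have h1 := lintegral_image_eq_lintegral_abs_deriv_mul (s := Set.Ioi (0 : ℝ))
      measurableSet_Ioi (f := fun s => ε * s) (f' := fun _ => ε)
      (fun x _ => by simpa using ((hasDerivAt_id x).const_mul ε).hasDerivWithinAt)
      (fun x _ y _ h => mul_left_cancel₀ hε.ne' h) (fun t => ENNReal.ofReal (F ε t))
    rw [himg] at h1
    rw [h1, abs_of_pos hε, lintegral_const_mul' _ _ ENNReal.ofReal_ne_top]
    congr 1
    refine setLIntegral_congr_fun measurableSet_Ioi fun s hs0 => ?_
    have e0 : ε * s / ε = s := mul_div_cancel_left₀ s hε.ne'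
    have e1 : Real.exp (-(c * s)) ^ 2 * Real.sinh s ^ (N - 1) =
        ((1 - Real.exp (-(2 * s))) / 2) ^ (N - 1) := by
      have e2 : Real.exp (-(c * s)) ^ 2 = Real.exp (-s) ^ (N - 1) := by
        rw [← Real.exp_nat_mul, ← Real.exp_nat_mul, Nat.cast_sub hN, hc]
        congr 1
        push_cast
        ring
      rw [e2, ← mul_pow, Real.sinh_eq, mul_div_assoc', mul_sub, ← Real.exp_add, ← Real.exp_add,
        neg_add_cancel, Real.exp_zero]
      congr 4
      ring
    simp only [hF, hGeq ε s hs0, e0]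
    congr 1
    rw [← e1]
    ring
  -- a common bound on `0 < ε < 1`
  obtain ⟨M, hM⟩ := ((isCompact_Icc (a := (0 : ℝ)) (b := 1)).prod
    ((isCompact_Icc (a := (0 : ℝ)) (b := 1)).prod
      (isCompact_Icc (a := (1 : ℝ)) (b := 2)))).exists_bound_of_continuousOn
        hG.continuous.continuousOn
  have hw : ∀ s : ℝ, 0 ≤ s → 0 ≤ (1 - Real.exp (-(2 * s))) / 2 ∧
      (1 - Real.exp (-(2 * s))) / 2 ≤ 1 := by
    intro s hs0
    have h1 : Real.exp (-(2 * s)) ≤ 1 := Real.exp_le_one_iff.2 (by linarith)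
    have h2 := Real.exp_pos (-(2 * s))
    constructor <;> linarith
  have hq : ∀ s : ℝ, 1 ≤ s → 0 ≤ Real.cosh s / Real.sinh s - 1 := by
    intro s h
    rw [coth_sub_one_eq (by linarith)]
    exact div_nonneg (Real.exp_pos _).le (Real.sinh_pos_iff.2 (by linarith)).le
  have hbound : ∀ ε : ℝ, 0 < ε → ε < 1 → ∀ t ∈ Set.Ioi (0 : ℝ), ENNReal.ofReal (F ε t) ≤
      (Set.Icc (1 : ℝ) 2).indicator (fun _ => ENNReal.ofReal (M ^ 2)) t := by
    intro ε hε hε1 t ht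
    by_cases h : t ∈ Set.Icc (1 : ℝ) 2
    · rw [Set.indicator_of_mem h]
      have h1 : 1 ≤ t / ε := by rw [le_div_iff₀ hε]; linarith [h.1]
      have h2 := hM (ε, Real.cosh (t / ε) / Real.sinh (t / ε) - 1, t)
        ⟨⟨hε.le, hε1.le⟩, ⟨hq _ h1, (coth_sub_one_le h1).trans
          (Real.exp_le_one_iff.2 (by linarith))⟩, h⟩
      obtain ⟨h3, h4⟩ := hw (t / ε) (by linarith)
      refine ENNReal.ofReal_le_ofReal ?_
      refine (mul_le_of_le_one_right (sq_nonneg _) (pow_le_one₀ h3 h4)).trans ?_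
      rw [← sq_abs]
      exact pow_le_pow_left₀ (abs_nonneg _) h2 2
    · simp only [hF, Set.indicator_of_notMem h]
      rw [hG0 _ h]
      simp
  have hev1 : ∀ᶠ ε : ℝ in 𝓝[>] 0, 0 < ε ∧ ε < 1 := Ioo_mem_nhdsGT one_pos
  have hlim : ∀ t ∈ Set.Ioi (0 : ℝ), Tendsto (fun ε => ENNReal.ofReal (F ε t)) (𝓝[>] 0)
      (𝓝 (ENNReal.ofReal (c ^ (2 * j) * (χ t ^ 2 * (1 / 2) ^ (N - 1))))) := by
    intro t ht
    have hinf : Tendsto (fun ε : ℝ => t / ε) (𝓝[>] 0) atTop :=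
      tendsto_inv_nhdsGT_zero.const_mul_atTop ht
    have hexp : Tendsto (fun ε : ℝ => Real.exp (-(t / ε))) (𝓝[>] 0) (𝓝 0) :=
      Real.tendsto_exp_neg_atTop_nhds_zero.comp hinf
    have hexp2 : Tendsto (fun ε : ℝ => Real.exp (-(2 * (t / ε)))) (𝓝[>] 0) (𝓝 0) :=
      Real.tendsto_exp_neg_atTop_nhds_zero.comp (hinf.const_mul_atTop two_pos)
    have hqlim : Tendsto (fun ε : ℝ => Real.cosh (t / ε) / Real.sinh (t / ε) - 1) (𝓝[>] 0)
        (𝓝 0) := by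
      refine tendsto_of_tendsto_of_tendsto_of_le_of_le' tendsto_const_nhds hexp ?_ ?_
      · filter_upwards [hinf.eventually_ge_atTop 1] with ε h using hq _ h
      · filter_upwards [hinf.eventually_ge_atTop 1] with ε h using coth_sub_one_le h
    have hid : Tendsto (fun ε : ℝ => ε) (𝓝[>] 0) (𝓝 0) := tendsto_id.mono_left nhdsWithin_le_nhds
    have h1 : Tendsto (fun ε : ℝ => G (ε, Real.cosh (t / ε) / Real.sinh (t / ε) - 1, t))
        (𝓝[>] 0) (𝓝 (G (0, 0, t))) :=
      (hG.continuous.tendsto _).comp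
        (hid.prodMk_nhds (hqlim.prodMk_nhds (tendsto_const_nhds (x := t))))
    have h2 := (h1.pow 2).mul (((hexp2.const_sub 1).div_const 2).pow (N - 1))
    rw [hGlim, sub_zero, mul_assoc] at h2
    exact ENNReal.tendsto_ofReal h2
  have hkey := tendsto_lintegral_filter_of_dominated_convergence
    (μ := volume.restrict (Set.Ioi (0 : ℝ))) (l := 𝓝[>] (0 : ℝ))
    (F := fun ε t => ENNReal.ofReal (F ε t))
    ((Set.Icc (1 : ℝ) 2).indicator (fun _ => ENNReal.ofReal (M ^ 2)))
    (Eventually.of_forall fun ε => by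
      have hm : Measurable fun t : ℝ => G (ε, Real.cosh (t / ε) / Real.sinh (t / ε) - 1, t) := by
        have := hG.continuous.measurable
        fun_prop
      simp only [hF]
      exact ((hm.pow_const 2).mul (by fun_prop)).ennreal_ofReal)
    (by
      filter_upwards [hev1] with ε hε
      exact (ae_restrict_iff' measurableSet_Ioi).2 (Eventually.of_forall (hbound ε hε.1 hε.2)))
    (by
      rw [lintegral_indicator_const measurableSet_Icc]
      refine (ENNReal.mul_lt_top ENNReal.ofReal_lt_top
        (lt_of_le_of_lt (Measure.restrict_apply_le _ _) ?_)).ne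
      exact isCompact_Icc.measure_lt_top)
    ((ae_restrict_iff' measurableSet_Ioi).2 (Eventually.of_forall hlim))
  have hc0 : 0 ≤ c ^ (2 * j) := by rw [pow_mul]; positivity
  simp only [ENNReal.ofReal_mul hc0] at hkey
  rw [lintegral_const_mul' _ _ ENNReal.ofReal_ne_top] at hkey
  refine hkey.congr' ?_
  filter_upwards [hev1] with ε hε using (hsub ε hε.1).symm

theorem IsTest.radialGrad {v : Coord N → ℝ} (hv : IsTest (puncturedBall N) v) (j : ℕ) :
    IsTest (puncturedBall N) (radialGrad j v) := by
  induction j with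
  | zero => exact hv
  | succ j ih =>
    by_cases h : Even j
    · have e : HypRadial.radialGrad (j + 1) v =
          HypRadial.radialDeriv (HypRadial.radialGrad j v) := by
        funext x
        simp only [HypRadial.radialGrad, gradStep, if_pos h]
      rw [e]
      exact ih.radialDeriv
    · have e : HypRadial.radialGrad (j + 1) v =
          -HypRadial.radialDerivAdj (HypRadial.radialGrad j v) := by
        funext x
        simp only [HypRadial.radialGrad, gradStep, if_neg h, Pi.neg_apply,
          HypRadial.radialDerivAdj, neg_neg]
      rw [e]
      exact ih.radialDerivAdj.neg

theorem IsTest.radialEnergy_lt_top (hN : 0 < N) {v : Coord N → ℝ}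
    (hv : IsTest (puncturedBall N) v) (j : ℕ) : radialEnergy j v < ⊤ := by
  refine (radialEnergy_le (hasWeakRadialGrad_radialGrad hN j hv.1.contDiffOn)).trans_lt ?_
  rw [lintegral_sq_eq_eLpNorm_sq]
  exact ENNReal.pow_lt_top ((hv.radialGrad j).memLp Set.sdiff_subset).eLpNorm_lt_top

theorem IsTest.memSobolev {u : Coord N → ℝ} (hu : IsTest (Metric.ball 0 1) u) (k : ℕ) :
    MemSobolev N k u := by
  refine ⟨hu.memLp subset_rfl, fun _ => u, fun _ => hu, ?_, fun j _ => ?_⟩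
  · simp
  · have h0 : ∀ x, covNormSq j (u - u) x = 0 := fun x => by
      have h := (iterCovDeriv_eventuallyEq_zero (v := u - u) (x := x)
        (by rw [sub_self]) j).self_of_nhds
      simp only [covNormSq, h, ne_eq, OfNat.ofNat_ne_zero, not_false_eq_true, zero_pow,
        Finset.sum_const_zero, mul_zero]
    simp only [h0, ENNReal.ofReal_zero, lintegral_zero, tendsto_const_nhds]

/-- The energy of a radial function is the area of the sphere times a ray integral. -/
theorem radialEnergy_sepVar_one (hN : 0 < N) (j : ℕ) {a : ℝ → ℝ} (ha : IsRayTest a) :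
    radialEnergy j (sepVar a fun _ : Coord N => 1) = sphereVol N Set.univ *
      ∫⁻ s in Set.Ioi 0, ENNReal.ofReal (rayGrad N j a s ^ 2 * Real.sinh s ^ (N - 1)) := by
  have hu : IsTest (puncturedBall N) (sepVar a fun _ : Coord N => 1) :=
    isTest_sepVar ha contDiff_const
  have hw := hasWeakRadialGrad_radialGrad hN j hu.1.contDiffOn
  rw [radialEnergy_eq hN hw, lintegral_sq_polar hN (hw.aestronglyMeasurable hN).aemeasurable,
    mul_comm, ← lintegral_const]
  refine lintegral_congr fun σ => setLIntegral_congr_fun measurableSet_Ioi fun s hs => ?_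
  have hσ : ‖(σ : Coord N)‖ = 1 := norm_eq_of_mem_sphere σ
  have e : Set.EqOn (fun s => sepVar a (fun _ : Coord N => 1) (polar s (σ : Coord N))) a
      (Set.Ioi 0) := fun s hs => by
    simp only [sepVar_polar a (fun _ : Coord N => 1) hs hσ, mul_one]
  simp only [radialGrad_polar j _ hσ hs, rayGrad_congr j e hs]

theorem sphereVol_univ_ne_zero (hN : 0 < N) : sphereVol N Set.univ ≠ 0 := by
  have : Nonempty (Fin N) := ⟨⟨0, hN⟩⟩
  simp only [sphereVol]
  rw [Measure.toSphere_apply_univ]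
  refine mul_ne_zero ?_ (Metric.measure_ball_pos volume _ one_pos).ne'
  simp [hN.ne']

/-- The constant in the radial Poincaré inequality is optimal. -/
theorem exists_radialEnergy_lt (hN : 2 ≤ N) {k l : ℕ} (hlk : l < k) {Λ : ℝ}
    (hΛ : (((N : ℝ) - 1) / 2) ^ (2 * (k - l)) < Λ) :
    ∃ u : Coord N → ℝ, MemSobolev N k u ∧ (∀ j, radialEnergy j u < ⊤) ∧
      radialEnergy k u < ENNReal.ofReal Λ * radialEnergy l u := by
  have hN0 : 0 < N := by omega
  have hc : 0 < ((N : ℝ) - 1) / 2 := by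
    have : (2 : ℝ) ≤ N := by exact_mod_cast hN
    linarith
  set c : ℝ := ((N : ℝ) - 1) / 2
  let χ : ContDiffBump (3 / 2 : ℝ) := ⟨1 / 4, 1 / 2, by norm_num, by norm_num⟩
  have hs : ∀ t, t ∉ Set.Icc (1 : ℝ) 2 → χ t = 0 := fun t ht => by
    refine χ.zero_of_le_dist ?_
    by_contra h
    rw [not_le, Real.dist_eq, abs_lt] at h
    have h1 := h.1
    have h2 := h.2
    simp only [χ] at h1 h2
    exact ht ⟨by linarith, by linarith⟩
  have hχ : ContDiff ℝ ∞ χ := χ.contDiff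
  set I : ℝ≥0∞ := ∫⁻ t in Set.Ioi 0, ENNReal.ofReal (χ t ^ 2 * (1 / 2) ^ (N - 1)) with hI
  have hItop : I < ⊤ := by
    have h1 : I ≤ ∫⁻ t in Set.Ioi 0, (Set.Icc (1 : ℝ) 2).indicator (fun _ => 1) t := by
      refine lintegral_mono fun t => ?_
      by_cases h : t ∈ Set.Icc (1 : ℝ) 2
      · rw [Set.indicator_of_mem h]
        refine ENNReal.ofReal_le_one.2 (mul_le_one₀ ?_ (by positivity) ?_)
        · exact pow_le_one₀ χ.nonneg χ.le_one
        · exact pow_le_one₀ (by norm_num) (by norm_num)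
      · simp [hs t h]
    refine h1.trans_lt ?_
    rw [lintegral_indicator_const measurableSet_Icc, one_mul]
    exact (Measure.restrict_apply_le _ _).trans_lt isCompact_Icc.measure_lt_top
  have hIpos : I ≠ 0 := by
    have h1 : ENNReal.ofReal ((1 / 2) ^ (N - 1)) * volume (Set.Ioo (3 / 2 : ℝ) (7 / 4)) ≤ I := by
      rw [← setLIntegral_const]
      refine le_trans (le_of_eq ?_) (lintegral_mono_set (s := Set.Ioo (3 / 2 : ℝ) (7 / 4))
        fun t ht => lt_trans (by norm_num) ht.1)
      refine setLIntegral_congr_fun measurableSet_Ioo fun t ht => ?_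
      have : χ t = 1 := by
        refine χ.one_of_mem_closedBall ?_
        rw [Metric.mem_closedBall, Real.dist_eq, abs_le]
        simp only [χ]
        constructor <;> linarith [ht.1, ht.2]
      simp only [this, one_pow, one_mul]
    refine (lt_of_lt_of_le (ENNReal.mul_pos ?_ ?_) h1).ne'
    · exact (ENNReal.ofReal_pos.2 (by positivity)).ne'
    · rw [Real.volume_Ioo]
      exact (ENNReal.ofReal_pos.2 (by norm_num)).ne'
  have hlk2 := tendsto_lintegral_rayGrad_slowProfile hN0 k hχ hs
  have hll := ENNReal.Tendsto.const_mul (a := ENNReal.ofReal Λ)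
    (tendsto_lintegral_rayGrad_slowProfile hN0 l hχ hs) (Or.inr ENNReal.ofReal_ne_top)
  have hlt : ENNReal.ofReal (c ^ (2 * k)) * I < ENNReal.ofReal Λ *
      (ENNReal.ofReal (c ^ (2 * l)) * I) := by
    have hcl : 0 < c ^ (2 * l) := by positivity
    have hΛ0 : 0 < Λ := lt_of_le_of_lt (by positivity) hΛ
    rw [← mul_assoc, ← ENNReal.ofReal_mul hΛ0.le]
    refine ENNReal.mul_lt_mul_left hIpos hItop.ne ?_
    refine (ENNReal.ofReal_lt_ofReal_iff (by positivity)).2 ?_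
    have e : c ^ (2 * k) = c ^ (2 * (k - l)) * c ^ (2 * l) := by
      rw [← pow_add]; congr 1; omega
    rw [e]
    exact mul_lt_mul_of_pos_right hΛ hcl
  obtain ⟨ε, hε, hε0⟩ := ((hlk2.eventually_lt hll hlt).and self_mem_nhdsWithin).exists
  have hfε := isRayTest_slowProfile (N := N) hχ hs hε0
  have hu : IsTest (puncturedBall N) (sepVar (slowProfile N χ ε) fun _ : Coord N => 1) :=
    isTest_sepVar hfε contDiff_const
  have hub : IsTest (Metric.ball 0 1) (sepVar (slowProfile N χ ε) fun _ : Coord N => 1) :=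
    ⟨hu.1, hu.2.1, hu.2.2.trans Set.sdiff_subset⟩
  refine ⟨_, hub.memSobolev k, hu.radialEnergy_lt_top hN0, ?_⟩
  have hε1 : ENNReal.ofReal ε ≠ 0 := (ENNReal.ofReal_pos.2 hε0).ne'
  rw [radialEnergy_sepVar_one hN0 k hfε, radialEnergy_sepVar_one hN0 l hfε, mul_left_comm]
  refine ENNReal.mul_lt_mul_right (sphereVol_univ_ne_zero hN0) (measure_ne_top _ _) ?_
  rw [mul_left_comm] at hε
  exact lt_of_mul_lt_mul_left' hε

end HypRadial

end

theorem mainTheorem1 (N k l : ℕ) (hN : 3 ≤ N) (hlk : l < k) :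
    (∀ u : HypRadial.Coord N → ℝ, HypRadial.MemSobolev N k u →
      (∀ j < k, HypRadial.radialEnergy j u < ⊤) →
      ENNReal.ofReal ((((N : ℝ) - 1) / 2) ^ (2 * (k - l))) * HypRadial.radialEnergy l u
        ≤ HypRadial.radialEnergy k u) ∧
    (2 * k ≤ N + 1 → ∀ u : HypRadial.Coord N → ℝ, HypRadial.MemSobolev N k u →
      ∀ j ≤ k, HypRadial.radialEnergy j u < ⊤) ∧
    (∀ Λ : ℝ, (((N : ℝ) - 1) / 2) ^ (2 * (k - l)) < Λ →
      ∃ u : HypRadial.Coord N → ℝ, HypRadial.MemSobolev N k u ∧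
        (∀ j ≤ k, HypRadial.radialEnergy j u < ⊤) ∧
        HypRadial.radialEnergy k u < ENNReal.ofReal Λ * HypRadial.radialEnergy l u) := by
  refine ⟨fun u _ hfin => HypRadial.poincare_radialEnergy (by omega) hlk hfin,
    fun hk u hu j hj => HypRadial.radialEnergy_lt_top_of_memSobolev (by omega) hj (by omega) hu,
    fun Λ hΛ => ?_⟩
  obtain ⟨u, hu, hfin, hlt⟩ := HypRadial.exists_radialEnergy_lt (by omega) hlk hΛ
  exact ⟨u, hu, fun j _ => hfin j, hlt⟩
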